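/- Let $k>0$, $R\ge R_0>0$, $\delta>0$, and write $\Omega^R=\mathbb R^2\times(0,R)$, $\Omega_0^R=(-\pi,\pi)^2\times(0,R)$, $\Gamma_0^s=(-\pi,\pi)^2\times\{s\}$. Let $\varepsilon_r\in W^{1,\infty}(\Omega^R;\mathbb C)$ and $\mu_r\in L^\infty(\Omega^R;\mathbb C)$ be $2\pi$-periodic in $x_1,x_2$, with $\operatorname{Re}\varepsilon_r\ge\varepsilon_0>0$ and $\operatorname{Re}\mu_r\ge\mu_0>0$ almost everywhere and $\varepsilon_r=\mu_r=1$ for $x_3>R_0-\delta$. Let $\alpha\in[-\tfrac12,\tfrac12]^2$, put $\alpha_j=\alpha+j$ for $j\in\mathbb Z^2$, and assume $|\alpha_j|\ne k$ for all $j$. Let $\beta_j=\sqrt{k^2-|\alpha_j|^2}$ with $\operatorname{Re}\beta_j,\operatorname{Im}\beta_j\ge0$. All fields are $\alpha$-quasi-periodic in $\Omega^R$, i.e. $u(x+2\pi(j,0))=e^{-2\pi i\alpha\cdot j}u(x)$; the index $\alpha$ on a space refers to this, derivatives are taken weakly in $\Omega^R$ and norms over $\Omega_0^R$. Distributions on $\Gamma_0^R$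 are expanded as $\varphi=\frac1{2\pi}\sum_j\hat\varphi_j e^{-i\alpha_j\cdot(x_1,x_2)}$, and $H^s_\alpha(\Gamma_0^R)$ has the squared norm $\sum_j(1+|\alpha_j|^2)^s|\hat\varphi_j|^2$. For tangential fields $\varphi$ define $\widehat{(N_\alpha\varphi)}_j=-\frac{i\alpha_j}{\beta_j}(\alpha_j\cdot\hat\varphi_j)$, $\widehat{(T_\alpha\varphi)}_j=i\beta_j\hat\varphi_j$ and $\widehat{(\operatorname{div}_T\varphi)}_j=-i\alpha_j\cdot\hat\varphi_j$. Let $\tilde X_\alpha$ be the space of all $u\in H_\alpha(\operatorname{curl};\Omega_0^R)$ whose tangential trace $u_T$ vanishes on $\Gamma_0^0$ and lies in $H^{1/2}_\alpha(\Gamma_0^R)$ on $\Gamma_0^R$, with $\|u\|_{\tilde X_\alpha}^2=\|u\|_{L^2}^2+\|\nabla\times u\|_{L^2}^2+\|u_T\|_{H^{1/2}_\alpha(\Gamma_0^R)}^2$, and let $$Y_\alpha=\{u\in\tilde X_\alpha:\ \operatorname{div}(\varepsilon_r u)=0\text{ in }\Omega^R,\quad k^2u_3=-\operatorname{div}_T[(N_\alpha-T_\alpha)u_T]\text{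 in }H^{-1/2}_\alpha(\Gamma_0^R)\}.$$ For $\rho>0$ and $u,v\in Y_\alpha$ let $$a^\rho_\alpha(u,v)=\int_{\Omega_0^R}\mu_r^{-1}(\nabla\times u)\cdot(\nabla\times\overline v)+\rho\,u\cdot\overline v\,dx+\int_{\Gamma_0^R}(N_\alpha-T_\alpha)(u_T)\cdot\overline{v}_T\,dS+C(k^2,\alpha)\sum_{j\in\mathbb Z^2}(1+|\alpha_j|^2)^{-1/2}\,\widehat{(u_T)}_j\cdot\overline{\widehat{(v_T)}_j},$$ where the boundary integral is the duality pairing and $C(k^2,\alpha)=\frac{k^2}{2\pi}\sup_{j}\frac{(1+|\alpha_j|^2)^{1/2}}{|k^2-|\alpha_j|^2|^{1/2}}$. Theorem. Every $u\in Y_\alpha$ belongs to $H^1_\alpha(\Omega_0^R)^3$, and for all sufficiently large $\rho>0$ the form $a^\rho_\alpha$ is coercive on $Y_\alpha$ with respect to the $H^1$ norm, and in particular with respect to the norm of $\tilde X_\alpha$: there is $\rho_0>0$ such that for every $\rho\ge\rho_0$ there is $c>0$ with $$\operatorname{Re}a^\rho_\alpha(u,u)\ge c\,\|u\|^2_{H^1(\Omega_0^R)^3}\quad\text{and}\quad\operatorname{Re}a^\rho_\alpha(u,u)\ge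 c\,\|u\|^2_{\tilde X_\alpha}\qquad\text{for all }u\in Y_\alpha.$$ -/

import Mathlib

open MeasureTheory
open scoped ContDiff

noncomputable section

namespace QPMaxwell

/-- Points of three-dimensional space. -/
abbrev E3 := EuclideanSpace ℝ (Fin 3)
/-- Horizontal (two-dimensional) real vectors. -/
abbrev E2 := EuclideanSpace ℝ (Fin 2)
/-- Values of complex vector fields. -/
abbrev C3 := EuclideanSpace ℂ (Fin 3)
/-- Values of tangential complex vector fields on a horizontal plane. -/
abbrev C2 := EuclideanSpace ℂ (Fin 2)
/-- The index set `ℤ²` of the Fourier series. -/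
abbrev Idx := Fin 2 → ℤ

/-! ### Geometry -/

/-- The strip `ℝ² × (0, R)`. -/
def strip (R : ℝ) : Set E3 := {x | 0 < x 2 ∧ x 2 < R}

/-- The periodicity cell `(-π, π)² × (0, R)`. -/
def cell (R : ℝ) : Set E3 :=
  {x | (-Real.pi < x 0 ∧ x 0 < Real.pi) ∧ (-Real.pi < x 1 ∧ x 1 < Real.pi) ∧ (0 < x 2 ∧ x 2 < R)}

/-- The square `(-π, π)²`. -/
def square : Set E2 :=
  {y | (-Real.pi < y 0 ∧ y 0 < Real.pi) ∧ (-Real.pi < y 1 ∧ y 1 < Real.pi)}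

/-- The horizontal translation by `2π j`. -/
def shift (j : Idx) : E3 := !₂[2 * Real.pi * (j 0 : ℝ), 2 * Real.pi * (j 1 : ℝ), 0]

/-- The factor `exp (-2π i α · j)` of quasi-periodicity. -/
def phase (α : E2) (j : Idx) : ℂ :=
  Complex.exp (-(2 * Real.pi * (α 0 * j 0 + α 1 * j 1) : ℂ) * Complex.I)

/-- The wave vector `α_j = α + j`. -/
def wave (α : E2) (j : Idx) : E2 := !₂[α 0 + (j 0 : ℝ), α 1 + (j 1 : ℝ)]

/-- `α_j` as a complex vector. -/
def waveC (α : E2) (j : Idx) : C2 := !₂[((wave α j 0 : ℝ) : ℂ), ((wave α j 1 : ℝ) : ℂ)]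

/-! ### Weak derivatives and function spaces -/

/-- The classical partial derivative `∂_i f`. -/
def partialD {F : Type*} [NormedAddCommGroup F] [NormedSpace ℝ F] (i : Fin 3) (f : E3 → F) :
    E3 → F :=
  fun x => fderiv ℝ f x (EuclideanSpace.single i 1)

/-- The classical curl of a differentiable vector field. -/
def curl (v : E3 → C3) : E3 → C3 := fun x =>
  !₂[partialD 1 v x 2 - partialD 2 v x 1,
     partialD 2 v x 0 - partialD 0 v x 2,
     partialD 0 v x 1 - partialD 1 v x 0]

/-- `C_c^∞` of the strip, with values in `F`. -/
structure IsTest {F : Type*} [NormedAddCommGroup F] [NormedSpace ℝ F] (R : ℝ) (φ : E3 → F) :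
    Prop where
  smooth : ContDiff ℝ ∞ φ
  compact : HasCompactSupport φ
  supp : tsupport φ ⊆ strip R

/-- `g` is the `i`-th weak partial derivative of `f` in the strip. -/
def IsWeakPartial {F : Type*} [NormedAddCommGroup F] [NormedSpace ℝ F] (R : ℝ) (i : Fin 3)
    (f g : E3 → F) : Prop :=
  ∀ φ : E3 → ℝ, IsTest R φ →
    ∫ x in strip R, partialD i φ x • f x = -∫ x in strip R, φ x • g x

/-- `W^{1,∞}` of the strip. -/
def MemW1Inf (R : ℝ) (f : E3 → ℂ) : Prop :=
  MemLp f ⊤ (volume.restrict (strip R)) ∧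
    ∀ i, ∃ g : E3 → ℂ, MemLp g ⊤ (volume.restrict (strip R)) ∧ IsWeakPartial R i f g

/-- `2π`-periodicity in the horizontal variables. -/
def IsPeriodic (R : ℝ) (f : E3 → ℂ) : Prop :=
  ∀ j : Idx, ∀ᵐ x ∂volume.restrict (strip R), f (x + shift j) = f x

/-- `L²_α(Ω_0^R)³`: `α`-quasi-periodic fields in the strip, square integrable over a cell. -/
def MemL2 (R : ℝ) (α : E2) (u : E3 → C3) : Prop :=
  MemLp u 2 (volume.restrict (cell R)) ∧
    ∀ j : Idx, ∀ᵐ x ∂volume.restrict (strip R), u (x + shift j) = phase α j • u x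

/-- The squared norm of `L²(Ω_0^R)³`. -/
def sqL2 (R : ℝ) (u : E3 → C3) : ℝ := ∫ x in cell R, ‖u x‖ ^ 2

/-- `H¹_α(Ω_0^R)³`. The derivatives are taken in the strip, so that no jumps occur
across the lateral faces of the cell. -/
def MemH1 (R : ℝ) (α : E2) (u : E3 → C3) : Prop :=
  MemL2 R α u ∧ ∀ i, ∃ g, MemL2 R α g ∧ IsWeakPartial R i u g

open Classical in
/-- The weak partial derivative in `L²` (zero if there is none). -/
def weakPartial (R : ℝ) (α : E2) (i : Fin 3) (u : E3 → C3) : E3 → C3 :=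
  if h : ∃ g, MemL2 R α g ∧ IsWeakPartial R i u g then h.choose else 0

/-- The squared norm of `H¹(Ω_0^R)³`. -/
def sqH1 (R : ℝ) (α : E2) (u : E3 → C3) : ℝ :=
  sqL2 R u + ∑ i, sqL2 R (weakPartial R α i u)

/-- `c ∈ L²_α` is the weak curl of `u` in the strip. -/
def IsWeakCurl (R : ℝ) (α : E2) (u c : E3 → C3) : Prop :=
  MemL2 R α c ∧ ∀ φ : E3 → C3, IsTest R φ →
    ∫ x in strip R, inner ℂ (curl φ x) (u x) = ∫ x in strip R, inner ℂ (φ x) (c x)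

/-- `H_α(curl; Ω_0^R)`. -/
def MemHcurl (R : ℝ) (α : E2) (u : E3 → C3) : Prop :=
  MemL2 R α u ∧ ∃ c, IsWeakCurl R α u c

open Classical in
/-- The weak curl in `L²` (zero if there is none). -/
def weakCurl (R : ℝ) (α : E2) (u : E3 → C3) : E3 → C3 :=
  if h : ∃ c, IsWeakCurl R α u c then h.choose else 0

/-- `div (ε u) = 0` in the sense of distributions in the strip. -/
def DivFree (R : ℝ) (ε : E3 → ℂ) (u : E3 → C3) : Prop :=
  ∀ φ : E3 → ℝ, IsTest R φ →
    ∫ x in strip R, ε x * ∑ i : Fin 3, u x i * ((partialD i φ x : ℝ) : ℂ) = 0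

/-! ### Traces

A quasi-periodic distribution `g` on the plane `x₃ = R` is represented by its Fourier
coefficients `ĝ_j`, normalized so that `g = (2π)⁻¹ ∑ ĝ_j exp (-i α_j · y)`; hence
`∫ f · conj g` over `(-π, π)² × {R}` is `∑ f̂_j · conj ĝ_j`. -/

/-- The `j`-th Fourier coefficient of the restriction of `f` to the plane `x₃ = R`. -/
def fourierCoef {F : Type*} [NormedAddCommGroup F] [NormedSpace ℂ F] (R : ℝ) (α : E2)
    (f : E3 → F) (j : Idx) : F :=
  ((2 * Real.pi : ℝ) : ℂ)⁻¹ •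
    ∫ y in square, Complex.exp (((inner ℝ (wave α j) y : ℝ) : ℂ) * Complex.I) •
      f !₂[y 0, y 1, R]

/-- The duality pairing `∫ φ · conj ψ` of the boundary, in terms of Fourier coefficients. -/
def pairing {F : Type*} [NormedAddCommGroup F] [InnerProductSpace ℂ F] (φ ψ : Idx → F) : ℂ :=
  ∑' j, inner ℂ (ψ j) (φ j)

/-- `φ` is the coefficient sequence of an element of `H^s_α(Γ_0^R)`. -/
def MemHs {F : Type*} [NormedAddCommGroup F] (α : E2) (s : ℝ) (φ : Idx → F) : Prop :=
  Summable fun j => (1 + ‖wave α j‖ ^ 2) ^ s * ‖φ j‖ ^ 2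

/-- The squared norm of `H^s_α(Γ_0^R)`. -/
def sqHs {F : Type*} [NormedAddCommGroup F] (α : E2) (s : ℝ) (φ : Idx → F) : ℝ :=
  ∑' j, (1 + ‖wave α j‖ ^ 2) ^ s * ‖φ j‖ ^ 2

/-- Smooth `α`-quasi-periodic functions on the whole space. -/
def IsQPSmooth {F : Type*} [NormedAddCommGroup F] [NormedSpace ℂ F] [NormedSpace ℝ F]
    (α : E2) (v : E3 → F) : Prop :=
  ContDiff ℝ ∞ v ∧ ∀ (j : Idx) (x : E3), v (x + shift j) = phase α j • v x

/-- The left-hand side of Green's formula for the curl on a cell: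
`∫ (∇ × u) · conj v - u · conj (∇ × v)`. -/
def greenCurl (R : ℝ) (α : E2) (u v : E3 → C3) : ℂ :=
  ∫ x in cell R, (inner ℂ (v x) (weakCurl R α u x) - inner ℂ (curl v x) (u x))

/-- `e₃ × φ` for a tangential vector `φ`. -/
def e3cross (φ : C2) : C3 := !₂[-φ 1, φ 0, 0]

/-- `φ` is the tangential trace `u_T` on the upper face (through Green's formula, with
`∫ (e₃ × u_T) · conj v` on the right). -/
def IsTopTrace (R : ℝ) (α : E2) (u : E3 → C3) (φ : Idx → C2) : Prop :=
  MemHs α (-1 / 2) φ ∧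
    ∀ v : E3 → C3, IsQPSmooth α v → (∃ s : ℝ, 0 < s ∧ ∀ x : E3, x 2 < s → v x = 0) →
      greenCurl R α u v = pairing (fun j => e3cross (φ j)) (fourierCoef R α v)

/-- The tangential trace `u_T` vanishes on the lower face. -/
def ZeroBottomTrace (R : ℝ) (α : E2) (u : E3 → C3) : Prop :=
  ∀ v : E3 → C3, IsQPSmooth α v → (∃ s : ℝ, 0 < s ∧ ∀ x : E3, R - s < x 2 → v x = 0) →
    greenCurl R α u v = 0

open Classical in
/-- The Fourier coefficients of the tangential trace `u_T` on the upper face. -/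
def topTrace (R : ℝ) (α : E2) (u : E3 → C3) : Idx → C2 :=
  if h : ∃ φ, IsTopTrace R α u φ then h.choose else 0

/-- `c` is the trace on the upper face of the normal component of `ε u`, where
`div (ε u) = 0`; it is `u₃` because `ε = 1` near that face. -/
def IsNormalTrace (R : ℝ) (α : E2) (ε : E3 → ℂ) (u : E3 → C3) (c : Idx → ℂ) : Prop :=
  MemHs α (-1 / 2) c ∧
    ∀ ψ : E3 → ℂ, IsQPSmooth α ψ → (∃ s : ℝ, 0 < s ∧ ∀ x : E3, x 2 < s → ψ x = 0) →
      ∫ x in cell R, ε x * ∑ i : Fin 3, u x i * (starRingEnd ℂ) (partialD i ψ x) =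
        pairing c (fourierCoef R α ψ)

/-! ### Boundary operators -/

/-- `α_j · φ`. -/
def waveDot (α : E2) (j : Idx) (φ : C2) : ℂ := wave α j 0 * φ 0 + wave α j 1 * φ 1

/-- The square root `β_j` of `k² - |α_j|²` with nonnegative real and imaginary part. -/
def beta (k : ℝ) (α : E2) (j : Idx) : ℂ :=
  if ‖wave α j‖ ≤ k then (Real.sqrt (k ^ 2 - ‖wave α j‖ ^ 2) : ℂ)
  else Complex.I * (Real.sqrt (‖wave α j‖ ^ 2 - k ^ 2) : ℂ)

/-- The operator `N_α`, on Fourier coefficients. -/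
def opN (k : ℝ) (α : E2) (φ : Idx → C2) (j : Idx) : C2 :=
  (-Complex.I / beta k α j * waveDot α j (φ j)) • waveC α j

/-- The Dirichlet-to-Neumann operator `T_α`, on Fourier coefficients. -/
def opT (k : ℝ) (α : E2) (φ : Idx → C2) (j : Idx) : C2 :=
  (Complex.I * beta k α j) • φ j

/-- `(N_α - T_α) φ`, on Fourier coefficients. -/
def opNT (k : ℝ) (α : E2) (φ : Idx → C2) (j : Idx) : C2 := opN k α φ j - opT k α φ j

/-- The surface divergence, on Fourier coefficients. -/
def surfDiv (α : E2) (φ : Idx → C2) (j : Idx) : ℂ := -Complex.I * waveDot α j (φ j)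

/-! ### The solution spaces and the sesquilinear form -/

/-- The space `X̃_α`. -/
structure MemX (R : ℝ) (α : E2) (u : E3 → C3) : Prop where
  hcurl : MemHcurl R α u
  exists_trace : ∃ φ, IsTopTrace R α u φ
  trace_mem : MemHs α (1 / 2) (topTrace R α u)
  bottom : ZeroBottomTrace R α u

/-- The squared norm of `X̃_α`. -/
def sqX (R : ℝ) (α : E2) (u : E3 → C3) : ℝ :=
  sqL2 R u + sqL2 R (weakCurl R α u) + sqHs α (1 / 2) (topTrace R α u)

/-- The space `Y_α`: the fields of `X̃_α` with `div (ε u) = 0` and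
`k² u₃ = - div_T ((N_α - T_α) u_T)` on the upper face. -/
structure MemY (k R : ℝ) (α : E2) (ε : E3 → ℂ) (u : E3 → C3) : Prop where
  memX : MemX R α u
  divFree : DivFree R ε u
  boundary : ∃ c, IsNormalTrace R α ε u c ∧
    ∀ j, (k : ℂ) ^ 2 * c j = -surfDiv α (opNT k α (topTrace R α u)) j

/-- The constant `C(k², α)`. -/
def constC (k : ℝ) (α : E2) : ℝ :=
  k ^ 2 / (2 * Real.pi) *
    ⨆ j : Idx, (1 + ‖wave α j‖ ^ 2) ^ (1 / 2 : ℝ) / |k ^ 2 - ‖wave α j‖ ^ 2| ^ (1 / 2 : ℝ)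

/-- The sesquilinear form `a^ρ_α`. -/
def formA (k R : ℝ) (α : E2) (μ : E3 → ℂ) (ρ : ℝ) (u v : E3 → C3) : ℂ :=
  (∫ x in cell R, ((μ x)⁻¹ * inner ℂ (weakCurl R α v x) (weakCurl R α u x)
      + (ρ : ℂ) * inner ℂ (v x) (u x)))
    + pairing (opNT k α (topTrace R α u)) (topTrace R α v)
    + (constC k α : ℂ) * ∑' j, (((1 + ‖wave α j‖ ^ 2) ^ (-1 / 2 : ℝ) : ℝ) : ℂ) *
        inner ℂ (topTrace R α v j) (topTrace R α u j)

end QPMaxwell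

end

open QPMaxwell

noncomputable section

namespace QPMaxwell

open Filter Topology Set

/-! The fields are expanded in Fourier series in the horizontal variables. A mode with wave vector
`α_j = (a, b)` is a function of the height `t ∈ (0, R)` alone, and the weak vector equations become
ordinary differential equations. The first two components of the curl give the vertical derivatives
of the tangential components, the third gives an algebraic relation, and the divergence gives the
derivative of the normal component. Since `div (ε u) = 0` and `ε` lies in `W^{1,∞}`, one has `div u
= -q` with `q = ε⁻¹ ∇ε · u`, a term of order zero in `u`.

The core is `mode_energy`. Expanding squares, `|curl|² + |q|²` equals the gradient density of the
mode minus twice the real part of the derivative of `i (a u₁ + b u₂) conj u₃`. After integration the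
value at the bottom vanishes with the tangential trace. At the top, the condition defining `Y_α`
reduces to `u₃ = (α_j · u_T) / β_j` (`normalTrace_eq`), because `|α_j|² + β_j² = k²`. The boundary
term is then a nonnegative multiple of `Re (i / conj β_j)`, which is zero for real `β_j` and
negative for imaginary `β_j` (`re_boundary_nonpos`). It can be dropped, and summation by Parseval
gives `‖∇u‖² ≤ ‖curl u‖² + K ‖u‖²` (`exists_modeSystem`). Resynthesis of the derivatives from their
modes turns this bound into membership in `H¹` (`ModeSystem.memH1`).

For coercivity, the real part of the volume form is at least `m ‖curl u‖² + ρ ‖u‖²`. The boundary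
form loses at most a multiple of `‖u_T‖²` in `L²`, because the parts of order one in `N_α` and `T_α`
compensate each other on evanescent modes (`re_inner_opNT_ge`). This loss is at most `η ‖∇u‖² + η⁻¹
‖u‖²`, up to a constant, with `η` as small as desired (`ModeSystem.tsum_trace_sq_le`). The gradient
part is absorbed by the curl term through the energy inequality and the rest by a large `ρ`. The
correction with `C(k², α)` is nonnegative and is discarded. The `X̃_α` norm follows from the
`H^{1/2}` trace estimate `ModeSystem.sqHs_trace_le`. -/

/-! ### Absolutely continuous functions of one variable -/

lemma intervalIntegrable_of_locallyIntegrable {f : ℝ → ℂ} (hf : LocallyIntegrable f) (a b : ℝ) :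
    IntervalIntegrable f volume a b :=
  intervalIntegrable_iff.mpr ((hf.integrableOn_isCompact isCompact_uIcc).mono_set uIoc_subset_uIcc)

/-- The real and imaginary parts have absolutely continuous primitives; the complex primitive is
their combination with the constants `1` and `Complex.I`. -/
lemma absolutelyContinuousOnInterval_primitive {f : ℝ → ℂ} (hf : LocallyIntegrable f) (a b : ℝ) :
    AbsolutelyContinuousOnInterval (fun x => ∫ s in a..x, f s) a b := by
  have hi := intervalIntegrable_of_locallyIntegrable hf
  have hr : IntervalIntegrable (fun s => (f s).re) volume a b := ⟨(hi a b).1.re, (hi a b).2.re⟩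
  have hm : IntervalIntegrable (fun s => (f s).im) volume a b := ⟨(hi a b).1.im, (hi a b).2.im⟩
  have h1 := hr.absolutelyContinuousOnInterval_intervalIntegral (c := a) (by simp)
  have h2 := hm.absolutelyContinuousOnInterval_intervalIntegral (c := a) (by simp)
  have hc (z : ℂ) : AbsolutelyContinuousOnInterval (fun _ : ℝ => z) a b :=
    (LipschitzWith.const z).lipschitzOnWith.absolutelyContinuousOnInterval (K := 0)
  have h3 : (fun x => ∫ s in a..x, f s) =
      ((fun x => ∫ s in a..x, (f s).re) • fun _ : ℝ => (1 : ℂ)) +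
        ((fun x => ∫ s in a..x, (f s).im) • fun _ : ℝ => Complex.I) := by
    ext x
    have hre : (∫ s in a..x, f s).re = ∫ s in a..x, (f s).re :=
      (Complex.reCLM.intervalIntegral_comp_comm (hi a x)).symm
    have him : (∫ s in a..x, f s).im = ∫ s in a..x, (f s).im :=
      (Complex.imCLM.intervalIntegral_comp_comm (hi a x)).symm
    simp only [Pi.add_apply, Pi.smul_apply', Complex.real_smul, mul_one]
    rw [← hre, ← him, Complex.re_add_im]
  rw [h3]
  exact (h1.smul (hc _)).add (h2.smul (hc _))

/-- `F` is a primitive of the locally integrable function `f`. -/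
structure IsPrimitive (F f : ℝ → ℂ) : Prop where
  locInt : LocallyIntegrable f
  eq : ∀ a b : ℝ, ∫ s in a..b, f s = F b - F a

namespace IsPrimitive

variable {F G f g : ℝ → ℂ}

lemma intervalIntegrable (h : IsPrimitive F f) (a b : ℝ) : IntervalIntegrable f volume a b :=
  intervalIntegrable_of_locallyIntegrable h.locInt a b

lemma ac (h : IsPrimitive F f) (a b : ℝ) : AbsolutelyContinuousOnInterval F a b := by
  have h1 := absolutelyContinuousOnInterval_primitive h.locInt a b
  have h2 : AbsolutelyContinuousOnInterval (fun _ : ℝ => F a) a b :=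
    (LipschitzWith.const (F a)).lipschitzOnWith.absolutelyContinuousOnInterval (K := 0)
  have h3 : F = (fun _ : ℝ => F a) + fun x => ∫ s in a..x, f s := by
    ext x; simp [h.eq]
  rw [h3]; exact h2.add h1

lemma continuous (h : IsPrimitive F f) : Continuous F := by
  have : F = fun x => F 0 + ∫ s in (0:ℝ)..x, f s := by ext x; simp [h.eq]
  rw [this]
  exact continuous_const.add
    (intervalIntegral.continuous_primitive (fun a b => h.intervalIntegrable a b) 0)

lemma ae_hasDerivAt (h : IsPrimitive F f) : ∀ᵐ x, HasDerivAt F (f x) x := by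
  filter_upwards [LocallyIntegrable.ae_hasDerivAt_integral h.locInt] with x hx
  have : F = fun x => F 0 + ∫ s in (0:ℝ)..x, f s := by ext x; simp [h.eq]
  rw [this]; exact (hx 0).const_add _

/-- The product minus the primitive of its almost everywhere derivative is absolutely continuous
with zero derivative almost everywhere, hence constant. This is the integration by parts used for
every mode. -/
lemma mul (hF : IsPrimitive F f) (hG : IsPrimitive G g) :
    IsPrimitive (fun x => F x * G x) (fun x => f x * G x + F x * g x) := by
  have hl : LocallyIntegrable (fun x => f x * G x + F x * g x) := by
    refine LocallyIntegrable.add ?_ ?_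
    · exact hF.locInt.mul_continuous hG.continuous
    · exact hG.locInt.continuous_mul hF.continuous
  refine ⟨hl, fun a b => ?_⟩
  have hP : AbsolutelyContinuousOnInterval
      (fun x => F x * G x - ∫ s in a..x, (f s * G s + F s * g s)) a b :=
    ((hF.ac a b).smul (hG.ac a b)).sub
      (absolutelyContinuousOnInterval_primitive hl a b)
  obtain ⟨C, hC⟩ := hP.const_of_ae_hasDerivAt_zero (by
    filter_upwards [hF.ae_hasDerivAt, hG.ae_hasDerivAt, LocallyIntegrable.ae_hasDerivAt_integral hl]
      with x h1 h2 h3 _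
    have := (h1.mul h2).sub (h3 a)
    rw [sub_self] at this
    exact this)
  have h1 := hC a (by simp)
  have h2 := hC b (by simp)
  simp only [intervalIntegral.integral_same, sub_zero] at h1
  rw [← h1] at h2
  linear_combination -h2

lemma add (hF : IsPrimitive F f) (hG : IsPrimitive G g) :
    IsPrimitive (fun x => F x + G x) (fun x => f x + g x) := by
  refine ⟨hF.locInt.add hG.locInt, fun a b => ?_⟩
  rw [intervalIntegral.integral_add (hF.intervalIntegrable a b) (hG.intervalIntegrable a b),
    hF.eq, hG.eq]; ring

lemma const_mul (c : ℂ) (hF : IsPrimitive F f) :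
    IsPrimitive (fun x => c * F x) (fun x => c * f x) := by
  refine ⟨hF.locInt.smul c, fun a b => ?_⟩
  rw [intervalIntegral.integral_const_mul, hF.eq]; ring

lemma conj (hF : IsPrimitive F f) :
    IsPrimitive (fun x => (starRingEnd ℂ) (F x)) (fun x => (starRingEnd ℂ) (f x)) := by
  refine ⟨fun x => ?_, fun a b => ?_⟩
  · obtain ⟨s, hs, h⟩ := hF.locInt x
    exact ⟨s, hs, (Complex.conjCLE.toContinuousLinearMap.integrable_comp h)⟩
  · rw [intervalIntegral, integral_conj, integral_conj, ← map_sub, ← map_sub]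
    rw [← hF.eq]; rfl

lemma of_contDiff {χ : ℝ → ℝ} (hχ : ContDiff ℝ ∞ χ) :
    IsPrimitive (fun t => (χ t : ℂ)) (fun t => ((deriv χ t : ℝ) : ℂ)) := by
  have hc : Continuous fun t => ((deriv χ t : ℝ) : ℂ) :=
    Complex.continuous_ofReal.comp (hχ.continuous_deriv (by simp))
  refine ⟨hc.locallyIntegrable, fun a b => ?_⟩
  refine intervalIntegral.integral_eq_sub_of_hasDerivAt (f := fun t => (χ t : ℂ)) (fun x _ => ?_)
    (hc.intervalIntegrable _ _)
  exact ((hχ.differentiable (by simp)) x).hasDerivAt.ofReal_comp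

/-- The primitive with prescribed value `b` at `R`. -/
lemma of_value {R : ℝ} (b : ℂ) (hf : LocallyIntegrable f) :
    IsPrimitive (fun t => b + ∫ s in R..t, f s) f := by
  refine ⟨hf, fun a c => ?_⟩
  rw [add_sub_add_left_eq_sub, intervalIntegral.integral_interval_sub_left]
  all_goals exact intervalIntegrable_of_locallyIntegrable hf _ _

end IsPrimitive

/-- A function on `(0, R)` satisfying the weak form of `f' = g`, `f(R) = b` for test functions
vanishing near `0` coincides with the primitive of `g` with value `b` at `R`. -/
lemma ae_eq_primitive_of_weak {R : ℝ} (hR : 0 < R) {f g : ℝ → ℂ} {b : ℂ}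
    (hf : IntegrableOn f (Ioo 0 R)) (hg : LocallyIntegrable g)
    (h : ∀ χ : ℝ → ℝ, ContDiff ℝ ∞ χ → (∃ s, 0 < s ∧ ∀ t < s, χ t = 0) →
      ∫ t in Ioo 0 R, (((deriv χ t : ℝ) : ℂ) * f t + (χ t : ℂ) * g t) = (χ R : ℂ) * b) :
    ∀ᵐ t ∂volume.restrict (Ioo 0 R), f t = b + ∫ s in R..t, g s := by
  have hF := IsPrimitive.of_value (R := R) b hg
  set F := fun t => b + ∫ s in R..t, g s with hFdef
  have hFR : F R = b := by simp [hFdef]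
  have hFi : IntegrableOn F (Ioo 0 R) :=
    (hF.continuous.integrableOn_Icc).mono_set Ioo_subset_Icc_self
  have key := isOpen_Ioo.ae_eq_zero_of_integral_contDiff_smul_eq_zero
    (f := fun t => f t - F t) (μ := volume) (U := Ioo 0 R)
    ((hf.sub hFi).locallyIntegrableOn) (by
      intro η hη hηc hηs
      -- The test functions are free at `R`, so the antiderivative of any `η` supported in `(0, R)`
      -- is admissible. Integration by parts against the primitive `F` then removes the boundary
      -- value `b` and leaves `∫ η (f - F) = 0`.
      set χ : ℝ → ℝ := fun t => ∫ s in (0:ℝ)..t, η s with hχdef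
      have hχd : ∀ t, HasDerivAt χ (η t) t := fun t =>
        intervalIntegral.integral_hasDerivAt_right (hη.continuous.intervalIntegrable _ _)
          (hη.continuous.stronglyMeasurableAtFilter _ _) hη.continuous.continuousAt
      have hχ' : deriv χ = η := funext fun t => (hχd t).deriv
      have hχ : ContDiff ℝ ∞ χ := by
        rw [contDiff_infty_iff_deriv]
        exact ⟨fun t => (hχd t).differentiableAt, hχ' ▸ hη⟩
      have hvan : ∃ s, 0 < s ∧ ∀ t < s, χ t = 0 := by
        by_cases hne : (tsupport η).Nonempty
        · obtain ⟨m, hm, hmin⟩ := hηc.isCompact.exists_isMinOn hne continuousOn_id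
          have h0 : ∀ t < m, η t = 0 := fun t ht => by
            by_contra hc
            exact absurd (hmin (subset_tsupport _ hc)) (not_le.2 ht)
          refine ⟨m, (hηs hm).1, fun t ht => ?_⟩
          change ∫ s in (0:ℝ)..t, η s = 0
          have : ∀ s ∈ uIcc 0 t, η s = 0 := fun s hs => h0 s (by
            rcases le_total 0 t with h | h
            · rw [uIcc_of_le h] at hs; exact hs.2.trans_lt ht
            · rw [uIcc_of_ge h] at hs; exact hs.2.trans_lt (hηs hm).1)
          rw [intervalIntegral.integral_congr this]; simp
        · refine ⟨1, one_pos, fun t _ => ?_⟩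
          have : η = 0 := by
            rwa [not_nonempty_iff_eq_empty, tsupport_eq_empty_iff] at hne
          simp [hχdef, this]
      have h1 := h χ hχ hvan
      have h2 := ((IsPrimitive.of_contDiff hχ).mul hF).eq 0 R
      have h0 : χ 0 = 0 := by simp [hχdef]
      rw [intervalIntegral.integral_of_le hR.le, integral_Ioc_eq_integral_Ioo, h0, hFR] at h2
      simp only [Complex.ofReal_zero, zero_mul, sub_zero] at h2
      rw [hχ'] at h1 h2
      have hbd : ∃ C, ∀ t, ‖(η t : ℂ)‖ ≤ C := by
        obtain ⟨C, hC⟩ := hηc.exists_bound_of_continuous hη.continuous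
        exact ⟨C, fun t => by simpa using hC t⟩
      obtain ⟨C, hC⟩ := hbd
      have hηm : Continuous fun t => (η t : ℂ) := Complex.continuous_ofReal.comp hη.continuous
      have i1 : IntegrableOn (fun t => (η t : ℂ) * f t) (Ioo 0 R) :=
        hf.bdd_mul hηm.aestronglyMeasurable (Eventually.of_forall hC)
      have i2 : IntegrableOn (fun t => (η t : ℂ) * F t) (Ioo 0 R) :=
        hFi.bdd_mul hηm.aestronglyMeasurable (Eventually.of_forall hC)
      have hχm : Continuous fun t => (χ t : ℂ) := Complex.continuous_ofReal.comp hχ.continuous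
      have i3 : IntegrableOn (fun t => (χ t : ℂ) * g t) (Ioo 0 R) :=
        ((hg.continuous_mul hχm).integrableOn_isCompact isCompact_Icc).mono_set
          Ioo_subset_Icc_self
      rw [integral_add i1 i3] at h1
      rw [integral_add i2 i3] at h2
      have h3 : ∫ t in Ioo 0 R, (η t : ℂ) * (f t - F t) = 0 := by
        simp only [mul_sub]
        rw [integral_sub i1 i2]; linear_combination h1 - h2
      rw [← setIntegral_eq_integral_of_forall_compl_eq_zero (s := Ioo 0 R)]
      · simpa using h3
      · intro x hx
        have : η x = 0 := by
          by_contra hc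
          exact hx (hηs (subset_tsupport _ hc))
        simp [this])
  rw [ae_restrict_iff' measurableSet_Ioo]
  filter_upwards [key] with t ht hm
  exact sub_eq_zero.1 (ht hm)

/-! ### Endpoint bound and energy identity for one mode -/

lemma integrable_norm_sq {X E : Type*} [MeasurableSpace X] {m : Measure X} [NormedAddCommGroup E]
    {f : X → E} (hf : MemLp f 2 m) : Integrable (fun x => ‖f x‖ ^ 2) m :=
  (memLp_two_iff_integrable_sq_norm hf.1).1 hf

lemma integrable_add3 {X : Type*} [MeasurableSpace X] {m : Measure X} {f g h : X → ℝ}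
    (hf : Integrable f m) (hg : Integrable g m) (hh : Integrable h m) :
    Integrable (fun x => f x + g x + h x) m := (hf.add hg).add hh

lemma integral_add3 {X : Type*} [MeasurableSpace X] {m : Measure X} {f g h : X → ℝ}
    (hf : Integrable f m) (hg : Integrable g m) (hh : Integrable h m) :
    ∫ x, (f x + g x + h x) ∂m = ∫ x, f x ∂m + ∫ x, g x ∂m + ∫ x, h x ∂m := by
  rw [← integral_add hf hg]
  exact integral_add (hf.add hg) hh

lemma integral_re_eq {X : Type*} [MeasurableSpace X] {m : Measure X} {f : X → ℂ}
    (hf : Integrable f m) : ∫ x, (f x).re ∂m = (∫ x, f x ∂m).re :=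
  Complex.reCLM.integral_comp_comm hf

lemma IsPrimitive.integral_Ioo {F f : ℝ → ℂ} (h : IsPrimitive F f) {R : ℝ} (hR : 0 < R) :
    ∫ t in Ioo 0 R, f t = F R - F 0 := by
  rw [← h.eq, intervalIntegral.integral_of_le hR.le, integral_Ioc_eq_integral_Ioo]

lemma memLp_two_Ioo_of_continuous {F : ℝ → ℂ} (hF : Continuous F) (R : ℝ) :
    MemLp F 2 (volume.restrict (Ioo 0 R)) := by
  obtain ⟨C, hC⟩ := isCompact_Icc.exists_bound_of_continuousOn (s := Icc 0 R) hF.continuousOn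
  refine MemLp.of_bound hF.aestronglyMeasurable C ?_
  filter_upwards [ae_restrict_mem measurableSet_Ioo] with t ht using hC t ⟨ht.1.le, ht.2.le⟩

/-- A bound for the value at the end point of a function vanishing at the initial point. -/
lemma IsPrimitive.norm_sq_end_le {F f : ℝ → ℂ} (h : IsPrimitive F f) {R : ℝ} (hR : 0 < R)
    (h0 : F 0 = 0) (hf : MemLp f 2 (volume.restrict (Ioo 0 R))) {η : ℝ} (hη : 0 < η) :
    ‖F R‖ ^ 2 ≤ η * (∫ t in Ioo 0 R, ‖f t‖ ^ 2) + η⁻¹ * ∫ t in Ioo 0 R, ‖F t‖ ^ 2 := by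
  have hF := memLp_two_Ioo_of_continuous h.continuous R
  -- The derivative of `|F|²` is `2 Re (f conj F)`, and `|F|²` vanishes at `0`; Young's inequality
  -- with weight `η` finishes.
  have hp := h.mul h.conj
  have h1 := hp.integral_Ioo hR
  have hi : IntegrableOn (fun t => f t * (starRingEnd ℂ) (F t) + F t * (starRingEnd ℂ) (f t))
      (Ioo 0 R) :=
    (hp.locInt.integrableOn_isCompact isCompact_Icc).mono_set Ioo_subset_Icc_self
  have h2 : ‖F R‖ ^ 2 =
      ∫ t in Ioo 0 R, (f t * (starRingEnd ℂ) (F t) + F t * (starRingEnd ℂ) (f t)).re := by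
    have := congrArg Complex.re h1
    rw [h0, Complex.mul_conj, ← integral_re_eq hi] at this
    rw [this, map_zero, mul_zero, sub_zero, Complex.ofReal_re, Complex.normSq_eq_norm_sq]
  rw [h2, ← integral_const_mul, ← integral_const_mul,
    ← integral_add ((integrable_norm_sq hf).const_mul _) ((integrable_norm_sq hF).const_mul _)]
  refine integral_mono hi.re
    (((integrable_norm_sq hf).const_mul _).add ((integrable_norm_sq hF).const_mul _)) fun t => ?_
  have e1 : (f t * (starRingEnd ℂ) (F t) + F t * (starRingEnd ℂ) (f t)).re ≤
      2 * (‖f t‖ * ‖F t‖) := by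
    refine (Complex.re_le_norm _).trans ((norm_add_le _ _).trans (le_of_eq ?_))
    simp only [norm_mul, RCLike.norm_conj]; ring
  have hs : 0 < Real.sqrt η := Real.sqrt_pos.2 hη
  have e2 : 2 * (‖f t‖ * ‖F t‖) ≤ η * ‖f t‖ ^ 2 + η⁻¹ * ‖F t‖ ^ 2 := by
    have h3 := mul_nonneg (inv_nonneg.2 hη.le) (sq_nonneg (η * ‖f t‖ - ‖F t‖))
    have h4 : η⁻¹ * (η * ‖f t‖ - ‖F t‖) ^ 2 =
        η * ‖f t‖ ^ 2 + η⁻¹ * ‖F t‖ ^ 2 - 2 * (‖f t‖ * ‖F t‖) := by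
      field_simp; ring
    linarith
  exact e1.trans e2

/-- The energy estimate for one Fourier mode: the gradient is controlled by the curl and the
divergence when the boundary term has the favourable sign. -/
lemma mode_energy {R a b : ℝ} (hR : 0 < R) {F₁ F₂ F₃ f₁ f₂ f₃ c₁ c₂ c₃ q : ℝ → ℂ}
    (h₁ : IsPrimitive F₁ f₁) (h₂ : IsPrimitive F₂ f₂) (h₃ : IsPrimitive F₃ f₃)
    (hf₁ : MemLp f₁ 2 (volume.restrict (Ioo 0 R))) (hf₂ : MemLp f₂ 2 (volume.restrict (Ioo 0 R)))
    (hf₃ : MemLp f₃ 2 (volume.restrict (Ioo 0 R)))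
    (hc₁ : MemLp c₁ 2 (volume.restrict (Ioo 0 R))) (hc₂ : MemLp c₂ 2 (volume.restrict (Ioo 0 R)))
    (hc₃ : MemLp c₃ 2 (volume.restrict (Ioo 0 R))) (hq : MemLp q 2 (volume.restrict (Ioo 0 R)))
    (e₁ : ∀ᵐ t ∂volume.restrict (Ioo 0 R), f₁ t = c₂ t - Complex.I * a * F₃ t)
    (e₂ : ∀ᵐ t ∂volume.restrict (Ioo 0 R), f₂ t = -(c₁ t + Complex.I * b * F₃ t))
    (e₃ : ∀ᵐ t ∂volume.restrict (Ioo 0 R),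
      f₃ t = Complex.I * (a * F₁ t + b * F₂ t) - q t)
    (e₄ : ∀ᵐ t ∂volume.restrict (Ioo 0 R), c₃ t = Complex.I * (b * F₁ t - a * F₂ t))
    (z₁ : F₁ 0 = 0) (z₂ : F₂ 0 = 0)
    (hb : (Complex.I * (a * F₁ R + b * F₂ R) * (starRingEnd ℂ) (F₃ R)).re ≤ 0) :
    ((∫ t in Ioo 0 R, ‖f₁ t‖ ^ 2) + (∫ t in Ioo 0 R, ‖f₂ t‖ ^ 2) + ∫ t in Ioo 0 R, ‖f₃ t‖ ^ 2) +
      (a ^ 2 + b ^ 2) * ((∫ t in Ioo 0 R, ‖F₁ t‖ ^ 2) + (∫ t in Ioo 0 R, ‖F₂ t‖ ^ 2) +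
        ∫ t in Ioo 0 R, ‖F₃ t‖ ^ 2) ≤
    ((∫ t in Ioo 0 R, ‖c₁ t‖ ^ 2) + (∫ t in Ioo 0 R, ‖c₂ t‖ ^ 2) + ∫ t in Ioo 0 R, ‖c₃ t‖ ^ 2) +
      ∫ t in Ioo 0 R, ‖q t‖ ^ 2 := by
  have hF₁ := integrable_norm_sq (memLp_two_Ioo_of_continuous h₁.continuous R)
  have hF₂ := integrable_norm_sq (memLp_two_Ioo_of_continuous h₂.continuous R)
  have hF₃ := integrable_norm_sq (memLp_two_Ioo_of_continuous h₃.continuous R)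
  -- The function `i (a F₁ + b F₂) conj F₃` has as derivative exactly the cross terms of the energy,
  -- so these integrate to its boundary values.
  have hp := (((h₁.const_mul a).add (h₂.const_mul b)).mul h₃.conj).const_mul Complex.I
  have h1 := hp.integral_Ioo hR
  have hi := (hp.locInt.integrableOn_isCompact isCompact_Icc (k := Icc 0 R)).mono_set
    Ioo_subset_Icc_self
  have h2 := congrArg Complex.re h1
  rw [← integral_re_eq hi] at h2
  simp only [z₁, z₂, mul_zero, add_zero, zero_mul, sub_zero] at h2
  rw [← mul_assoc] at h2
  -- Solving the four relations for `c₁, c₂, c₃, q` and expanding the squares makes this a pointwise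
  -- polynomial identity; the mixed horizontal products cancel between `c₃` and `q`.
  have key : (∫ t in Ioo 0 R, ((‖c₁ t‖ ^ 2 + ‖c₂ t‖ ^ 2 + ‖c₃ t‖ ^ 2) + ‖q t‖ ^ 2)) =
      ∫ t in Ioo 0 R, (((‖f₁ t‖ ^ 2 + ‖f₂ t‖ ^ 2 + ‖f₃ t‖ ^ 2) +
        (a ^ 2 + b ^ 2) * (‖F₁ t‖ ^ 2 + ‖F₂ t‖ ^ 2 + ‖F₃ t‖ ^ 2)) -
        2 * (Complex.I * ((a * f₁ t + b * f₂ t) * (starRingEnd ℂ) (F₃ t) +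
          (a * F₁ t + b * F₂ t) * (starRingEnd ℂ) (f₃ t))).re) := by
    refine integral_congr_ae ?_
    filter_upwards [e₁, e₂, e₃, e₄] with t g₁ g₂ g₃ g₄
    have k₂ : c₂ t = f₁ t + Complex.I * a * F₃ t := by rw [g₁]; ring
    have k₁ : c₁ t = -f₂ t - Complex.I * b * F₃ t := by rw [g₂]; ring
    have kq : q t = Complex.I * (a * F₁ t + b * F₂ t) - f₃ t := by rw [g₃]; ring
    rw [k₁, k₂, kq, g₄]
    simp only [← Complex.normSq_eq_norm_sq, Complex.normSq_apply, Complex.add_re, Complex.add_im,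
      Complex.sub_re, Complex.sub_im, Complex.mul_re, Complex.mul_im, Complex.I_re, Complex.I_im,
      Complex.ofReal_re, Complex.ofReal_im, Complex.conj_re, Complex.conj_im, Complex.neg_re,
      Complex.neg_im]
    ring
  have j₁ := (integrable_norm_sq hf₁)
  have j₂ := (integrable_norm_sq hf₂)
  have j₃ := (integrable_norm_sq hf₃)
  have l₁ := (integrable_norm_sq hc₁)
  have l₂ := (integrable_norm_sq hc₂)
  have l₃ := (integrable_norm_sq hc₃)
  have l₄ := (integrable_norm_sq hq)
  have k₁ := integrable_add3 j₁ j₂ j₃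
  have k₂ := (integrable_add3 hF₁ hF₂ hF₃).const_mul (a ^ 2 + b ^ 2)
  have k₃ : Integrable (fun t => 2 * (Complex.I * ((a * f₁ t + b * f₂ t) * (starRingEnd ℂ) (F₃ t) +
      (a * F₁ t + b * F₂ t) * (starRingEnd ℂ) (f₃ t))).re) (volume.restrict (Ioo 0 R)) :=
    hi.re.const_mul 2
  have k₄ : Integrable (fun t => (‖f₁ t‖ ^ 2 + ‖f₂ t‖ ^ 2 + ‖f₃ t‖ ^ 2) +
      (a ^ 2 + b ^ 2) * (‖F₁ t‖ ^ 2 + ‖F₂ t‖ ^ 2 + ‖F₃ t‖ ^ 2)) (volume.restrict (Ioo 0 R)) :=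
    k₁.add k₂
  rw [integral_add (integrable_add3 l₁ l₂ l₃) l₄, integral_add3 l₁ l₂ l₃, integral_sub k₄ k₃,
    integral_add k₁ k₂, integral_add3 j₁ j₂ j₃, integral_const_mul,
    integral_add3 hF₁ hF₂ hF₃, integral_const_mul, h2] at key
  rw [key]
  linarith

/-! ### Fourier series on the square -/

/-- The half-open unit square. -/
def unitBox : Set (Fin 2 → ℝ) := {x | ∀ i, x i ∈ Ioc (-(1 / 2) : ℝ) (-(1 / 2) + 1)}

/-- The dilation of the unit square onto `(-π, π]²`. -/
def dilate (z : Fin 2 → ℝ) : E2 := WithLp.toLp 2 ((2 * Real.pi) • z)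

lemma measurableSet_unitBox : MeasurableSet unitBox := by
  have : unitBox = ⋂ i : Fin 2, (fun x : Fin 2 → ℝ => x i) ⁻¹' Ioc (-(1 / 2) : ℝ) (-(1 / 2) + 1) := by
    ext x; simp [unitBox]
  rw [this]
  exact MeasurableSet.iInter fun i => measurableSet_Ioc.preimage (measurable_pi_apply i)

lemma measurableEmbedding_dilate : MeasurableEmbedding dilate := by
  have h : (2 * Real.pi) ≠ 0 := by positivity
  exact (MeasurableEquiv.toLp 2 (Fin 2 → ℝ)).measurableEmbedding.comp
    (measurableEmbedding_const_smul₀ h)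

lemma volume_coord_eq (i : Fin 2) (c : ℝ) : volume {y : E2 | y i = c} = 0 := by
  have h := (EuclideanSpace.volume_preserving_symm_measurableEquiv_toLp (Fin 2))
  have e : {y : E2 | y i = c} =
      (MeasurableEquiv.toLp 2 (Fin 2 → ℝ)).symm ⁻¹' {x : Fin 2 → ℝ | x i = c} := by
    ext y; rfl
  rw [e, h.measure_preimage_equiv]
  exact Measure.pi_hyperplane (fun _ : Fin 2 => (volume : Measure ℝ)) i c

/-- The half-open square `(-π, π]²`. -/
def halfSquare : Set E2 := {y | ∀ i, y i ∈ Ioc (-Real.pi) Real.pi}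

/-- The two squares differ only within two lines. The half-open one is needed because it is the
dilated fundamental domain of the torus. -/
lemma square_ae_eq_halfSquare : square =ᵐ[volume] halfSquare := by
  have hsub : square ⊆ halfSquare := by
    intro y hy i
    fin_cases i
    · exact ⟨hy.1.1, hy.1.2.le⟩
    · exact ⟨hy.2.1, hy.2.2.le⟩
  refine hsub.eventuallyLE.antisymm ?_
  rw [ae_le_set]
  refine measure_mono_null (t := {y : E2 | y 0 = Real.pi} ∪ {y : E2 | y 1 = Real.pi}) ?_
    (measure_union_null (volume_coord_eq 0 _) (volume_coord_eq 1 _))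
  rintro y ⟨h1, h2⟩
  by_contra hc
  rw [mem_union, not_or] at hc
  exact h2 ⟨⟨(h1 0).1, lt_of_le_of_ne (h1 0).2 hc.1⟩, ⟨(h1 1).1, lt_of_le_of_ne (h1 1).2 hc.2⟩⟩

lemma dilate_preimage : dilate ⁻¹' halfSquare = unitBox := by
  have hp := Real.pi_pos
  ext x
  refine forall_congr' fun i => ?_
  change (-Real.pi < 2 * Real.pi * x i ∧ 2 * Real.pi * x i ≤ Real.pi) ↔
    (-(1 / 2) < x i ∧ x i ≤ -(1 / 2) + 1)
  constructor
  · rintro ⟨h1, h2⟩; constructor <;> nlinarith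
  · rintro ⟨h1, h2⟩; constructor <;> nlinarith

lemma map_dilate : Measure.map dilate (volume.restrict unitBox) =
    ENNReal.ofReal ((2 * Real.pi) ^ 2)⁻¹ • volume.restrict square := by
  have h : (2 * Real.pi) ≠ 0 := by positivity
  rw [Measure.restrict_congr_set square_ae_eq_halfSquare, ← dilate_preimage,
    ← measurableEmbedding_dilate.restrict_map]
  have : Measure.map dilate volume =
      ENNReal.ofReal ((2 * Real.pi) ^ 2)⁻¹ • (volume : Measure E2) := by
    have h1 : dilate = (MeasurableEquiv.toLp 2 (Fin 2 → ℝ)) ∘ (fun x => (2 * Real.pi) • x) := rfl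
    rw [h1, ← Measure.map_map (MeasurableEquiv.measurable _) (measurable_const_smul _),
      Measure.map_addHaar_smul _ h, Measure.map_smul,
      show Measure.map (MeasurableEquiv.toLp 2 (Fin 2 → ℝ)) volume = volume from
        (EuclideanSpace.volume_preserving_symm_measurableEquiv_toLp (Fin 2)).symm.map_eq]
    congr 2
    rw [abs_of_nonneg (by positivity)]; simp
  rw [this, Measure.restrict_smul]

lemma integral_dilate {E : Type*} [NormedAddCommGroup E] [NormedSpace ℝ E] (f : E2 → E) :
    ∫ z in unitBox, f (dilate z) = ((2 * Real.pi) ^ 2)⁻¹ • ∫ y in square, f y := by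
  rw [← measurableEmbedding_dilate.integral_map, map_dilate, integral_smul_measure,
    ENNReal.toReal_ofReal (by positivity)]

section Torus

attribute [local instance] instMeasureSpaceUnitAddCircle

/-- The representative in the unit box of a point of the torus. -/
def boxRep (z : UnitAddTorus (Fin 2)) : Fin 2 → ℝ :=
  (UnitAddTorus.measurableEquivPiIoc (fun _ => -(1 / 2)) z : Fin 2 → ℝ)

lemma measurePreserving_boxRep : MeasurePreserving boxRep volume (volume.restrict unitBox) := by
  have h1 := UnitAddTorus.measurePreserving_equivPiIoc (fun _ : Fin 2 => (-(1 / 2) : ℝ))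
  have h2 : MeasurePreserving (Subtype.val : unitBox → (Fin 2 → ℝ))
      (Measure.comap Subtype.val volume) (volume.restrict unitBox) :=
    ⟨measurable_subtype_coe, map_comap_subtype_coe measurableSet_unitBox _⟩
  exact h2.comp h1

lemma boxRep_coe {x : Fin 2 → ℝ} (hx : x ∈ unitBox) :
    boxRep (fun i => (x i : UnitAddCircle)) = x := by
  have : (fun i => (x i : UnitAddCircle)) =
    (UnitAddTorus.measurableEquivPiIoc (fun _ : Fin 2 => (-(1 / 2) : ℝ))).symm ⟨x, hx⟩ := rfl
  rw [boxRep, this, MeasurableEquiv.apply_symm_apply]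

lemma integral_boxRep {E : Type*} [NormedAddCommGroup E] [NormedSpace ℝ E]
    (f : UnitAddTorus (Fin 2) → (Fin 2 → ℝ) → E) :
    ∫ z, f z (boxRep z) = ∫ x in unitBox, f (fun i => (x i : UnitAddCircle)) x := by
  rw [UnitAddTorus.integral_preimage _ (fun _ => (-(1 / 2) : ℝ))]
  refine setIntegral_congr_fun measurableSet_unitBox fun x hx => ?_
  simp only [boxRep_coe hx]

/-- Parseval's identity on the square for periodic Fourier series. -/
lemma hasSum_periodic {f : E2 → ℂ} (hf : MemLp f 2 (volume.restrict square)) :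
    HasSum (fun n : Idx => ‖((2 * Real.pi : ℝ) : ℂ)⁻¹ •
      ∫ y in square, Complex.exp (((n 0 * y 0 + n 1 * y 1 : ℝ) : ℂ) * Complex.I) • f y‖ ^ 2)
      (∫ y in square, ‖f y‖ ^ 2) := by
  have hp : (2 * Real.pi) ≠ 0 := by positivity
  have hH : MemLp (fun z => f (dilate (boxRep z))) 2 (volume : Measure (UnitAddTorus (Fin 2))) := by
    have h1 : MemLp f 2 (Measure.map dilate (volume.restrict unitBox)) := by
      rw [map_dilate]; exact hf.smul_measure ENNReal.ofReal_ne_top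
    exact (h1.comp_of_map measurableEmbedding_dilate.measurable.aemeasurable).comp_measurePreserving
      measurePreserving_boxRep
  have hP := UnitAddTorus.hasSum_sq_mFourierCoeff (hH.toLp _)
  have hn : ∫ t, ‖(hH.toLp _) t‖ ^ 2 = ((2 * Real.pi) ^ 2)⁻¹ * ∫ y in square, ‖f y‖ ^ 2 := by
    rw [← smul_eq_mul, ← integral_dilate, ← integral_boxRep (fun _ x => ‖f (dilate x)‖ ^ 2)]
    refine integral_congr_ae ?_
    filter_upwards [MemLp.coeFn_toLp hH] with z hz
    rw [hz]
  -- The torus coefficient of index `n` integrates against the conjugate character, whereas here the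
  -- character has a positive exponent; hence the index `-n`, and the reindexing by `Equiv.neg`
  -- below.
  have hc (n : Idx) : UnitAddTorus.mFourierCoeff (hH.toLp _) (-n) = ((((2 * Real.pi) ^ 2)⁻¹ : ℝ) : ℂ) *
      ∫ y in square, Complex.exp (((n 0 * y 0 + n 1 * y 1 : ℝ) : ℂ) * Complex.I) • f y := by
    rw [← Complex.real_smul, ← integral_dilate,
      ← integral_boxRep (fun _ x => Complex.exp
        (((n 0 * (dilate x) 0 + n 1 * (dilate x) 1 : ℝ) : ℂ) * Complex.I) • f (dilate x))]
    have : UnitAddTorus.mFourierCoeff (hH.toLp _) (-n) =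
        ∫ z, UnitAddTorus.mFourier n z • f (dilate (boxRep z)) := by
      rw [UnitAddTorus.mFourierCoeff, neg_neg]
      refine integral_congr_ae ?_
      filter_upwards [MemLp.coeFn_toLp hH] with z hz
      rw [hz]
    rw [this, integral_boxRep (fun z x => UnitAddTorus.mFourier n z • f (dilate x)),
      integral_boxRep (fun _ x => Complex.exp
        (((n 0 * (dilate x) 0 + n 1 * (dilate x) 1 : ℝ) : ℂ) * Complex.I) • f (dilate x))]
    refine setIntegral_congr_fun measurableSet_unitBox fun x hx => ?_
    have : UnitAddTorus.mFourier n (fun i => (x i : UnitAddCircle)) =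
        Complex.exp (((n 0 * (dilate x) 0 + n 1 * (dilate x) 1 : ℝ) : ℂ) * Complex.I) := by
      change ∏ i, fourier (n i) (x i : UnitAddCircle) = _
      rw [Fin.prod_univ_two, fourier_coe_apply, fourier_coe_apply, ← Complex.exp_add]
      congr 1
      change _ = (((n 0 * (2 * Real.pi * x 0) + n 1 * (2 * Real.pi * x 1) : ℝ)) : ℂ) * Complex.I
      push_cast; ring
    simp only [this]
  have h2 := (Equiv.neg Idx).hasSum_iff.2 hP
  rw [hn] at h2
  have h3 := h2.mul_left ((2 * Real.pi) ^ 2)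
  rw [mul_inv_cancel_left₀ (pow_ne_zero 2 hp)] at h3
  refine HasSum.congr_fun h3 fun n => ?_
  simp only [Function.comp_apply, Equiv.neg_apply, hc, smul_eq_mul, norm_mul, mul_pow]
  rw [norm_inv, Complex.norm_real, Complex.norm_real, Real.norm_of_nonneg (by positivity),
    Real.norm_of_nonneg (by positivity)]
  field_simp
  simp only [mul_comm Complex.I]

end Torus

/-- The character `exp (i α_j · y)`. -/
def planeWave (α : E2) (j : Idx) (y : E2) : ℂ :=
  Complex.exp (((inner ℝ (wave α j) y : ℝ) : ℂ) * Complex.I)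

lemma inner_wave (α : E2) (j : Idx) (y : E2) :
    (inner ℝ (wave α j) y : ℝ) = (α 0 + j 0) * y 0 + (α 1 + j 1) * y 1 := by
  simp [wave, PiLp.inner_apply, Fin.sum_univ_two, mul_comm]

lemma continuous_planeWave (α : E2) (j : Idx) : Continuous (planeWave α j) := by
  unfold planeWave; fun_prop

lemma norm_planeWave (α : E2) (j : Idx) (y : E2) : ‖planeWave α j y‖ = 1 :=
  Complex.norm_exp_ofReal_mul_I _

/-- The Fourier coefficient of a function of the horizontal variables. -/
def sliceCoef {F : Type*} [NormedAddCommGroup F] [NormedSpace ℂ F] (α : E2) (f : E2 → F)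
    (j : Idx) : F :=
  ((2 * Real.pi : ℝ) : ℂ)⁻¹ • ∫ y in square, planeWave α j y • f y

/-- Parseval's identity on the square for quasi-periodic Fourier series. -/
lemma hasSum_sliceCoef (α : E2) {f : E2 → ℂ} (hf : MemLp f 2 (volume.restrict square)) :
    HasSum (fun j : Idx => ‖sliceCoef α f j‖ ^ 2) (∫ y in square, ‖f y‖ ^ 2) := by
  -- Multiplication by the unimodular function `planeWave α 0` leaves the norm unchanged and turns
  -- the frequencies `α + j` into integers.
  have hg : MemLp (fun y => planeWave α 0 y * f y) 2 (volume.restrict square) := by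
    refine hf.of_le ((continuous_planeWave α 0).aestronglyMeasurable.mul hf.1)
      (Eventually.of_forall fun y => ?_)
    rw [norm_mul, norm_planeWave, one_mul]
  have h := hasSum_periodic hg
  simp only [norm_mul, norm_planeWave, one_mul] at h
  refine HasSum.congr_fun h fun j => ?_
  have : ∀ y : E2, planeWave α j y • f y = Complex.exp (((j 0 * y 0 + j 1 * y 1 : ℝ) : ℂ) *
      Complex.I) • (planeWave α 0 y * f y) := fun y => by
    simp only [smul_eq_mul, ← mul_assoc, planeWave]
    rw [← Complex.exp_add, inner_wave, inner_wave, ← add_mul, ← Complex.ofReal_add]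
    congr 4
    simp only [Pi.zero_apply, Int.cast_zero]; ring
  simp only [sliceCoef, this]

lemma volume_square : volume square = ENNReal.ofReal ((2 * Real.pi) ^ 2) := by
  have h := congrArg (fun m => m univ) map_dilate
  simp only [Measure.map_apply measurableEmbedding_dilate.measurable MeasurableSet.univ,
    preimage_univ, Measure.restrict_apply MeasurableSet.univ, univ_inter, Measure.smul_apply,
    smul_eq_mul] at h
  have h1 : volume unitBox = 1 := by
    have : unitBox = univ.pi fun _ : Fin 2 => Ioc (-(1 / 2) : ℝ) (-(1 / 2) + 1) := by
      ext x; simp [unitBox]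
    rw [this, Real.volume_pi_Ioc]; simp
  rw [h1, ENNReal.ofReal_inv_of_pos (by positivity)] at h
  have hne : ENNReal.ofReal ((2 * Real.pi) ^ 2) ≠ 0 := by
    rw [Ne, ENNReal.ofReal_eq_zero, not_le]; positivity
  rw [← mul_one (ENNReal.ofReal _), h, ← mul_assoc,
    ENNReal.mul_inv_cancel hne ENNReal.ofReal_ne_top, one_mul]

instance isFiniteMeasure_square : IsFiniteMeasure (volume.restrict square) :=
  ⟨by rw [Measure.restrict_apply_univ, volume_square]; exact ENNReal.ofReal_lt_top⟩

/-- Orthogonality is read off from Parseval for the constant `1`: its zeroth coefficient already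
exhausts the norm, so all other coefficients vanish. -/
lemma integral_exp_square (n : Idx) :
    ∫ y in square, Complex.exp (((n 0 * y 0 + n 1 * y 1 : ℝ) : ℂ) * Complex.I) =
      if n = 0 then (((2 * Real.pi) ^ 2 : ℝ) : ℂ) else 0 := by
  have hv : (volume.restrict square).real univ = (2 * Real.pi) ^ 2 := by
    rw [measureReal_restrict_apply_univ, Measure.real, volume_square,
      ENNReal.toReal_ofReal (by positivity)]
  have h0 : ∫ y in square, Complex.exp ((((0 : Idx) 0 * y 0 + (0 : Idx) 1 * y 1 : ℝ) : ℂ) *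
      Complex.I) = (((2 * Real.pi) ^ 2 : ℝ) : ℂ) := by
    simp [hv]
  split_ifs with hn
  · rw [hn, h0]
  · have hP := hasSum_periodic (f := fun _ => 1) (memLp_const 1)
    simp only [smul_eq_mul, mul_one, norm_one, one_pow, integral_const, hv, norm_mul, mul_pow] at hP
    have hle := sum_le_hasSum {0, n} (fun i _ => by positivity) hP
    rw [Finset.sum_pair (Ne.symm hn), h0, norm_inv, Complex.norm_real, Complex.norm_real,
      Real.norm_of_nonneg (by positivity), Real.norm_of_nonneg (by positivity)] at hle
    have e1 : ((2 * Real.pi)⁻¹) ^ 2 * ((2 * Real.pi) ^ 2) ^ 2 = (2 * Real.pi) ^ 2 := by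
      have := Real.pi_pos
      field_simp
    rw [e1] at hle
    have h2 : (2 * Real.pi)⁻¹ ^ 2 * ‖∫ y in square,
        Complex.exp (((n 0 * y 0 + n 1 * y 1 : ℝ) : ℂ) * Complex.I)‖ ^ 2 ≤ 0 := by linarith
    have h3 : 0 < (2 * Real.pi)⁻¹ ^ 2 := by positivity
    have h4 : ‖∫ y in square,
        Complex.exp (((n 0 * y 0 + n 1 * y 1 : ℝ) : ℂ) * Complex.I)‖ ^ 2 = 0 :=
      le_antisymm (nonpos_of_mul_nonpos_right h2 h3) (sq_nonneg _)
    exact norm_eq_zero.1 (pow_eq_zero_iff (two_ne_zero) |>.1 h4)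

lemma planeWave_mul_conj (α : E2) (j l : Idx) (y : E2) :
    planeWave α l y * (starRingEnd ℂ) (planeWave α j y) =
      Complex.exp ((((l - j) 0 * y 0 + (l - j) 1 * y 1 : ℝ) : ℂ) * Complex.I) := by
  simp only [planeWave]
  rw [← Complex.exp_conj, ← Complex.exp_add, map_mul, Complex.conj_I, Complex.conj_ofReal,
    inner_wave, inner_wave]
  congr 1
  simp only [Pi.sub_apply, Int.cast_sub]
  push_cast; ring

/-- Fourier coefficients of a plane wave. -/
lemma sliceCoef_planeWave {F : Type*} [NormedAddCommGroup F] [NormedSpace ℂ F] [CompleteSpace F]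
    (α : E2) (j l : Idx) (c : F) :
    sliceCoef α (fun y => (starRingEnd ℂ) (planeWave α j y) • c) l =
      if l = j then ((2 * Real.pi : ℝ) : ℂ) • c else 0 := by
  simp only [sliceCoef, smul_smul, planeWave_mul_conj]
  rw [integral_smul_const, integral_exp_square]
  have hp : ((2 * Real.pi : ℝ) : ℂ) ≠ 0 := by
    have : (2 * Real.pi) ≠ 0 := by positivity
    exact_mod_cast this
  simp only [sub_eq_zero]
  split_ifs with h
  · rw [smul_smul]; congr 1; push_cast at hp ⊢; field_simp
  · simp

/-! ### Horizontal slices -/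

/-- The point of space with given horizontal and vertical coordinates. -/
def emb (p : E2 × ℝ) : E3 := !₂[p.1 0, p.1 1, p.2]

/-- The horizontal coordinates of a point. -/
def hor (x : E3) : E2 := !₂[x 0, x 1]

@[simp] lemma emb_zero (p : E2 × ℝ) : emb p 0 = p.1 0 := rfl
@[simp] lemma emb_one (p : E2 × ℝ) : emb p 1 = p.1 1 := rfl
@[simp] lemma emb_two (p : E2 × ℝ) : emb p 2 = p.2 := rfl

@[simp] lemma hor_emb (p : E2 × ℝ) : hor (emb p) = p.1 := by
  ext i; fin_cases i <;> rfl

lemma emb_hor (x : E3) : emb (hor x, x 2) = x := by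
  ext i; fin_cases i <;> rfl

/-- The splitting of space into horizontal and vertical coordinates. -/
def splitEquiv : E2 × ℝ ≃ᵐ E3 :=
  (((MeasurableEquiv.toLp 2 (Fin 2 → ℝ)).symm.prodCongr (MeasurableEquiv.refl ℝ)).trans
    MeasurableEquiv.prodComm).trans
    ((MeasurableEquiv.piFinSuccAbove (fun _ : Fin 3 => ℝ) (Fin.last 2)).symm.trans
      (MeasurableEquiv.toLp 2 (Fin 3 → ℝ)))

lemma splitEquiv_apply (p : E2 × ℝ) : splitEquiv p = emb p := by
  ext i
  fin_cases i
  · rfl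
  · rfl
  · rfl

lemma measurePreserving_emb : MeasurePreserving emb (volume.prod volume) volume := by
  have h : MeasurePreserving splitEquiv (volume.prod volume) volume := by
    have h1 : MeasurePreserving (MeasurableEquiv.toLp 2 (Fin 2 → ℝ)).symm volume volume :=
      EuclideanSpace.volume_preserving_symm_measurableEquiv_toLp (Fin 2)
    have h2 := h1.prod (MeasurePreserving.id (volume : Measure ℝ))
    have h3 : MeasurePreserving (Prod.swap : (Fin 2 → ℝ) × ℝ → ℝ × (Fin 2 → ℝ))
      (volume.prod volume) (volume.prod volume) := Measure.measurePreserving_swap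
    have h4 := (volume_preserving_piFinSuccAbove (fun _ : Fin 3 => ℝ) (Fin.last 2)).symm
    have h5 : MeasurePreserving (MeasurableEquiv.toLp 2 (Fin 3 → ℝ)) volume volume :=
      (EuclideanSpace.volume_preserving_symm_measurableEquiv_toLp (Fin 3)).symm
    exact (h5.comp h4).comp (h3.comp h2)
  have e : (splitEquiv : E2 × ℝ → E3) = emb := funext splitEquiv_apply
  rwa [e] at h

lemma measurableEmbedding_emb : MeasurableEmbedding emb := by
  have e : (splitEquiv : E2 × ℝ → E3) = emb := funext splitEquiv_apply
  exact e ▸ splitEquiv.measurableEmbedding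

lemma emb_preimage_cell (R : ℝ) : emb ⁻¹' cell R = square ×ˢ Ioo 0 R := by
  ext p; simp [cell, square, and_assoc]

lemma emb_preimage_strip (R : ℝ) : emb ⁻¹' strip R = univ ×ˢ Ioo 0 R := by
  ext p; simp [strip]

lemma measurePreserving_emb_cell (R : ℝ) : MeasurePreserving emb
    ((volume.restrict square).prod (volume.restrict (Ioo 0 R))) (volume.restrict (cell R)) := by
  rw [Measure.prod_restrict, ← emb_preimage_cell]
  exact measurePreserving_emb.restrict_preimage_emb measurableEmbedding_emb _

lemma measurePreserving_emb_strip (R : ℝ) : MeasurePreserving emb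
    (volume.prod (volume.restrict (Ioo 0 R))) (volume.restrict (strip R)) := by
  have : (volume : Measure E2).prod (volume.restrict (Ioo 0 R)) =
      (volume.prod volume).restrict (emb ⁻¹' strip R) := by
    rw [emb_preimage_strip, ← Measure.prod_restrict, Measure.restrict_univ]
  rw [this]
  exact measurePreserving_emb.restrict_preimage_emb measurableEmbedding_emb _

lemma cell_subset_strip (R : ℝ) : cell R ⊆ strip R := fun _ hx => hx.2.2

lemma measurableSet_strip (R : ℝ) : MeasurableSet (strip R) := by
  have h : Measurable fun x : E3 => x 2 := by fun_prop
  exact (measurableSet_lt measurable_const h).inter (measurableSet_lt h measurable_const)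

lemma measurableSet_cell (R : ℝ) : MeasurableSet (cell R) := by
  have h0 : Measurable fun x : E3 => x 0 := by fun_prop
  have h1 : Measurable fun x : E3 => x 1 := by fun_prop
  exact ((measurableSet_lt measurable_const h0).inter (measurableSet_lt h0 measurable_const)).inter
    (((measurableSet_lt measurable_const h1).inter (measurableSet_lt h1 measurable_const)).inter
      (measurableSet_strip R))

instance isFiniteMeasure_Ioo (R : ℝ) : IsFiniteMeasure (volume.restrict (Ioo 0 R)) :=
  ⟨by rw [Measure.restrict_apply_univ]; exact measure_Ioo_lt_top⟩

instance isFiniteMeasure_cell (R : ℝ) : IsFiniteMeasure (volume.restrict (cell R)) := by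
  rw [← (measurePreserving_emb_cell R).map_eq]
  infer_instance

section Slices

variable {F : Type*} [NormedAddCommGroup F]

lemma integral_cell [NormedSpace ℝ F] {R : ℝ} {f : E3 → F}
    (hf : Integrable f (volume.restrict (cell R))) :
    ∫ x in cell R, f x = ∫ t in Ioo 0 R, ∫ y in square, f (emb (y, t)) := by
  rw [← (measurePreserving_emb_cell R).integral_comp measurableEmbedding_emb, integral_prod_symm]
  exact (measurePreserving_emb_cell R).integrable_comp_of_integrable hf

lemma integral_strip [NormedSpace ℝ F] {R : ℝ} {f : E3 → F}
    (hf : Integrable f (volume.restrict (strip R))) :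
    ∫ x in strip R, f x = ∫ y, ∫ t in Ioo 0 R, f (emb (y, t)) := by
  rw [← (measurePreserving_emb_strip R).integral_comp measurableEmbedding_emb, integral_prod]
  exact (measurePreserving_emb_strip R).integrable_comp_of_integrable hf

lemma ae_slice_integrable {R : ℝ} {f : E3 → F}
    (hf : Integrable f (volume.restrict (cell R))) :
    ∀ᵐ t ∂volume.restrict (Ioo 0 R), Integrable (fun y => f (emb (y, t)))
      (volume.restrict square) :=
  ((measurePreserving_emb_cell R).integrable_comp_of_integrable hf).prod_left_ae

lemma integral_slice_integrable [NormedSpace ℝ F] {R : ℝ} {f : E3 → F}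
    (hf : Integrable f (volume.restrict (cell R))) :
    IntegrableOn (fun t => ∫ y in square, f (emb (y, t))) (Ioo 0 R) :=
  ((measurePreserving_emb_cell R).integrable_comp_of_integrable hf).integral_prod_right

end Slices

section Coef

variable {F : Type*} [NormedAddCommGroup F] [NormedSpace ℂ F]

lemma fourierCoef_eq_sliceCoef (t : ℝ) (α : E2) (f : E3 → F) (j : Idx) :
    fourierCoef t α f j = sliceCoef α (fun y => f (emb (y, t))) j := rfl

lemma continuous_hor : Continuous hor := by
  unfold hor; fun_prop

lemma integrable_amplitude_mul {R : ℝ} {α : E2} {f : E3 → ℂ}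
    (hf : Integrable f (volume.restrict (cell R))) {χ : ℝ → ℂ} (hχ : Continuous χ) (j : Idx) :
    Integrable (fun x => χ (x 2) * planeWave α j (hor x) * f x) (volume.restrict (cell R)) := by
  obtain ⟨C, hC⟩ := isCompact_Icc.exists_bound_of_continuousOn (s := Icc 0 R) hχ.continuousOn
  have hc : Continuous fun x : E3 => χ (x 2) * planeWave α j (hor x) :=
    (hχ.comp (by fun_prop)).mul ((continuous_planeWave α j).comp continuous_hor)
  refine hf.bdd_mul (c := C) hc.aestronglyMeasurable ?_
  filter_upwards [ae_restrict_mem (measurableSet_cell R)] with x hx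
  rw [norm_mul, norm_planeWave, mul_one]
  exact hC _ ⟨hx.2.2.1.le, hx.2.2.2.le⟩

/-- Integration against a plane wave with vertical amplitude `χ`. -/
lemma integral_cell_planeWave {R : ℝ} {α : E2} {f : E3 → ℂ}
    (hf : Integrable f (volume.restrict (cell R))) {χ : ℝ → ℂ} (hχ : Continuous χ) (j : Idx) :
    ∫ x in cell R, χ (x 2) * planeWave α j (hor x) * f x =
      ((2 * Real.pi : ℝ) : ℂ) * ∫ t in Ioo 0 R, χ t * fourierCoef t α f j := by
  have hi : Integrable (fun x => χ (x 2) * planeWave α j (hor x) * f x)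
      (volume.restrict (cell R)) := integrable_amplitude_mul hf hχ j
  rw [integral_cell hi, ← integral_const_mul]
  refine integral_congr_ae (Eventually.of_forall fun t => ?_)
  have hp : ((2 * Real.pi : ℝ) : ℂ) ≠ 0 := by
    have : (2 * Real.pi) ≠ 0 := by positivity
    exact_mod_cast this
  simp only [fourierCoef_eq_sliceCoef, sliceCoef, emb_two, hor_emb, mul_assoc, smul_eq_mul]
  rw [integral_const_mul, mul_left_comm (χ t), mul_inv_cancel_left₀ hp]

lemma integrableOn_fourierCoef {R : ℝ} {α : E2} {f : E3 → F}
    (hf : Integrable f (volume.restrict (cell R))) (j : Idx) :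
    IntegrableOn (fun t => fourierCoef t α f j) (Ioo 0 R) := by
  have h1 : Integrable (fun x => planeWave α j (hor x) • f x) (volume.restrict (cell R)) := by
    refine hf.bdd_smul 1 ?_ (Eventually.of_forall fun x => (norm_planeWave _ _ _).le)
    exact ((continuous_planeWave α j).comp continuous_hor).aestronglyMeasurable
  have h2 := (integral_slice_integrable h1).smul (((2 * Real.pi : ℝ) : ℂ)⁻¹)
  simp only [hor_emb] at h2
  exact h2

/-- Slices of an integrable function are integrable only at almost every height, which is why
additivity is an almost everywhere statement. -/
lemma fourierCoef_add_ae {R : ℝ} {α : E2} {f g : E3 → F}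
    (hf : Integrable f (volume.restrict (cell R))) (hg : Integrable g (volume.restrict (cell R)))
    (j : Idx) : ∀ᵐ t ∂volume.restrict (Ioo 0 R),
      fourierCoef t α (fun x => f x + g x) j = fourierCoef t α f j + fourierCoef t α g j := by
  filter_upwards [ae_slice_integrable hf, ae_slice_integrable hg] with t h1 h2
  have hb {h : E2 → F} (hh : Integrable h (volume.restrict square)) :
      Integrable (fun y => planeWave α j y • h y) (volume.restrict square) :=
    hh.bdd_smul 1 (continuous_planeWave α j).aestronglyMeasurable
      (Eventually.of_forall fun x => (norm_planeWave _ _ _).le)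
  simp only [fourierCoef_eq_sliceCoef, sliceCoef, smul_add]
  rw [integral_add (hb h1) (hb h2), smul_add]

lemma fourierCoef_const_smul (t : ℝ) (α : E2) (f : E3 → F) (c : ℂ) (j : Idx) :
    fourierCoef t α (fun x => c • f x) j = c • fourierCoef t α f j := by
  simp only [fourierCoef_eq_sliceCoef, sliceCoef, smul_comm _ c]
  rw [integral_smul, smul_comm]

lemma fourierCoef_sub_ae {R : ℝ} {α : E2} {f g : E3 → F}
    (hf : Integrable f (volume.restrict (cell R))) (hg : Integrable g (volume.restrict (cell R)))
    (j : Idx) : ∀ᵐ t ∂volume.restrict (Ioo 0 R),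
      fourierCoef t α (fun x => f x - g x) j = fourierCoef t α f j - fourierCoef t α g j := by
  filter_upwards [fourierCoef_add_ae (α := α) hf (hg.smul (-1 : ℂ)) j] with t ht
  have h2 := fourierCoef_const_smul t α g (-1) j
  simp only [neg_smul, one_smul] at h2
  simp only [Pi.smul_apply, neg_smul, one_smul, ← sub_eq_add_neg] at ht
  rw [ht, sub_eq_add_neg, ← h2]; rfl

lemma ae_slice_memLp {R : ℝ} {f : E3 → ℂ} (hf : MemLp f 2 (volume.restrict (cell R))) :
    ∀ᵐ t ∂volume.restrict (Ioo 0 R), MemLp (fun y => f (emb (y, t))) 2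
      (volume.restrict square) := by
  have h1 := ae_slice_integrable (integrable_norm_sq hf)
  have h2 := ((hf.1.comp_measurePreserving (measurePreserving_emb_cell R))).prod_swap.prodMk_left
  filter_upwards [h1, h2] with t h3 h4
  exact (memLp_two_iff_integrable_sq_norm h4).2 h3

lemma norm_fourierCoef_sq_le_ae {R : ℝ} {α : E2} {f : E3 → ℂ}
    (hf : MemLp f 2 (volume.restrict (cell R))) : ∀ᵐ t ∂volume.restrict (Ioo 0 R),
      HasSum (fun j : Idx => ‖fourierCoef t α f j‖ ^ 2) (∫ y in square, ‖f (emb (y, t))‖ ^ 2) := by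
  filter_upwards [ae_slice_memLp hf] with t ht using hasSum_sliceCoef α ht

lemma memLp_fourierCoef {R : ℝ} {α : E2} {f : E3 → ℂ}
    (hf : MemLp f 2 (volume.restrict (cell R))) (j : Idx) :
    MemLp (fun t => fourierCoef t α f j) 2 (volume.restrict (Ioo 0 R)) := by
  have hm := (integrableOn_fourierCoef (α := α) (hf.integrable one_le_two) j).aestronglyMeasurable
  rw [memLp_two_iff_integrable_sq_norm hm]
  -- At almost every height one coefficient is dominated by the `L²` norm of the slice.
  refine Integrable.mono (integral_slice_integrable (integrable_norm_sq hf)) (hm.norm.pow 2) ?_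
  filter_upwards [norm_fourierCoef_sq_le_ae (α := α) hf] with t ht
  rw [Real.norm_of_nonneg (by positivity), Real.norm_of_nonneg (by positivity)]
  exact le_hasSum ht j fun _ _ => by positivity

/-- Parseval's identity on a cell, for Fourier series in the horizontal variables. -/
lemma hasSum_integral_fourierCoef {R : ℝ} {α : E2} {f : E3 → ℂ}
    (hf : MemLp f 2 (volume.restrict (cell R))) :
    HasSum (fun j : Idx => ∫ t in Ioo 0 R, ‖fourierCoef t α f j‖ ^ 2)
      (∫ x in cell R, ‖f x‖ ^ 2) := by
  have hi (j : Idx) := integrable_norm_sq (memLp_fourierCoef (α := α) hf j)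
  -- Slicewise Bessel bounds all finite sums by the norm of `f`, which justifies exchanging sum and
  -- integral.
  have hs : Summable fun j : Idx => ∫ t in Ioo 0 R, ‖‖fourierCoef t α f j‖ ^ 2‖ := by
    refine summable_of_sum_le (c := ∫ t in Ioo 0 R, ∫ y in square, ‖f (emb (y, t))‖ ^ 2)
      (fun j => integral_nonneg fun t => norm_nonneg _) fun s => ?_
    rw [← integral_finsetSum _ fun j _ => (hi j).norm]
    refine integral_mono_ae (integrable_finsetSum _ fun j _ => (hi j).norm)
      (integral_slice_integrable (integrable_norm_sq hf)) ?_
    filter_upwards [norm_fourierCoef_sq_le_ae (α := α) hf] with t ht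
    simp only [norm_pow, norm_norm]
    exact sum_le_hasSum s (fun _ _ => by positivity) ht
  have h := hasSum_integral_of_summable_integral_norm hi hs
  rw [integral_cell (integrable_norm_sq hf)]
  convert! h using 1
  refine integral_congr_ae ?_
  filter_upwards [norm_fourierCoef_sq_le_ae (α := α) hf] with t ht using ht.tsum_eq.symm

end Coef

/-! ### Test functions with a single Fourier mode -/

/-- The quasi-periodic function `χ(x₃) exp (-i α_j · y)`. -/
def modeFn (α : E2) (j : Idx) (χ : ℝ → ℝ) (x : E3) : ℂ :=
  (χ (x 2) : ℂ) * (starRingEnd ℂ) (planeWave α j (hor x))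

lemma conj_modeFn (α : E2) (j : Idx) (χ : ℝ → ℝ) (x : E3) :
    (starRingEnd ℂ) (modeFn α j χ x) = (χ (x 2) : ℂ) * planeWave α j (hor x) := by
  simp [modeFn]

lemma conj_planeWave_hor (α : E2) (j : Idx) (x : E3) :
    (starRingEnd ℂ) (planeWave α j (hor x)) =
      Complex.exp ((-((wave α j 0) * x 0 + (wave α j 1) * x 1 : ℝ) : ℂ) * Complex.I) := by
  rw [planeWave, ← Complex.exp_conj, map_mul, Complex.conj_I, Complex.conj_ofReal, inner_wave]
  congr 1
  simp only [mul_neg, neg_mul]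
  rfl

lemma contDiff_modeFn (α : E2) (j : Idx) {χ : ℝ → ℝ} (hχ : ContDiff ℝ ∞ χ) :
    ContDiff ℝ ∞ (modeFn α j χ) := by
  have h : modeFn α j χ = fun x : E3 => (χ (x 2) : ℂ) *
      Complex.exp ((-((wave α j 0) * x 0 + (wave α j 1) * x 1 : ℝ) : ℂ) * Complex.I) := by
    ext x; rw [modeFn, conj_planeWave_hor]
  rw [h]
  have h2 : ContDiff ℝ ∞ fun x : E3 => x 2 := by fun_prop
  have h0 : ContDiff ℝ ∞ fun x : E3 => (wave α j 0) * x 0 + (wave α j 1) * x 1 := by fun_prop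
  refine ((Complex.ofRealCLM.contDiff).comp (hχ.comp h2)).mul ?_
  refine ContDiff.cexp (((Complex.ofRealCLM.contDiff).comp h0).neg.mul contDiff_const)

lemma planeWave_shift (α : E2) (j l : Idx) (x : E3) :
    (starRingEnd ℂ) (planeWave α j (hor (x + shift l))) =
      phase α l * (starRingEnd ℂ) (planeWave α j (hor x)) := by
  rw [conj_planeWave_hor, conj_planeWave_hor, phase, ← Complex.exp_add]
  rw [Complex.exp_eq_exp_iff_exists_int]
  -- The factor `exp (-i (α + j) · 2π l)` differs from the phase by `exp (-2π i j · l)`, and `j · l`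
  -- is an integer.
  refine ⟨-(j 0 * l 0 + j 1 * l 1), ?_⟩
  have e0 : (x + shift l) 0 = x 0 + 2 * Real.pi * l 0 := rfl
  have e1 : (x + shift l) 1 = x 1 + 2 * Real.pi * l 1 := rfl
  have w0 : wave α j 0 = α 0 + j 0 := rfl
  have w1 : wave α j 1 = α 1 + j 1 := rfl
  rw [e0, e1, w0, w1]
  push_cast; ring

lemma isQPSmooth_modeFn (α : E2) (j : Idx) {χ : ℝ → ℝ} (hχ : ContDiff ℝ ∞ χ) :
    IsQPSmooth α (modeFn α j χ) := by
  refine ⟨contDiff_modeFn α j hχ, fun l x => ?_⟩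
  have e2 : (x + shift l) 2 = x 2 := by
    change x 2 + 0 = x 2; rw [add_zero]
  rw [modeFn, planeWave_shift, e2, modeFn, smul_eq_mul]; ring

lemma partialD_eq_of_hasDerivAt {F : Type*} [NormedAddCommGroup F] [NormedSpace ℝ F] {i : Fin 3}
    {f : E3 → F} {x : E3} {d : F} (hf : DifferentiableAt ℝ f x)
    (h : HasDerivAt (fun s : ℝ => f (x + s • EuclideanSpace.single i (1 : ℝ))) d 0) :
    partialD i f x = d := by
  have h1 : HasLineDerivAt ℝ f d x (EuclideanSpace.single i (1 : ℝ)) := h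
  exact (hf.hasFDerivAt.hasLineDerivAt _).unique h1

lemma modeFn_line (α : E2) (j : Idx) (χ : ℝ → ℝ) (x : E3) (s : ℝ) :
    modeFn α j χ (x + s • EuclideanSpace.single 0 (1 : ℝ)) =
      modeFn α j χ x * Complex.exp (-(Complex.I * (wave α j 0 : ℂ)) * s) ∧
    modeFn α j χ (x + s • EuclideanSpace.single 1 (1 : ℝ)) =
      modeFn α j χ x * Complex.exp (-(Complex.I * (wave α j 1 : ℂ)) * s) ∧
    modeFn α j χ (x + s • EuclideanSpace.single 2 (1 : ℝ)) =
      (χ (x 2 + s) : ℂ) * (starRingEnd ℂ) (planeWave α j (hor x)) := by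
  simp only [modeFn, conj_planeWave_hor]
  refine ⟨?_, ?_, ?_⟩
  · rw [mul_assoc, ← Complex.exp_add]
    congr 2
    · simp
    · simp; ring
  · rw [mul_assoc, ← Complex.exp_add]
    congr 2
    · simp
    · simp; ring
  · simp

lemma partialD_modeFn (α : E2) (j : Idx) {χ : ℝ → ℝ} (hχ : ContDiff ℝ ∞ χ) (x : E3) :
    partialD 0 (modeFn α j χ) x = -(Complex.I * (wave α j 0 : ℂ)) * modeFn α j χ x ∧
    partialD 1 (modeFn α j χ) x = -(Complex.I * (wave α j 1 : ℂ)) * modeFn α j χ x ∧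
    partialD 2 (modeFn α j χ) x = modeFn α j (deriv χ) x := by
  have hd := (contDiff_modeFn α j hχ).differentiable (by simp) x
  have hexp (c : ℂ) : HasDerivAt (fun s : ℝ => modeFn α j χ x * Complex.exp (c * s))
      (c * modeFn α j χ x) 0 := by
    have h1 : HasDerivAt (fun s : ℝ => c * (s : ℂ)) c 0 := by
      simpa using (Complex.ofRealCLM.hasDerivAt (x := 0)).const_mul c
    have h2 := (h1.cexp).const_mul (modeFn α j χ x)
    simpa [mul_comm] using h2
  refine ⟨partialD_eq_of_hasDerivAt hd ?_, partialD_eq_of_hasDerivAt hd ?_,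
    partialD_eq_of_hasDerivAt hd ?_⟩
  · simp only [(modeFn_line α j χ x _).1]; exact hexp _
  · simp only [(modeFn_line α j χ x _).2.1]; exact hexp _
  · simp only [(modeFn_line α j χ x _).2.2]
    have h1 : HasDerivAt χ (deriv χ (x 2)) (x 2 + 0) := by
      rw [add_zero]; exact ((hχ.differentiable (by simp)) (x 2)).hasDerivAt
    have h2 := ((h1.comp_const_add (x 2) 0).ofReal_comp).mul_const
      ((starRingEnd ℂ) (planeWave α j (hor x)))
    exact h2

lemma fourierCoef_modeFn (α : E2) (j l : Idx) (χ : ℝ → ℝ) (t : ℝ) :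
    fourierCoef t α (modeFn α j χ) l =
      if l = j then ((2 * Real.pi : ℝ) : ℂ) * (χ t : ℂ) else 0 := by
  rw [fourierCoef_eq_sliceCoef]
  have h : (fun y => modeFn α j χ (emb (y, t))) =
      fun y => (starRingEnd ℂ) (planeWave α j y) • (χ t : ℂ) := by
    ext y; simp only [modeFn, emb_two, hor_emb, smul_eq_mul, mul_comm]
  rw [h, sliceCoef_planeWave, smul_eq_mul]

/-- The vector field with the single nonzero component `ψ`. -/
def axisField (i : Fin 3) (ψ : E3 → ℂ) (x : E3) : C3 := ψ x • EuclideanSpace.single i (1 : ℂ)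

lemma isQPSmooth_axisField {α : E2} {ψ : E3 → ℂ} (hψ : IsQPSmooth α ψ) (i : Fin 3) :
    IsQPSmooth α (axisField i ψ) := by
  refine ⟨hψ.1.smul contDiff_const, fun l x => ?_⟩
  rw [axisField, hψ.2, axisField, smul_smul, smul_eq_mul]

lemma partialD_axisField {ψ : E3 → ℂ} {x : E3} (hψ : DifferentiableAt ℝ ψ x) (i l : Fin 3) :
    partialD l (axisField i ψ) x = partialD l ψ x • EuclideanSpace.single i (1 : ℂ) := by
  have := (hψ.hasFDerivAt.smul_const (EuclideanSpace.single i (1 : ℂ) : C3)).fderiv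
  change fderiv ℝ (axisField i ψ) x _ = _
  unfold axisField
  rw [this]; rfl

lemma fourierCoef_axisField (i : Fin 3) (ψ : E3 → ℂ) (t : ℝ) (α : E2) (j : Idx) :
    fourierCoef t α (axisField i ψ) j = fourierCoef t α ψ j • EuclideanSpace.single i (1 : ℂ) := by
  simp only [fourierCoef_eq_sliceCoef, sliceCoef, axisField, smul_smul]
  rw [integral_smul_const, smul_smul]; rfl

lemma inner_axisField (i : Fin 3) (ψ : E3 → ℂ) (x : E3) (c : C3) :
    inner ℂ (axisField i ψ x) c = (starRingEnd ℂ) (ψ x) * c i := by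
  rw [axisField, inner_smul_left, EuclideanSpace.inner_single_left]; simp

lemma curl_axisField {ψ : E3 → ℂ} {x : E3} (hψ : DifferentiableAt ℝ ψ x) :
    curl (axisField 0 ψ) x = !₂[0, partialD 2 ψ x, -partialD 1 ψ x] ∧
    curl (axisField 1 ψ) x = !₂[-partialD 2 ψ x, 0, partialD 0 ψ x] ∧
    curl (axisField 2 ψ) x = !₂[partialD 1 ψ x, -partialD 0 ψ x, 0] := by
  simp only [curl, partialD_axisField hψ]
  refine ⟨?_, ?_, ?_⟩ <;> congr 1 <;> ext i <;> fin_cases i <;> simp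

/-- The Fourier coefficient at height `t` of a component of a vector field. -/
def compCoef (α : E2) (u : E3 → C3) (l : Fin 3) (j : Idx) (t : ℝ) : ℂ :=
  fourierCoef t α (fun x => u x l) j

lemma MemL2.comp {R : ℝ} {α : E2} {u : E3 → C3} (hu : MemL2 R α u) (l : Fin 3) :
    MemLp (fun x => u x l) 2 (volume.restrict (cell R)) := hu.1.eval_piLp l

lemma MemL2.comp_integrable {R : ℝ} {α : E2} {u : E3 → C3} (hu : MemL2 R α u) (l : Fin 3) :
    Integrable (fun x => u x l) (volume.restrict (cell R)) := (hu.comp l).integrable one_le_two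

lemma MemL2.memLp_compCoef {R : ℝ} {α : E2} {u : E3 → C3} (hu : MemL2 R α u) (l : Fin 3)
    (j : Idx) : MemLp (compCoef α u l j) 2 (volume.restrict (Ioo 0 R)) :=
  memLp_fourierCoef (hu.comp l) j

lemma isWeakCurl_weakCurl {R : ℝ} {α : E2} {u : E3 → C3} (hu : MemHcurl R α u) :
    IsWeakCurl R α u (weakCurl R α u) := by
  have h := hu.2
  rw [weakCurl, dif_pos h]
  exact h.choose_spec

lemma isTopTrace_topTrace {R : ℝ} {α : E2} {u : E3 → C3} (hu : MemX R α u) :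
    IsTopTrace R α u (topTrace R α u) := by
  have h := hu.exists_trace
  rw [topTrace, dif_pos h]
  exact h.choose_spec

lemma pairing_axisField (α : E2) (j : Idx) (χ : ℝ → ℝ) (R : ℝ) (i : Fin 3) (φ : Idx → C3) :
    pairing φ (fourierCoef R α (axisField i (modeFn α j χ))) =
      ((2 * Real.pi : ℝ) : ℂ) * ((χ R : ℂ) * φ j i) := by
  rw [pairing, tsum_eq_single j]
  · rw [fourierCoef_axisField, fourierCoef_modeFn, if_pos rfl, inner_smul_left,
      EuclideanSpace.inner_single_left]
    simp only [map_mul, Complex.conj_ofReal, map_one, one_mul, mul_assoc]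
  · intro l hl
    rw [fourierCoef_axisField, fourierCoef_modeFn, if_neg hl, zero_smul, inner_zero_left]

lemma pairing_modeFn (α : E2) (j : Idx) (χ : ℝ → ℝ) (R : ℝ) (φ : Idx → ℂ) :
    pairing φ (fourierCoef R α (modeFn α j χ)) =
      ((2 * Real.pi : ℝ) : ℂ) * ((χ R : ℂ) * φ j) := by
  rw [pairing, tsum_eq_single j]
  · rw [fourierCoef_modeFn, if_pos rfl]
    simp only [RCLike.inner_apply, map_mul, Complex.conj_ofReal]; ring
  · intro l hl
    rw [fourierCoef_modeFn, if_neg hl, inner_zero_left]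

lemma integral_conj_modeFn {R : ℝ} {α : E2} {f : E3 → ℂ}
    (hf : Integrable f (volume.restrict (cell R))) {χ : ℝ → ℝ} (hχ : Continuous χ) (j : Idx) :
    Integrable (fun x => (starRingEnd ℂ) (modeFn α j χ x) * f x) (volume.restrict (cell R)) ∧
    ∫ x in cell R, (starRingEnd ℂ) (modeFn α j χ x) * f x =
      ((2 * Real.pi : ℝ) : ℂ) * ∫ t in Ioo 0 R, (χ t : ℂ) * fourierCoef t α f j := by
  simp only [conj_modeFn]
  have hc : Continuous fun t => (χ t : ℂ) := Complex.continuous_ofReal.comp hχ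
  exact ⟨integrable_amplitude_mul hf hc j, integral_cell_planeWave hf hc j⟩

lemma integrableOn_real_mul {R : ℝ} {χ : ℝ → ℝ} (hχ : Continuous χ) {f : ℝ → ℂ}
    (hf : IntegrableOn f (Ioo 0 R)) : IntegrableOn (fun t => (χ t : ℂ) * f t) (Ioo 0 R) := by
  obtain ⟨C, hC⟩ := isCompact_Icc.exists_bound_of_continuousOn (s := Icc 0 R) hχ.continuousOn
  refine Integrable.bdd_mul (c := C) hf
    (Complex.continuous_ofReal.comp hχ).aestronglyMeasurable ?_
  filter_upwards [ae_restrict_mem measurableSet_Ioo] with t ht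
  simpa using hC t ⟨ht.1.le, ht.2.le⟩

lemma integral_comb3 {X : Type*} [MeasurableSpace X] {m : Measure X} {f g h : X → ℂ}
    (hf : Integrable f m) (hg : Integrable g m) (hh : Integrable h m) {a b c : ℂ} :
    ∫ x, (a * f x + b * g x + c * h x) ∂m =
      a * ∫ x, f x ∂m + b * ∫ x, g x ∂m + c * ∫ x, h x ∂m := by
  rw [← integral_const_mul, ← integral_const_mul, ← integral_const_mul,
    ← integral_add (hf.const_mul a) (hg.const_mul b)]
  exact integral_add ((hf.const_mul a).add (hg.const_mul b)) (hh.const_mul c)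

/-- Green's formula tested with the single modes. -/
lemma greenCurl_modeFn {R : ℝ} {α : E2} {u : E3 → C3} (hu : MemHcurl R α u) (j : Idx)
    {χ : ℝ → ℝ} (hχ : ContDiff ℝ ∞ χ) :
    greenCurl R α u (axisField 0 (modeFn α j χ)) = ((2 * Real.pi : ℝ) : ℂ) *
      -(∫ t in Ioo 0 R, (((deriv χ t : ℝ) : ℂ) * compCoef α u 1 j t + (χ t : ℂ) *
        -(compCoef α (weakCurl R α u) 0 j t + Complex.I * wave α j 1 * compCoef α u 2 j t))) ∧
    greenCurl R α u (axisField 1 (modeFn α j χ)) = ((2 * Real.pi : ℝ) : ℂ) *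
      (∫ t in Ioo 0 R, (((deriv χ t : ℝ) : ℂ) * compCoef α u 0 j t + (χ t : ℂ) *
        (compCoef α (weakCurl R α u) 1 j t - Complex.I * wave α j 0 * compCoef α u 2 j t))) ∧
    greenCurl R α u (axisField 2 (modeFn α j χ)) = ((2 * Real.pi : ℝ) : ℂ) *
      (∫ t in Ioo 0 R, (χ t : ℂ) * (compCoef α (weakCurl R α u) 2 j t -
        Complex.I * (wave α j 1 * compCoef α u 0 j t - wave α j 0 * compCoef α u 1 j t))) := by
  have hcu := (isWeakCurl_weakCurl hu).1
  set c := weakCurl R α u with hc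
  have hd (x : E3) := (contDiff_modeFn α j hχ).differentiable (by simp) x
  have hχc := hχ.continuous
  have hχ'c : Continuous (deriv χ) := hχ.continuous_deriv (by simp)
  have U (l : Fin 3) := integral_conj_modeFn (α := α) (hu.1.comp_integrable l) hχc j
  have U' (l : Fin 3) := integral_conj_modeFn (α := α) (hu.1.comp_integrable l) hχ'c j
  have Cc (l : Fin 3) := integral_conj_modeFn (α := α) (hcu.comp_integrable l) hχc j
  have iU (l : Fin 3) : IntegrableOn (fun t => (χ t : ℂ) * compCoef α u l j t) (Ioo 0 R) :=
    integrableOn_real_mul hχc (integrableOn_fourierCoef (hu.1.comp_integrable l) j)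
  have iU' (l : Fin 3) : IntegrableOn (fun t => ((deriv χ t : ℝ) : ℂ) * compCoef α u l j t)
      (Ioo 0 R) :=
    integrableOn_real_mul hχ'c (integrableOn_fourierCoef (hu.1.comp_integrable l) j)
  have iC (l : Fin 3) : IntegrableOn (fun t => (χ t : ℂ) * compCoef α c l j t) (Ioo 0 R) :=
    integrableOn_real_mul hχc (integrableOn_fourierCoef (hcu.comp_integrable l) j)
  refine ⟨?_, ?_, ?_⟩
  · have e : ∀ x, inner ℂ (axisField 0 (modeFn α j χ) x) (c x) -
        inner ℂ (curl (axisField 0 (modeFn α j χ)) x) (u x) =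
        1 * ((starRingEnd ℂ) (modeFn α j χ x) * c x 0) +
          (-1) * ((starRingEnd ℂ) (modeFn α j (deriv χ) x) * u x 1) +
          (Complex.I * wave α j 1) * ((starRingEnd ℂ) (modeFn α j χ x) * u x 2) := fun x => by
      rw [inner_axisField, (curl_axisField (hd x)).1, (partialD_modeFn α j hχ x).2.1,
        (partialD_modeFn α j hχ x).2.2]
      simp [PiLp.inner_apply, Fin.sum_univ_three]; ring
    have e2 : ∀ t, ((deriv χ t : ℝ) : ℂ) * compCoef α u 1 j t + (χ t : ℂ) *
        -(compCoef α c 0 j t + Complex.I * wave α j 1 * compCoef α u 2 j t) =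
        1 * (((deriv χ t : ℝ) : ℂ) * compCoef α u 1 j t) + (-1) * ((χ t : ℂ) * compCoef α c 0 j t) +
          (-(Complex.I * wave α j 1)) * ((χ t : ℂ) * compCoef α u 2 j t) := fun t => by ring
    rw [greenCurl, integral_congr_ae (Eventually.of_forall e),
      integral_congr_ae (Eventually.of_forall e2), integral_comb3 (Cc 0).1 (U' 1).1 (U 2).1,
      integral_comb3 (iU' 1) (iC 0) (iU 2), (Cc 0).2, (U' 1).2, (U 2).2]
    simp only [compCoef]; ring
  · have e : ∀ x, inner ℂ (axisField 1 (modeFn α j χ) x) (c x) -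
        inner ℂ (curl (axisField 1 (modeFn α j χ)) x) (u x) =
        1 * ((starRingEnd ℂ) (modeFn α j χ x) * c x 1) +
          1 * ((starRingEnd ℂ) (modeFn α j (deriv χ) x) * u x 0) +
          (-(Complex.I * wave α j 0)) * ((starRingEnd ℂ) (modeFn α j χ x) * u x 2) := fun x => by
      rw [inner_axisField, (curl_axisField (hd x)).2.1, (partialD_modeFn α j hχ x).1,
        (partialD_modeFn α j hχ x).2.2]
      simp [PiLp.inner_apply, Fin.sum_univ_three]; ring
    have e2 : ∀ t, ((deriv χ t : ℝ) : ℂ) * compCoef α u 0 j t + (χ t : ℂ) *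
        (compCoef α c 1 j t - Complex.I * wave α j 0 * compCoef α u 2 j t) =
        1 * (((deriv χ t : ℝ) : ℂ) * compCoef α u 0 j t) + 1 * ((χ t : ℂ) * compCoef α c 1 j t) +
          (-(Complex.I * wave α j 0)) * ((χ t : ℂ) * compCoef α u 2 j t) := fun t => by ring
    rw [greenCurl, integral_congr_ae (Eventually.of_forall e),
      integral_congr_ae (Eventually.of_forall e2), integral_comb3 (Cc 1).1 (U' 0).1 (U 2).1,
      integral_comb3 (iU' 0) (iC 1) (iU 2), (Cc 1).2, (U' 0).2, (U 2).2]
    simp only [compCoef]; ring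
  · have e : ∀ x, inner ℂ (axisField 2 (modeFn α j χ) x) (c x) -
        inner ℂ (curl (axisField 2 (modeFn α j χ)) x) (u x) =
        1 * ((starRingEnd ℂ) (modeFn α j χ x) * c x 2) +
          (-(Complex.I * wave α j 1)) * ((starRingEnd ℂ) (modeFn α j χ x) * u x 0) +
          (Complex.I * wave α j 0) * ((starRingEnd ℂ) (modeFn α j χ x) * u x 1) := fun x => by
      rw [inner_axisField, (curl_axisField (hd x)).2.2, (partialD_modeFn α j hχ x).1,
        (partialD_modeFn α j hχ x).2.1]
      simp [PiLp.inner_apply, Fin.sum_univ_three]; ring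
    have e2 : ∀ t, (χ t : ℂ) * (compCoef α c 2 j t -
        Complex.I * (wave α j 1 * compCoef α u 0 j t - wave α j 0 * compCoef α u 1 j t)) =
        1 * ((χ t : ℂ) * compCoef α c 2 j t) +
          (-(Complex.I * wave α j 1)) * ((χ t : ℂ) * compCoef α u 0 j t) +
          (Complex.I * wave α j 0) * ((χ t : ℂ) * compCoef α u 1 j t) := fun t => by ring
    rw [greenCurl, integral_congr_ae (Eventually.of_forall e),
      integral_congr_ae (Eventually.of_forall e2), integral_comb3 (Cc 2).1 (U 0).1 (U 1).1,
      integral_comb3 (iC 2) (iU 0) (iU 1), (Cc 2).2, (U 0).2, (U 1).2]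
    simp only [compCoef]; ring

/-! ### The tangential components of a single mode -/

lemma exists_lower_bound_support {R : ℝ} {η : ℝ → ℝ} (hc : HasCompactSupport η)
    (hs : tsupport η ⊆ Ioo 0 R) : ∃ s, 0 < s ∧ ∀ t < s, η t = 0 := by
  by_cases hne : (tsupport η).Nonempty
  · obtain ⟨m, hm, hmin⟩ := hc.isCompact.exists_isMinOn hne continuousOn_id
    refine ⟨m, (hs hm).1, fun t ht => ?_⟩
    by_contra h
    exact absurd (hmin (subset_tsupport _ h)) (not_le.2 ht)
  · refine ⟨1, one_pos, fun t _ => ?_⟩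
    have : η = 0 := by rwa [not_nonempty_iff_eq_empty, tsupport_eq_empty_iff] at hne
    simp [this]

/-- The right-hand side `g` is controlled only on `(0, R)`; extended by zero it has a primitive on
the whole line, and the extension is invisible in the weak identity. -/
lemma exists_primitive_of_weak {R : ℝ} (hR : 0 < R) {f g : ℝ → ℂ} {b : ℂ}
    (hf : IntegrableOn f (Ioo 0 R)) (hg : IntegrableOn g (Ioo 0 R))
    (h : ∀ χ : ℝ → ℝ, ContDiff ℝ ∞ χ → (∃ s, 0 < s ∧ ∀ t < s, χ t = 0) →
      ∫ t in Ioo 0 R, (((deriv χ t : ℝ) : ℂ) * f t + (χ t : ℂ) * g t) = (χ R : ℂ) * b) :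
    ∃ F G : ℝ → ℂ, IsPrimitive F G ∧ (∀ᵐ t ∂volume.restrict (Ioo 0 R), f t = F t) ∧
      (∀ᵐ t ∂volume.restrict (Ioo 0 R), G t = g t) ∧ F R = b := by
  have hG : LocallyIntegrable ((Ioo 0 R).indicator g) :=
    (hg.integrable_indicator measurableSet_Ioo).locallyIntegrable
  have hGg : ∀ᵐ t ∂volume.restrict (Ioo 0 R), (Ioo 0 R).indicator g t = g t := by
    filter_upwards [ae_restrict_mem measurableSet_Ioo] with t ht using indicator_of_mem ht g
  refine ⟨_, _, IsPrimitive.of_value (R := R) b hG, ?_, hGg, by simp⟩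
  refine ae_eq_primitive_of_weak hR hf hG fun χ hχ hs => ?_
  rw [← h χ hχ hs]
  refine integral_congr_ae ?_
  filter_upwards [hGg] with t ht
  rw [ht]

/-- A cutoff function in the vertical variable, equal to one at the bottom and to zero in the
upper half. -/
def bottomCut (R : ℝ) (t : ℝ) : ℝ := Real.smoothTransition (2 - 4 * t / R)

lemma contDiff_bottomCut (R : ℝ) : ContDiff ℝ ∞ (bottomCut R) :=
  Real.smoothTransition.contDiff.comp (by fun_prop)

lemma bottomCut_zero (R : ℝ) : bottomCut R 0 = 1 :=
  Real.smoothTransition.one_of_one_le (by norm_num)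

lemma bottomCut_of_half_le {R t : ℝ} (hR : 0 < R) (ht : R / 2 ≤ t) : bottomCut R t = 0 := by
  refine Real.smoothTransition.zero_of_nonpos ?_
  have : 2 ≤ 4 * t / R := by rw [le_div_iff₀ hR]; linarith
  linarith

/-- The cutoff is one at `0` and zero at `R`, so integration by parts leaves only `-F 0`. -/
lemma IsPrimitive.eq_zero_of_weak {R : ℝ} (hR : 0 < R) {F G f g : ℝ → ℂ} (h : IsPrimitive F G)
    (hf : ∀ᵐ t ∂volume.restrict (Ioo 0 R), f t = F t)
    (hg : ∀ᵐ t ∂volume.restrict (Ioo 0 R), G t = g t)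
    (hw : ∫ t in Ioo 0 R, (((deriv (bottomCut R) t : ℝ) : ℂ) * f t + (bottomCut R t : ℂ) * g t)
      = 0) : F 0 = 0 := by
  have h1 := ((IsPrimitive.of_contDiff (contDiff_bottomCut R)).mul h).integral_Ioo hR
  have h2 : ∫ t in Ioo 0 R, (((deriv (bottomCut R) t : ℝ) : ℂ) * F t + (bottomCut R t : ℂ) * G t)
      = 0 := by
    rw [← hw]
    refine integral_congr_ae ?_
    filter_upwards [hf, hg] with t h3 h4
    rw [h3, h4]
  rw [h2, bottomCut_zero, bottomCut_of_half_le hR (by linarith)] at h1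
  simpa using h1

lemma ae_eq_zero_of_weak {R : ℝ} {h : ℝ → ℂ} (hh : IntegrableOn h (Ioo 0 R))
    (hw : ∀ χ : ℝ → ℝ, ContDiff ℝ ∞ χ → (∃ s, 0 < s ∧ ∀ t < s, χ t = 0) →
      ∫ t in Ioo 0 R, (χ t : ℂ) * h t = 0) :
    ∀ᵐ t ∂volume.restrict (Ioo 0 R), h t = 0 := by
  rw [ae_restrict_iff' measurableSet_Ioo]
  refine isOpen_Ioo.ae_eq_zero_of_integral_contDiff_smul_eq_zero hh.locallyIntegrableOn
    fun η hη hηc hηs => ?_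
  rw [← hw η hη (exists_lower_bound_support hηc hηs)]
  symm
  have : ∀ t, (η t : ℂ) * h t = η t • h t := fun t => (Complex.real_smul).symm
  simp only [this]
  refine setIntegral_eq_integral_of_forall_compl_eq_zero fun t ht => ?_
  have : η t = 0 := by
    by_contra hc
    exact ht (hηs (subset_tsupport _ hc))
  rw [this, zero_smul]

/-- The tangential components of a mode of a field in `X̃_α` are absolutely continuous, with
derivatives given by the curl, and attain the boundary values. -/
lemma exists_tangential_primitives {R : ℝ} (hR : 0 < R) {α : E2} {u : E3 → C3}
    (hu : MemX R α u) (j : Idx) :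
    ∃ F₀ f₀ F₁ f₁ : ℝ → ℂ, IsPrimitive F₀ f₀ ∧ IsPrimitive F₁ f₁ ∧
      (∀ᵐ t ∂volume.restrict (Ioo 0 R), compCoef α u 0 j t = F₀ t) ∧
      (∀ᵐ t ∂volume.restrict (Ioo 0 R), compCoef α u 1 j t = F₁ t) ∧
      (∀ᵐ t ∂volume.restrict (Ioo 0 R), f₀ t = compCoef α (weakCurl R α u) 1 j t -
        Complex.I * wave α j 0 * compCoef α u 2 j t) ∧
      (∀ᵐ t ∂volume.restrict (Ioo 0 R), f₁ t = -(compCoef α (weakCurl R α u) 0 j t +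
        Complex.I * wave α j 1 * compCoef α u 2 j t)) ∧
      (∀ᵐ t ∂volume.restrict (Ioo 0 R), compCoef α (weakCurl R α u) 2 j t =
        Complex.I * (wave α j 1 * compCoef α u 0 j t - wave α j 0 * compCoef α u 1 j t)) ∧
      F₀ 0 = 0 ∧ F₁ 0 = 0 ∧ F₀ R = topTrace R α u j 0 ∧ F₁ R = topTrace R α u j 1 := by
  have hcu := (isWeakCurl_weakCurl hu.hcurl).1
  have hp : ((2 * Real.pi : ℝ) : ℂ) ≠ 0 := by
    have : (2 * Real.pi) ≠ 0 := by positivity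
    exact_mod_cast this
  have htr := (isTopTrace_topTrace hu).2
  have iu (l : Fin 3) : IntegrableOn (compCoef α u l j) (Ioo 0 R) :=
    integrableOn_fourierCoef (hu.hcurl.1.comp_integrable l) j
  have ic (l : Fin 3) : IntegrableOn (compCoef α (weakCurl R α u) l j) (Ioo 0 R) :=
    integrableOn_fourierCoef (hcu.comp_integrable l) j
  have hvan {χ : ℝ → ℝ} (i : Fin 3) (hs : ∃ s, 0 < s ∧ ∀ t < s, χ t = 0) :
      ∃ s : ℝ, 0 < s ∧ ∀ x : E3, x 2 < s → axisField i (modeFn α j χ) x = 0 := by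
    obtain ⟨s, h1, h2⟩ := hs
    exact ⟨s, h1, fun x hx => by simp [axisField, modeFn, h2 _ hx]⟩
  -- Since `e₃ × φ = (-φ₁, φ₀, 0)`, a test field along axis `1` detects the component `0` of the
  -- trace, and a field along axis `0` detects minus the component `1`.
  obtain ⟨F₀, f₀, h₀, e₀, d₀, b₀⟩ := exists_primitive_of_weak hR (b := topTrace R α u j 0) (iu 0)
    (g := fun t => compCoef α (weakCurl R α u) 1 j t -
        Complex.I * wave α j 0 * compCoef α u 2 j t) ((ic 1).sub ((iu 2).const_mul _))
    (fun χ hχ hs => by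
      have h1 := htr _ (isQPSmooth_axisField (isQPSmooth_modeFn α j hχ) 1) (hvan 1 hs)
      rw [(greenCurl_modeFn hu.hcurl j hχ).2.1, pairing_axisField] at h1
      exact mul_left_cancel₀ hp h1)
  obtain ⟨F₁, f₁, h₁, e₁, d₁, b₁⟩ := exists_primitive_of_weak hR (b := topTrace R α u j 1) (iu 1)
    (g := fun t => -(compCoef α (weakCurl R α u) 0 j t +
        Complex.I * wave α j 1 * compCoef α u 2 j t)) ((ic 0).add ((iu 2).const_mul _)).neg
    (fun χ hχ hs => by
      have h1 := htr _ (isQPSmooth_axisField (isQPSmooth_modeFn α j hχ) 0) (hvan 0 hs)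
      rw [(greenCurl_modeFn hu.hcurl j hχ).1, pairing_axisField] at h1
      have h2 := mul_left_cancel₀ hp h1
      have h3 : e3cross (topTrace R α u j) 0 = -topTrace R α u j 1 := rfl
      rw [h3, mul_neg, neg_inj] at h2
      exact h2)
  -- The cutoff is not zero at the bottom, so this is where the vanishing lower trace enters.
  have hcut (i : Fin 3) : greenCurl R α u (axisField i (modeFn α j (bottomCut R))) = 0 :=
    hu.bottom _ (isQPSmooth_axisField (isQPSmooth_modeFn α j (contDiff_bottomCut R)) i)
      ⟨R / 2, by linarith, fun x hx => by
        simp [axisField, modeFn, bottomCut_of_half_le hR (t := x 2) (by linarith)]⟩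
  refine ⟨F₀, f₀, F₁, f₁, h₀, h₁, e₀, e₁, d₀, d₁, ?_, ?_, ?_, b₀, b₁⟩
  -- A vertical test field meets no tangential trace and its curl contains no vertical derivative,
  -- so the third curl relation is algebraic in `t`.
  · have h := ae_eq_zero_of_weak (h := fun t => compCoef α (weakCurl R α u) 2 j t -
        Complex.I * (wave α j 1 * compCoef α u 0 j t - wave α j 0 * compCoef α u 1 j t))
      ((ic 2).sub ((((iu 0).const_mul _).sub ((iu 1).const_mul _)).const_mul _))
      (fun χ hχ hs => by
        have h1 := htr _ (isQPSmooth_axisField (isQPSmooth_modeFn α j hχ) 2) (hvan 2 hs)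
        rw [(greenCurl_modeFn hu.hcurl j hχ).2.2, pairing_axisField] at h1
        have h2 := mul_left_cancel₀ hp h1
        have h3 : e3cross (topTrace R α u j) 2 = 0 := rfl
        rw [h3, mul_zero] at h2
        exact h2)
    filter_upwards [h] with t ht using sub_eq_zero.1 ht
  · have h1 := hcut 1
    rw [(greenCurl_modeFn hu.hcurl j (contDiff_bottomCut R)).2.1] at h1
    exact h₀.eq_zero_of_weak hR e₀ d₀ ((mul_eq_zero.1 h1).resolve_left hp)
  · have h1 := hcut 0
    rw [(greenCurl_modeFn hu.hcurl j (contDiff_bottomCut R)).1] at h1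
    exact h₁.eq_zero_of_weak hR e₁ d₁ (neg_eq_zero.1 ((mul_eq_zero.1 h1).resolve_left hp))

/-! ### Mollification of the coefficient -/

/-- A sequence of bump functions shrinking to the origin. -/
def bump (n : ℕ) : ContDiffBump (0 : E3) where
  rIn := 1 / (2 * ((n : ℝ) + 1))
  rOut := 1 / ((n : ℝ) + 1)
  rIn_pos := by positivity
  rIn_lt_rOut := by
    have : (0 : ℝ) < (n : ℝ) + 1 := by positivity
    rw [div_lt_div_iff_of_pos_left one_pos (by positivity) this]; linarith

/-- The normalized bump functions. -/
def kernel (n : ℕ) : E3 → ℝ := (bump n).normed volume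

lemma kernel_nonneg (n : ℕ) (x : E3) : 0 ≤ kernel n x := (bump n).nonneg_normed x

lemma contDiff_kernel (n : ℕ) : ContDiff ℝ ∞ (kernel n) := (bump n).contDiff_normed

lemma hasCompactSupport_kernel (n : ℕ) : HasCompactSupport (kernel n) :=
  (bump n).hasCompactSupport_normed

lemma integrable_kernel_sub (n : ℕ) (x : E3) : Integrable (fun t => kernel n (x - t)) :=
  (bump n).integrable_normed.comp_sub_left x

lemma integral_kernel_sub (n : ℕ) (x : E3) : ∫ t, kernel n (x - t) = 1 := by
  rw [integral_sub_left_eq_self (fun t => kernel n t) volume x]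
  exact (bump n).integral_normed

lemma tsupport_kernel (n : ℕ) : tsupport (kernel n) = Metric.closedBall 0 (1 / ((n : ℝ) + 1)) :=
  (bump n).tsupport_normed_eq

/-- The mollified function. -/
def mollify (n : ℕ) (f : E3 → ℂ) (x : E3) : ℂ := ∫ t, kernel n (x - t) • f t

lemma mollify_eq_convolution (n : ℕ) (f : E3 → ℂ) :
    mollify n f = convolution (kernel n) f (ContinuousLinearMap.lsmul ℝ ℝ) volume := by
  ext x
  rw [convolution_lsmul_swap]; rfl

lemma contDiff_mollify (n : ℕ) {f : E3 → ℂ} (hf : LocallyIntegrable f) :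
    ContDiff ℝ ∞ (mollify n f) := by
  rw [mollify_eq_convolution]
  exact (hasCompactSupport_kernel n).contDiff_convolution_left _ (contDiff_kernel n) hf

lemma ae_tendsto_mollify {f : E3 → ℂ} (hf : LocallyIntegrable f) :
    ∀ᵐ x, Tendsto (fun n => mollify n f x) atTop (𝓝 (f x)) := by
  have h0 : Tendsto (fun n => (bump n).rOut) atTop (𝓝 0) :=
    tendsto_one_div_add_atTop_nhds_zero_nat
  -- The outer radii are exactly twice the inner ones; such a fixed ratio is what convergence at
  -- almost every point requires.
  have h := ContDiffBump.ae_convolution_tendsto_right_of_locallyIntegrable (μ := volume)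
    (φ := bump) (l := atTop) (K := 2) h0 (Eventually.of_forall fun n => le_of_eq (by
      change 1 / ((n : ℝ) + 1) = 2 * (1 / (2 * ((n : ℝ) + 1)))
      have : (0 : ℝ) < (n : ℝ) + 1 := by positivity
      field_simp)) hf
  simp only [mollify_eq_convolution]
  exact h

lemma integrable_kernel_smul (n : ℕ) {f : E3 → ℂ} {C : ℝ} (hm : AEStronglyMeasurable f volume)
    (hC : ∀ᵐ x, ‖f x‖ ≤ C) (x : E3) : Integrable (fun t => kernel n (x - t) • f t) := by
  have := (integrable_kernel_sub n x).smul_bdd C hm hC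
  exact this

lemma norm_mollify_le (n : ℕ) {f : E3 → ℂ} {C : ℝ} (hC : ∀ᵐ x, ‖f x‖ ≤ C) (x : E3) :
    ‖mollify n f x‖ ≤ C := by
  refine (norm_integral_le_of_norm_le ((integrable_kernel_sub n x).mul_const C) ?_).trans ?_
  · filter_upwards [hC] with t ht
    rw [norm_smul, Real.norm_of_nonneg (kernel_nonneg _ _)]
    exact mul_le_mul_of_nonneg_left ht (kernel_nonneg _ _)
  · rw [integral_mul_const, integral_kernel_sub, one_mul]

/-- Averages against a probability density stay in the half-plane `Re ≥ m`. Ellipticity thus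
survives mollification, and division by the mollified coefficient is safe. -/
lemma le_re_mollify (n : ℕ) {f : E3 → ℂ} {C m : ℝ} (hm : AEStronglyMeasurable f volume)
    (hC : ∀ᵐ x, ‖f x‖ ≤ C) (hf : ∀ᵐ x, m ≤ (f x).re) (x : E3) : m ≤ (mollify n f x).re := by
  have hi := integrable_kernel_smul n hm hC x
  rw [mollify, ← integral_re_eq hi]
  calc m = ∫ t, kernel n (x - t) * m := by rw [integral_mul_const, integral_kernel_sub, one_mul]
    _ ≤ _ := by
      refine integral_mono_ae ((integrable_kernel_sub n x).mul_const m) hi.re ?_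
      filter_upwards [hf] with t ht
      simp only [Complex.real_smul, Complex.re_ofReal_mul]
      exact mul_le_mul_of_nonneg_left ht (kernel_nonneg _ _)

lemma mollify_add (n : ℕ) {f : E3 → ℂ} {a : E3} (hf : ∀ᵐ x, f (x + a) = f x) (x : E3) :
    mollify n f (x + a) = mollify n f x := by
  rw [mollify, ← integral_add_right_eq_self _ a]
  refine integral_congr_ae ?_
  filter_upwards [hf] with t ht
  rw [ht, add_sub_add_right_eq_sub]

lemma partialD_mollify (n : ℕ) {f : E3 → ℂ} (hf : LocallyIntegrable f) (i : Fin 3) (x : E3) :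
    partialD i (mollify n f) x = ∫ t, partialD i (kernel n) (x - t) • f t := by
  have h := (hasCompactSupport_kernel n).hasFDerivAt_convolution_left
    (ContinuousLinearMap.lsmul ℝ ℝ) ((contDiff_kernel n).of_le (by exact_mod_cast le_top)) hf x
  have hi := ((hasCompactSupport_kernel n).fderiv ℝ).convolutionExists_left
    ((ContinuousLinearMap.lsmul ℝ ℝ).precompL E3)
    ((contDiff_kernel n).continuous_fderiv (by simp)) hf x
  rw [partialD, mollify_eq_convolution, h.fderiv, convolution_def,
    ContinuousLinearMap.integral_apply hi]
  rw [← integral_sub_left_eq_self _ volume x]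
  refine integral_congr_ae (Eventually.of_forall fun t => ?_)
  simp only [sub_sub_cancel]
  rfl

lemma abs_coord_le (x : E3) (i : Fin 3) : |x i| ≤ ‖x‖ := by
  simpa using PiLp.norm_apply_le x i

lemma isTest_kernel {R : ℝ} {n : ℕ} {x : E3} (h0 : 1 / ((n : ℝ) + 1) < x 2)
    (h1 : x 2 < R - 1 / ((n : ℝ) + 1)) : IsTest R (fun t => kernel n (x - t)) := by
  have hsub : tsupport (fun t => kernel n (x - t)) ⊆ Metric.closedBall x (1 / ((n : ℝ) + 1)) := by
    refine closure_minimal (fun t ht => ?_) Metric.isClosed_closedBall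
    have h2 : x - t ∈ tsupport (kernel n) := subset_tsupport _ ht
    rw [tsupport_kernel, mem_closedBall_zero_iff] at h2
    rwa [Metric.mem_closedBall, dist_comm, dist_eq_norm]
  refine ⟨(contDiff_kernel n).comp (contDiff_const.sub contDiff_id),
    HasCompactSupport.of_support_subset_isCompact (isCompact_closedBall x _)
      ((subset_tsupport _).trans hsub), fun t ht => ?_⟩
  have h3 := hsub ht
  rw [Metric.mem_closedBall, dist_eq_norm] at h3
  have h4 := (abs_le.1 ((abs_coord_le (t - x) 2).trans h3))
  have h5 : (t - x) 2 = t 2 - x 2 := rfl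
  rw [h5] at h4
  exact ⟨by linarith [h4.1], by linarith [h4.2]⟩

lemma partialD_kernel_sub (n : ℕ) (i : Fin 3) (x t : E3) :
    partialD i (fun t => kernel n (x - t)) t = -partialD i (kernel n) (x - t) := by
  have h1 := ((contDiff_kernel n).differentiable (by simp) (x - t)).hasFDerivAt
  have h2 : HasFDerivAt (fun t : E3 => x - t) (-ContinuousLinearMap.id ℝ E3) t :=
    (hasFDerivAt_id t).const_sub x
  have h3 := (h1.comp t h2).fderiv
  have h4 : fderiv ℝ (fun t => kernel n (x - t)) t = _ := h3
  rw [partialD, h4]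
  simp [partialD]

/-- Away from the boundary of the strip, mollification commutes with weak derivatives. -/
lemma partialD_mollify_of_isWeakPartial {R : ℝ} {n : ℕ} {f ε g : E3 → ℂ} {i : Fin 3}
    (hf : LocallyIntegrable f) (hfε : ∀ x ∈ strip R, f x = ε x) (hg : IsWeakPartial R i ε g)
    {x : E3} (h0 : 1 / ((n : ℝ) + 1) < x 2) (h1 : x 2 < R - 1 / ((n : ℝ) + 1)) :
    partialD i (mollify n f) x = mollify n ((strip R).indicator g) x := by
  have ht := isTest_kernel h0 h1
  have h2 := hg _ ht
  have hz : ∀ t ∉ strip R, kernel n (x - t) = 0 := fun t hn => by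
    by_contra hc
    exact hn (ht.supp (subset_tsupport _ hc))
  have hz' : ∀ t ∉ strip R, partialD i (fun t => kernel n (x - t)) t = 0 := fun t hn => by
    have : fderiv ℝ (fun t => kernel n (x - t)) t = 0 := by
      by_contra hc
      exact hn (ht.supp (support_fderiv_subset ℝ hc))
    rw [partialD, this]; rfl
  rw [partialD_mollify n hf]
  -- At `x` the kernel reflected and translated is itself a test function of the strip; the sign
  -- produced by `t ↦ x - t` cancels the one in the definition of the weak derivative.
  have e1 : ∫ t, partialD i (kernel n) (x - t) • f t =
      -∫ t in strip R, partialD i (fun t => kernel n (x - t)) t • ε t := by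
    rw [← integral_neg, ← setIntegral_eq_integral_of_forall_compl_eq_zero (s := strip R)]
    · refine setIntegral_congr_fun (measurableSet_strip R) fun t hm => ?_
      simp only [hfε t hm, partialD_kernel_sub, neg_smul, neg_neg]
    · intro t hn
      have := hz' t hn
      rw [partialD_kernel_sub, neg_eq_zero] at this
      rw [this, zero_smul]
  have e2 : ∫ t, kernel n (x - t) • (strip R).indicator g t =
      ∫ t in strip R, kernel n (x - t) • g t := by
    rw [← setIntegral_eq_integral_of_forall_compl_eq_zero (s := strip R)
      (f := fun t => kernel n (x - t) • (strip R).indicator g t)]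
    · refine setIntegral_congr_fun (measurableSet_strip R) fun t hm => ?_
      simp only [indicator_of_mem hm]
    · intro t hn
      rw [hz t hn, zero_smul]
  rw [e1, h2, neg_neg, mollify, e2]

lemma memLp_top_bound {R : ℝ} {f : E3 → ℂ} (hf : MemLp f ⊤ (volume.restrict (strip R))) :
    ∃ C, 0 ≤ C ∧ ∀ᵐ x ∂volume.restrict (strip R), ‖f x‖ ≤ C := by
  refine ⟨(eLpNorm f ⊤ (volume.restrict (strip R))).toReal, ENNReal.toReal_nonneg, ?_⟩
  have h := ae_le_eLpNormEssSup (f := f) (μ := volume.restrict (strip R))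
  rw [← eLpNorm_exponent_top] at h
  filter_upwards [h] with x hx
  rw [← toReal_enorm]
  exact ENNReal.toReal_mono hf.2.ne hx

lemma locallyIntegrable_of_bound {f : E3 → ℂ} {C : ℝ} (hm : AEStronglyMeasurable f volume)
    (hC : ∀ᵐ x, ‖f x‖ ≤ C) : LocallyIntegrable f := by
  refine (locallyIntegrable_const (μ := (volume : Measure E3)) C).mono hm ?_
  filter_upwards [hC] with x hx
  exact hx.trans (le_abs_self C)

/-- A function on the strip, extended by the value one. -/
def extendOne (R : ℝ) (f : E3 → ℂ) (x : E3) : ℂ := 1 + (strip R).indicator (fun y => f y - 1) x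

lemma extendOne_of_mem {R : ℝ} {f : E3 → ℂ} {x : E3} (hx : x ∈ strip R) :
    extendOne R f x = f x := by
  rw [extendOne, indicator_of_mem hx]; ring

lemma extendOne_of_notMem {R : ℝ} {f : E3 → ℂ} {x : E3} (hx : x ∉ strip R) :
    extendOne R f x = 1 := by
  rw [extendOne, indicator_of_notMem hx, add_zero]

lemma ae_extendOne {R : ℝ} {f : E3 → ℂ} {p : ℂ → Prop} (h1 : p 1)
    (h : ∀ᵐ x ∂volume.restrict (strip R), p (f x)) : ∀ᵐ x, p (extendOne R f x) := by
  rw [ae_restrict_iff' (measurableSet_strip R)] at h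
  filter_upwards [h] with x hx
  by_cases hm : x ∈ strip R
  · rw [extendOne_of_mem hm]; exact hx hm
  · rw [extendOne_of_notMem hm]; exact h1

lemma shift_mem_strip {R : ℝ} {x : E3} (l : Idx) : x + shift l ∈ strip R ↔ x ∈ strip R := by
  have : (x + shift l) 2 = x 2 := by
    change x 2 + 0 = x 2; rw [add_zero]
  simp only [strip, mem_ofPred_eq, this]

/-- Smooth, periodic and uniformly elliptic approximations of a coefficient in `W^{1,∞}`. -/
lemma exists_smooth_approx {R ε₀ : ℝ} {ε : E3 → ℂ} {g : Fin 3 → E3 → ℂ}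
    (hε : MemLp ε ⊤ (volume.restrict (strip R))) (hper : IsPeriodic R ε)
    (hpos : ∀ᵐ x ∂volume.restrict (strip R), ε₀ ≤ (ε x).re)
    (hg : ∀ i, MemLp (g i) ⊤ (volume.restrict (strip R)))
    (hw : ∀ i, IsWeakPartial R i ε (g i)) :
    ∃ (e : ℕ → E3 → ℂ) (C : ℝ), (∀ n, ContDiff ℝ ∞ (e n)) ∧
      (∀ n x, min ε₀ 1 ≤ (e n x).re) ∧ (∀ n l x, e n (x + shift l) = e n x) ∧
      (∀ᵐ x ∂volume.restrict (strip R), Tendsto (fun n => e n x) atTop (𝓝 (ε x))) ∧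
      (∀ i, ∀ᵐ x ∂volume.restrict (strip R),
        Tendsto (fun n => partialD i (e n) x) atTop (𝓝 (g i x))) ∧
      (∀ s, 0 < s → ∀ᶠ n in atTop, ∀ i, ∀ x : E3, s ≤ x 2 → x 2 ≤ R - s →
        ‖partialD i (e n) x‖ ≤ C) := by
  obtain ⟨M, hM0, hM⟩ := memLp_top_bound hε
  choose G hG0 hG using fun i => memLp_top_bound (hg i)
  -- Extension by one, rather than by zero, keeps the real part above `min ε₀ 1`. A jump at the
  -- faces does no harm, since derivatives are compared only away from them.
  set f := extendOne R ε with hf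
  have hfm : AEStronglyMeasurable f volume := by
    refine aestronglyMeasurable_const.add ?_
    rw [aestronglyMeasurable_indicator_iff (measurableSet_strip R)]
    exact hε.1.sub aestronglyMeasurable_const
  have hfM : ∀ᵐ x, ‖f x‖ ≤ max M 1 :=
    ae_extendOne (p := fun z => ‖z‖ ≤ max M 1) (by simp) (hM.mono fun x hx => hx.trans
      (le_max_left _ _))
  have hfl := locallyIntegrable_of_bound hfm hfM
  have hfpos : ∀ᵐ x, min ε₀ 1 ≤ (f x).re :=
    ae_extendOne (p := fun z => min ε₀ 1 ≤ z.re) (by simp) (hpos.mono fun x hx =>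
      (min_le_left _ _).trans hx)
  have hfper (l : Idx) : ∀ᵐ x, f (x + shift l) = f x := by
    have h := hper l
    rw [ae_restrict_iff' (measurableSet_strip R)] at h
    filter_upwards [h] with x hx
    by_cases hm : x ∈ strip R
    · rw [hf, extendOne_of_mem hm, extendOne_of_mem ((shift_mem_strip l).2 hm), hx hm]
    · rw [hf, extendOne_of_notMem hm, extendOne_of_notMem (mt (shift_mem_strip l).1 hm)]
  have hgm (i : Fin 3) : AEStronglyMeasurable ((strip R).indicator (g i)) volume := by
    rw [aestronglyMeasurable_indicator_iff (measurableSet_strip R)]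
    exact (hg i).1
  have hgM (i : Fin 3) : ∀ᵐ x, ‖(strip R).indicator (g i) x‖ ≤ G i := by
    have h := hG i
    rw [ae_restrict_iff' (measurableSet_strip R)] at h
    filter_upwards [h] with x hx
    by_cases hm : x ∈ strip R
    · rw [indicator_of_mem hm]; exact hx hm
    · rw [indicator_of_notMem hm, norm_zero]; exact hG0 i
  have h0 := tendsto_one_div_add_atTop_nhds_zero_nat (𝕜 := ℝ)
  have hcomm (s : ℝ) (hs : 0 < s) : ∀ᶠ n : ℕ in atTop, ∀ i, ∀ x : E3, s ≤ x 2 → x 2 ≤ R - s →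
      partialD i (mollify n f) x = mollify n ((strip R).indicator (g i)) x := by
    filter_upwards [h0.eventually_lt_const hs] with n hn i x h1 h2
    exact partialD_mollify_of_isWeakPartial hfl (fun y hy => extendOne_of_mem hy) (hw i)
      (by linarith) (by linarith)
  refine ⟨fun n => mollify n f, ∑ i, G i, fun n => contDiff_mollify n hfl,
    fun n x => le_re_mollify n hfm hfM hfpos x, fun n l x => mollify_add n (hfper l) x, ?_, ?_, ?_⟩
  · filter_upwards [ae_restrict_of_ae (ae_tendsto_mollify hfl),
      ae_restrict_mem (measurableSet_strip R)] with x hx hm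
    rwa [hf, extendOne_of_mem hm] at hx
  · intro i
    filter_upwards [ae_restrict_of_ae (ae_tendsto_mollify (locallyIntegrable_of_bound (hgm i)
      (hgM i))), ae_restrict_mem (measurableSet_strip R)] with x hx hm
    rw [indicator_of_mem hm] at hx
    refine hx.congr' ?_
    -- Every point of the open strip is eventually farther from both faces than the mollification
    -- radius.
    filter_upwards [hcomm (min (x 2) (R - x 2)) (lt_min hm.1 (by linarith [hm.2]))] with n hn
    exact (hn i x (min_le_left _ _) (by linarith [min_le_right (x 2) (R - x 2)])).symm
  · intro s hs
    filter_upwards [hcomm s hs] with n hn i x h1 h2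
    rw [hn i x h1 h2]
    exact (norm_mollify_le n (hgM i) x).trans
      (Finset.single_le_sum (fun i _ => hG0 i) (Finset.mem_univ i))

/-! ### The divergence of a single mode -/

lemma hasDerivAt_line {f : E3 → ℂ} {x : E3} (hf : DifferentiableAt ℝ f x) (i : Fin 3) :
    HasDerivAt (fun s : ℝ => f (x + s • EuclideanSpace.single i (1 : ℝ))) (partialD i f x) 0 :=
  hf.hasFDerivAt.hasLineDerivAt (EuclideanSpace.single i (1 : ℝ))

/-- The denominator is conjugated because the normal trace formula conjugates the derivative of the
test function, which brings back `e` itself. -/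
lemma conj_partialD_div {ψ e : E3 → ℂ} {x : E3} (hψ : DifferentiableAt ℝ ψ x)
    (he : DifferentiableAt ℝ e x) (h0 : e x ≠ 0) (i : Fin 3) :
    (starRingEnd ℂ) (partialD i (fun y => ψ y / (starRingEnd ℂ) (e y)) x) =
      (starRingEnd ℂ) (partialD i ψ x) / e x -
        (starRingEnd ℂ) (ψ x) * partialD i e x / e x ^ 2 := by
  have h0' : (starRingEnd ℂ) (e x) ≠ 0 := (map_ne_zero _).2 h0
  have hc : HasDerivAt (fun s : ℝ => (starRingEnd ℂ) (e (x + s • EuclideanSpace.single i (1 : ℝ))))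
      ((starRingEnd ℂ) (partialD i e x)) 0 :=
    (Complex.conjCLE.toContinuousLinearMap.hasFDerivAt.comp_hasDerivAt (0 : ℝ)
      (hasDerivAt_line he i))
  have hce : DifferentiableAt ℝ (fun y => (starRingEnd ℂ) (e y)) x :=
    Complex.conjCLE.toContinuousLinearMap.differentiableAt.comp x he
  have hd : DifferentiableAt ℝ (fun y => ψ y / (starRingEnd ℂ) (e y)) x := by
    simp only [div_eq_mul_inv]
    exact hψ.mul (hce.inv h0')
  have h := (hasDerivAt_line hψ i).div hc (by simpa using h0')
  rw [partialD_eq_of_hasDerivAt hd h]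
  simp only [zero_smul, add_zero, map_div₀, map_sub, map_mul, map_pow, Complex.conj_conj]
  field_simp

lemma isQPSmooth_div {α : E2} {ψ e : E3 → ℂ} (hψ : IsQPSmooth α ψ) (he : ContDiff ℝ ∞ e)
    (hper : ∀ l x, e (x + shift l) = e x) (h0 : ∀ x, e x ≠ 0) :
    IsQPSmooth α (fun y => ψ y / (starRingEnd ℂ) (e y)) := by
  refine ⟨?_, fun l x => ?_⟩
  · simp only [div_eq_mul_inv]
    exact hψ.1.mul (ContDiff.inv (Complex.conjCLE.contDiff.comp he)
      fun x => (map_ne_zero (starRingEnd ℂ)).2 (h0 x))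
  change ψ (x + shift l) / (starRingEnd ℂ) (e (x + shift l)) = _
  rw [hψ.2, hper, smul_eq_mul, smul_eq_mul, mul_div_assoc]

lemma continuous_partialD {f : E3 → ℂ} (hf : ContDiff ℝ ∞ f) (i : Fin 3) :
    Continuous (partialD i f) :=
  (hf.continuous_fderiv (by simp)).clm_apply continuous_const

lemma exists_margin_support {R : ℝ} {η : ℝ → ℝ} (hc : HasCompactSupport η)
    (hs : tsupport η ⊆ Ioo 0 R) :
    ∃ s, 0 < s ∧ ∀ t, (t < s ∨ R - s < t) → t ∉ tsupport η := by
  by_cases hne : (tsupport η).Nonempty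
  · obtain ⟨m, hm, hmin⟩ := hc.isCompact.exists_isMinOn hne continuousOn_id
    obtain ⟨M, hM, hmax⟩ := hc.isCompact.exists_isMaxOn hne continuousOn_id
    refine ⟨min m (R - M), lt_min (hs hm).1 (by linarith [(hs hM).2]), fun t ht h => ?_⟩
    rcases ht with ht | ht
    · exact absurd (hmin h) (not_le.2 (ht.trans_le (min_le_left _ _)))
    · have h1 : t ≤ M := hmax h
      linarith [min_le_right m (R - M)]
  · exact ⟨1, one_pos, fun t _ h => hne ⟨t, h⟩⟩

lemma norm_partialD_modeFn_le (α : E2) (j : Idx) {χ : ℝ → ℝ} (hχ : ContDiff ℝ ∞ χ) {B : ℝ}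
    (h1 : ∀ t, |χ t| ≤ B) (h2 : ∀ t, |deriv χ t| ≤ B) (i : Fin 3) (x : E3) :
    ‖partialD i (modeFn α j χ) x‖ ≤ (1 + ‖wave α j‖) * B := by
  have hB : 0 ≤ B := (abs_nonneg _).trans (h1 0)
  have hm (η : ℝ → ℝ) : ‖modeFn α j η x‖ = |η (x 2)| := by
    rw [modeFn, norm_mul, RCLike.norm_conj, norm_planeWave, mul_one, Complex.norm_real,
      Real.norm_eq_abs]
  have hw (k : Fin 2) : |wave α j k| ≤ ‖wave α j‖ := by
    simpa using PiLp.norm_apply_le (wave α j) k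
  have hp := partialD_modeFn α j hχ x
  have key (k : Fin 2) : ‖-(Complex.I * (wave α j k : ℂ)) * modeFn α j χ x‖ ≤
      (1 + ‖wave α j‖) * B := by
    rw [norm_mul, norm_neg, norm_mul, Complex.norm_I, one_mul, Complex.norm_real, hm,
      Real.norm_eq_abs]
    exact mul_le_mul (by linarith [hw k]) (h1 _) (abs_nonneg _) (by positivity)
  fin_cases i
  · exact hp.1 ▸ key 0
  · exact hp.2.1 ▸ key 1
  · have : ‖partialD 2 (modeFn α j χ) x‖ ≤ (1 + ‖wave α j‖) * B := by
      rw [hp.2.2, hm]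
      have := h2 (x 2)
      nlinarith [norm_nonneg (wave α j)]
    exact this

/-- The weak form of `div u = - ε⁻¹ ∇ε · u`, tested with a single mode. -/
lemma integral_conj_partialD_modeFn {R ε₀ : ℝ} (hε₀ : 0 < ε₀) {α : E2} {ε : E3 → ℂ}
    {g : Fin 3 → E3 → ℂ} {u : E3 → C3} {c : Idx → ℂ}
    (hε : MemLp ε ⊤ (volume.restrict (strip R))) (hper : IsPeriodic R ε)
    (hpos : ∀ᵐ x ∂volume.restrict (strip R), ε₀ ≤ (ε x).re)
    (hg : ∀ i, MemLp (g i) ⊤ (volume.restrict (strip R)))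
    (hw : ∀ i, IsWeakPartial R i ε (g i)) (hu : MemL2 R α u) (hc : IsNormalTrace R α ε u c)
    (j : Idx) {χ : ℝ → ℝ} (hχ : ContDiff ℝ ∞ χ) (hχc : HasCompactSupport χ)
    (hχs : tsupport χ ⊆ Ioo 0 R) :
    ∫ x in cell R, ((∑ i : Fin 3, u x i * (starRingEnd ℂ) (partialD i (modeFn α j χ) x)) -
      (starRingEnd ℂ) (modeFn α j χ x) * ((∑ i : Fin 3, g i x * u x i) / ε x)) = 0 := by
  obtain ⟨e, C, he, hem, heper, het, hed, heC⟩ := exists_smooth_approx hε hper hpos hg hw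
  obtain ⟨M, hM0, hM⟩ := memLp_top_bound hε
  obtain ⟨s, hs, hsm⟩ := exists_margin_support hχc hχs
  set m := min ε₀ 1 with hm
  have hm0 : 0 < m := lt_min hε₀ one_pos
  have henorm (n : ℕ) (x : E3) : m ≤ ‖e n x‖ := (hem n x).trans (Complex.re_le_norm _)
  have he0 (n : ℕ) (x : E3) : e n x ≠ 0 := norm_pos_iff.1 (hm0.trans_le (henorm n x))
  set ψ := modeFn α j χ with hψdef
  have hψ : IsQPSmooth α ψ := isQPSmooth_modeFn α j hχ
  have hψd (x : E3) : DifferentiableAt ℝ ψ x := hψ.1.differentiable (by simp) x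
  obtain ⟨B, hB1, hB2⟩ : ∃ B, (∀ t, |χ t| ≤ B) ∧ ∀ t, |deriv χ t| ≤ B := by
    obtain ⟨B1, h1⟩ := hχc.exists_bound_of_continuous hχ.continuous
    obtain ⟨B2, h2⟩ := hχc.deriv.exists_bound_of_continuous (hχ.continuous_deriv (by simp))
    exact ⟨max B1 B2, fun t => (h1 t).trans (le_max_left _ _),
      fun t => (h2 t).trans (le_max_right _ _)⟩
  have hB0 : 0 ≤ B := (abs_nonneg _).trans (hB1 0)
  set B' := (1 + ‖wave α j‖) * B with hB'
  have hpB : ∀ i x, ‖partialD i ψ x‖ ≤ B' := norm_partialD_modeFn_le α j hχ hB1 hB2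
  have hψB (x : E3) : ‖ψ x‖ ≤ B := by
    rw [hψdef, modeFn, norm_mul, RCLike.norm_conj, norm_planeWave, mul_one, Complex.norm_real]
    exact hB1 _
  have hsub : ∀ {p : E3 → Prop}, (∀ᵐ x ∂volume.restrict (strip R), p x) →
      ∀ᵐ x ∂volume.restrict (cell R), p x := fun h => ae_restrict_of_ae_restrict_of_subset
        (cell_subset_strip R) h
  -- The desired test function `ψ / conj ε` is not smooth. With `e n` in place of `ε` it is
  -- admissible, and since `χ` vanishes near both ends there is no boundary contribution.
  have hzero : ∀ n, ∫ x in cell R, ε x * ∑ i : Fin 3, u x i *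
      (starRingEnd ℂ) (partialD i (fun y => ψ y / (starRingEnd ℂ) (e n y)) x) = 0 := by
    intro n
    rw [hc.2 _ (isQPSmooth_div hψ (he n) (heper n) (he0 n)) ⟨s, hs, fun x hx => by
      have : χ (x 2) = 0 := image_eq_zero_of_notMem_tsupport (hsm _ (Or.inl hx))
      simp [hψdef, modeFn, this]⟩]
    have hR : χ R = 0 := image_eq_zero_of_notMem_tsupport fun h => lt_irrefl _ (hχs h).2
    have hz (l : Idx) : fourierCoef R α (fun y => ψ y / (starRingEnd ℂ) (e n y)) l = 0 := by
      rw [fourierCoef_eq_sliceCoef, sliceCoef]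
      simp [hψdef, modeFn, hR]
    simp [pairing, hz]
  have hlim : Tendsto (fun n => ∫ x in cell R, ε x * ∑ i : Fin 3, u x i *
      (starRingEnd ℂ) (partialD i (fun y => ψ y / (starRingEnd ℂ) (e n y)) x)) atTop
      (𝓝 (∫ x in cell R, ((∑ i : Fin 3, u x i * (starRingEnd ℂ) (partialD i ψ x)) -
      (starRingEnd ℂ) (ψ x) * ((∑ i : Fin 3, g i x * u x i) / ε x)))) := by
    refine tendsto_integral_filter_of_dominated_convergence
      -- The summands `B' / m` and `B * |C| / m ^ 2` bound the two terms of the quotient rule,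
      -- uniformly in `n`.
      (fun x => M * ∑ i : Fin 3, ‖u x i‖ * (B' / m + B * |C| / m ^ 2)) ?_ ?_ ?_ ?_
    · refine Eventually.of_forall fun n => ?_
      have h1 : AEStronglyMeasurable ε (volume.restrict (cell R)) :=
        hε.1.mono_measure (Measure.restrict_mono (cell_subset_strip R) le_rfl)
      refine h1.mul (Finset.aestronglyMeasurable_fun_sum _ fun i _ => ?_)
      refine (hu.comp i).1.mul ?_
      exact (Complex.continuous_conj.comp (continuous_partialD
        (isQPSmooth_div hψ (he n) (heper n) (he0 n)).1 i)).aestronglyMeasurable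
    · filter_upwards [heC s hs] with n hn
      filter_upwards [hsub hM] with x hMx
      rw [norm_mul]
      refine mul_le_mul hMx ((norm_sum_le _ _).trans (Finset.sum_le_sum fun i _ => ?_))
        (norm_nonneg _) hM0
      rw [norm_mul]
      refine mul_le_mul_of_nonneg_left ?_ (norm_nonneg _)
      rw [conj_partialD_div (hψd x) ((he n).differentiable (by simp) x) (he0 n x)]
      have hne : 0 < ‖e n x‖ := hm0.trans_le (henorm n x)
      refine (norm_sub_le _ _).trans (add_le_add ?_ ?_)
      · rw [norm_div, RCLike.norm_conj]
        exact div_le_div₀ (by positivity) (hpB i x) hm0 (henorm n x)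
      · rw [norm_div, norm_mul, RCLike.norm_conj, norm_pow]
        refine div_le_div₀ (by positivity) ?_ (by positivity)
          (pow_le_pow_left₀ hm0.le (henorm n x) 2)
        -- The bound on the derivatives of `e n` holds only at distance `s` from the faces; closer
        -- to them `ψ` is zero.
        by_cases hx : x 2 < s ∨ R - s < x 2
        · have : χ (x 2) = 0 := image_eq_zero_of_notMem_tsupport (hsm _ hx)
          have : ψ x = 0 := by simp [hψdef, modeFn, this]
          rw [this, norm_zero, zero_mul]; positivity
        · rw [not_or, not_lt, not_lt] at hx
          exact mul_le_mul (hψB x) ((hn i x hx.1 hx.2).trans (le_abs_self C)) (norm_nonneg _) hB0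
    · refine (integrable_finsetSum _ fun i _ => ?_).const_mul _
      exact (hu.comp_integrable i).norm.mul_const _
    · filter_upwards [hsub het, hsub (ae_all_iff.2 hed), hsub hpos] with x h1 h2 h3
      have hε0 : ε x ≠ 0 := fun h => by
        rw [h, Complex.zero_re] at h3; linarith
      have h4 : Tendsto (fun n => ε x * ∑ i : Fin 3, u x i *
          ((starRingEnd ℂ) (partialD i ψ x) / e n x -
            (starRingEnd ℂ) (ψ x) * partialD i (e n) x / e n x ^ 2)) atTop
          (𝓝 (ε x * ∑ i : Fin 3, u x i * ((starRingEnd ℂ) (partialD i ψ x) / ε x -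
            (starRingEnd ℂ) (ψ x) * g i x / ε x ^ 2))) := by
        refine tendsto_const_nhds.mul (tendsto_finsetSum _ fun i _ => tendsto_const_nhds.mul ?_)
        exact (tendsto_const_nhds.div h1 hε0).sub
          ((tendsto_const_nhds.mul (h2 i)).div (h1.pow 2) (pow_ne_zero 2 hε0))
      convert! h4 using 1
      · ext n
        refine congrArg _ (Finset.sum_congr rfl fun i _ => ?_)
        rw [conj_partialD_div (hψd x) ((he n).differentiable (by simp) x) (he0 n x)]
      · congr 1
        simp only [Fin.sum_univ_three]
        field_simp
        ring
  simp only [hzero] at hlim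
  exact (tendsto_nhds_unique tendsto_const_nhds hlim).symm

/-- The negative of the divergence of `u` when `div (ε u) = 0` and `g = ∇ε`. -/
def divPart (ε : E3 → ℂ) (g : Fin 3 → E3 → ℂ) (u : E3 → C3) (x : E3) : ℂ :=
  (∑ i : Fin 3, g i x * u x i) / ε x

lemma ae_cell_of_strip {R : ℝ} {p : E3 → Prop} (h : ∀ᵐ x ∂volume.restrict (strip R), p x) :
    ∀ᵐ x ∂volume.restrict (cell R), p x :=
  ae_restrict_of_ae_restrict_of_subset (cell_subset_strip R) h

lemma aestronglyMeasurable_cell_of_strip {R : ℝ} {f : E3 → ℂ}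
    (h : AEStronglyMeasurable f (volume.restrict (strip R))) :
    AEStronglyMeasurable f (volume.restrict (cell R)) :=
  h.mono_measure (Measure.restrict_mono (cell_subset_strip R) le_rfl)

/-- The bounded gradient of `ε` makes the divergence of order zero in `u`, with a constant depending
only on `ε`. A large `ρ` can therefore absorb it. -/
lemma exists_divPart_bound {R ε₀ : ℝ} (hε₀ : 0 < ε₀) (α : E2) {ε : E3 → ℂ} {g : Fin 3 → E3 → ℂ}
    (hε : MemLp ε ⊤ (volume.restrict (strip R)))
    (hpos : ∀ᵐ x ∂volume.restrict (strip R), ε₀ ≤ (ε x).re)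
    (hg : ∀ i, MemLp (g i) ⊤ (volume.restrict (strip R))) :
    ∃ K, 0 ≤ K ∧ ∀ u, MemL2 R α u → MemLp (divPart ε g u) 2 (volume.restrict (cell R)) ∧
      ∫ x in cell R, ‖divPart ε g u x‖ ^ 2 ≤ K * sqL2 R u := by
  choose G hG0 hG using fun i => memLp_top_bound (hg i)
  have hS : 0 ≤ ∑ i, G i := Finset.sum_nonneg fun i _ => hG0 i
  refine ⟨((∑ i, G i) / ε₀) ^ 2, by positivity, fun u hu => ?_⟩
  have hb : ∀ᵐ x ∂volume.restrict (cell R), ‖divPart ε g u x‖ ≤ ((∑ i, G i) / ε₀) * ‖u x‖ := by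
    filter_upwards [ae_cell_of_strip (ae_all_iff.2 hG), ae_cell_of_strip hpos] with x h1 h2
    rw [divPart, norm_div, div_mul_eq_mul_div]
    refine div_le_div₀ (by positivity) ((norm_sum_le _ _).trans ?_) hε₀
      (h2.trans (Complex.re_le_norm _))
    rw [Finset.sum_mul]
    refine Finset.sum_le_sum fun i _ => ?_
    rw [norm_mul]
    exact mul_le_mul (h1 i) (PiLp.norm_apply_le (u x) i) (norm_nonneg _) (hG0 i)
  have hm : AEStronglyMeasurable (divPart ε g u) (volume.restrict (cell R)) := by
    have h1 : AEStronglyMeasurable (fun x => ∑ i : Fin 3, g i x * u x i)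
        (volume.restrict (cell R)) :=
      Finset.aestronglyMeasurable_fun_sum _ fun i _ =>
        (aestronglyMeasurable_cell_of_strip (hg i).1).mul (hu.comp i).1
    have h2 := (aestronglyMeasurable_cell_of_strip hε.1).aemeasurable.inv.aestronglyMeasurable
    change AEStronglyMeasurable (fun x => (∑ i : Fin 3, g i x * u x i) / ε x) _
    simp only [div_eq_mul_inv]
    exact h1.mul h2
  have hq : MemLp (divPart ε g u) 2 (volume.restrict (cell R)) := hu.1.of_le_mul hm hb
  refine ⟨hq, ?_⟩
  rw [sqL2, ← integral_const_mul]
  refine integral_mono_ae (integrable_norm_sq hq) ((integrable_norm_sq hu.1).const_mul _) ?_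
  filter_upwards [hb] with x hx
  rw [← mul_pow]
  exact pow_le_pow_left₀ (norm_nonneg _) hx 2

lemma integral_sum_conj_partialD {R : ℝ} {α : E2} {u : E3 → C3} (hu : MemL2 R α u) (j : Idx)
    {χ : ℝ → ℝ} (hχ : ContDiff ℝ ∞ χ) :
    Integrable (fun x => ∑ i : Fin 3, u x i * (starRingEnd ℂ) (partialD i (modeFn α j χ) x))
      (volume.restrict (cell R)) ∧
    ∫ x in cell R, ∑ i : Fin 3, u x i * (starRingEnd ℂ) (partialD i (modeFn α j χ) x) =
      ((2 * Real.pi : ℝ) : ℂ) * ∫ t in Ioo 0 R, (((deriv χ t : ℝ) : ℂ) * compCoef α u 2 j t +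
        (χ t : ℂ) * (Complex.I * (wave α j 0 * compCoef α u 0 j t +
          wave α j 1 * compCoef α u 1 j t))) := by
  have hχc := hχ.continuous
  have hχ'c : Continuous (deriv χ) := hχ.continuous_deriv (by simp)
  have U (l : Fin 3) := integral_conj_modeFn (α := α) (hu.comp_integrable l) hχc j
  have U' (l : Fin 3) := integral_conj_modeFn (α := α) (hu.comp_integrable l) hχ'c j
  have iU (l : Fin 3) : IntegrableOn (fun t => (χ t : ℂ) * compCoef α u l j t) (Ioo 0 R) :=
    integrableOn_real_mul hχc (integrableOn_fourierCoef (hu.comp_integrable l) j)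
  have iU' (l : Fin 3) : IntegrableOn (fun t => ((deriv χ t : ℝ) : ℂ) * compCoef α u l j t)
      (Ioo 0 R) :=
    integrableOn_real_mul hχ'c (integrableOn_fourierCoef (hu.comp_integrable l) j)
  have e : (fun x => ∑ i : Fin 3, u x i * (starRingEnd ℂ) (partialD i (modeFn α j χ) x)) =
      fun x => (Complex.I * wave α j 0) * ((starRingEnd ℂ) (modeFn α j χ x) * u x 0) +
        (Complex.I * wave α j 1) * ((starRingEnd ℂ) (modeFn α j χ x) * u x 1) +
        1 * ((starRingEnd ℂ) (modeFn α j (deriv χ) x) * u x 2) := by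
    ext x
    rw [Fin.sum_univ_three, (partialD_modeFn α j hχ x).1, (partialD_modeFn α j hχ x).2.1,
      (partialD_modeFn α j hχ x).2.2]
    simp; ring
  have e2 : (fun t => ((deriv χ t : ℝ) : ℂ) * compCoef α u 2 j t +
        (χ t : ℂ) * (Complex.I * (wave α j 0 * compCoef α u 0 j t +
          wave α j 1 * compCoef α u 1 j t))) = fun t =>
        1 * (((deriv χ t : ℝ) : ℂ) * compCoef α u 2 j t) +
        (Complex.I * wave α j 0) * ((χ t : ℂ) * compCoef α u 0 j t) +
        (Complex.I * wave α j 1) * ((χ t : ℂ) * compCoef α u 1 j t) := by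
    ext t; ring
  rw [e, e2]
  refine ⟨(((U 0).1.const_mul _).add ((U 1).1.const_mul _)).add ((U' 2).1.const_mul _), ?_⟩
  rw [integral_comb3 (U 0).1 (U 1).1 (U' 2).1, integral_comb3 (iU' 2) (iU 0) (iU 1), (U 0).2,
    (U 1).2, (U' 2).2]
  simp only [compCoef]; ring

/-- A cutoff function in the vertical variable, vanishing below the height `a` and equal to one
above the height `b`. -/
def topCut (a b t : ℝ) : ℝ := Real.smoothTransition ((t - a) / (b - a))

lemma contDiff_topCut (a b : ℝ) : ContDiff ℝ ∞ (topCut a b) :=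
  Real.smoothTransition.contDiff.comp (by fun_prop)

lemma topCut_of_le {a b t : ℝ} (hab : a < b) (ht : t ≤ a) : topCut a b t = 0 :=
  Real.smoothTransition.zero_of_nonpos (div_nonpos_of_nonpos_of_nonneg (by linarith) (by linarith))

lemma topCut_of_ge {a b t : ℝ} (hab : a < b) (ht : b ≤ t) : topCut a b t = 1 :=
  Real.smoothTransition.one_of_one_le (by rw [le_div_iff₀ (by linarith)]; linarith)

lemma hasCompactSupport_of_bounds {χ : ℝ → ℝ} {a b : ℝ} (h1 : ∀ t < a, χ t = 0)
    (h2 : ∀ t, b < t → χ t = 0) : HasCompactSupport χ ∧ tsupport χ ⊆ Icc a b := by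
  have hs : Function.support χ ⊆ Icc a b := fun t ht =>
    ⟨not_lt.1 fun h => ht (h1 t h), not_lt.1 fun h => ht (h2 t h)⟩
  exact ⟨HasCompactSupport.of_support_subset_isCompact isCompact_Icc hs,
    closure_minimal hs isClosed_Icc⟩

/-- The normal component of a mode is absolutely continuous, with derivative given by the
divergence, and attains the boundary value. -/
lemma exists_normal_primitive {R T ε₀ : ℝ} (hT0 : 0 ≤ T) (hTR : T < R) (hε₀ : 0 < ε₀) {α : E2}
    {ε : E3 → ℂ} {g : Fin 3 → E3 → ℂ} {u : E3 → C3} {c : Idx → ℂ}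
    (hε : MemLp ε ⊤ (volume.restrict (strip R))) (hper : IsPeriodic R ε)
    (hpos : ∀ᵐ x ∂volume.restrict (strip R), ε₀ ≤ (ε x).re)
    (hone : ∀ᵐ x ∂volume.restrict (strip R), T < x 2 → ε x = 1)
    (hg : ∀ i, MemLp (g i) ⊤ (volume.restrict (strip R)))
    (hw : ∀ i, IsWeakPartial R i ε (g i)) (hu : MemL2 R α u) (hc : IsNormalTrace R α ε u c)
    (j : Idx) :
    ∃ F f : ℝ → ℂ, IsPrimitive F f ∧
      (∀ᵐ t ∂volume.restrict (Ioo 0 R), compCoef α u 2 j t = F t) ∧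
      (∀ᵐ t ∂volume.restrict (Ioo 0 R), f t = Complex.I * (wave α j 0 * compCoef α u 0 j t +
        wave α j 1 * compCoef α u 1 j t) - fourierCoef t α (divPart ε g u) j) ∧ F R = c j := by
  have hR : 0 < R := hT0.trans_lt hTR
  have hp : ((2 * Real.pi : ℝ) : ℂ) ≠ 0 := by
    have : (2 * Real.pi) ≠ 0 := by positivity
    exact_mod_cast this
  obtain ⟨K, _, hK⟩ := exists_divPart_bound hε₀ α hε hpos hg
  have hq := (hK u hu).1.integrable one_le_two
  set v := fun t => Complex.I * (wave α j 0 * compCoef α u 0 j t +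
    wave α j 1 * compCoef α u 1 j t) with hv
  set q := fun t => fourierCoef t α (divPart ε g u) j with hqdef
  have iu (l : Fin 3) : IntegrableOn (compCoef α u l j) (Ioo 0 R) :=
    integrableOn_fourierCoef (hu.comp_integrable l) j
  have iv : IntegrableOn v (Ioo 0 R) :=
    (((iu 0).const_mul _).add ((iu 1).const_mul _)).const_mul _
  have iq : IntegrableOn q (Ioo 0 R) := integrableOn_fourierCoef hq j
  have iw : IntegrableOn (fun t => v t - q t) (Ioo 0 R) := iv.sub iq
  have hint {χ : ℝ → ℝ} (hχ : ContDiff ℝ ∞ χ) {w : ℝ → ℂ} (iw : IntegrableOn w (Ioo 0 R)) :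
      IntegrableOn (fun t => ((deriv χ t : ℝ) : ℂ) * compCoef α u 2 j t + (χ t : ℂ) * w t)
        (Ioo 0 R) :=
    (integrableOn_real_mul (hχ.continuous_deriv (by simp)) (iu 2)).add
      (integrableOn_real_mul hχ.continuous iw)
  -- In the interior the weak form carries the lower-order term `q` but sees no boundary value.
  have hinner : ∀ χ : ℝ → ℝ, ContDiff ℝ ∞ χ → HasCompactSupport χ → tsupport χ ⊆ Ioo 0 R →
      ∫ t in Ioo 0 R, (((deriv χ t : ℝ) : ℂ) * compCoef α u 2 j t + (χ t : ℂ) * (v t - q t))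
        = 0 := by
    intro χ hχ hχc hχs
    have h := integral_conj_partialD_modeFn hε₀ hε hper hpos hg hw hu hc j hχ hχc hχs
    have hs := integral_sum_conj_partialD hu j hχ
    have hm := integral_conj_modeFn (α := α) hq hχ.continuous j
    change ∫ x in cell R, ((∑ i : Fin 3, u x i * (starRingEnd ℂ) (partialD i (modeFn α j χ) x)) -
      (starRingEnd ℂ) (modeFn α j χ x) * divPart ε g u x) = 0 at h
    rw [integral_sub hs.1 hm.1, hs.2, hm.2, ← mul_sub] at h
    have h2 := (mul_eq_zero.1 h).resolve_left hp
    rw [← integral_sub (hint hχ iv) (integrableOn_real_mul hχ.continuous iq)] at h2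
    rw [← h2]
    refine integral_congr_ae (Eventually.of_forall fun t => ?_)
    simp only [hv, hqdef]; ring
  -- Above the height `T` the coefficient is one, so the normal trace formula can be tested directly
  -- up to the top face, without `q`.
  have houter : ∀ χ : ℝ → ℝ, ContDiff ℝ ∞ χ → (∃ s, T < s ∧ ∀ t < s, χ t = 0) →
      ∫ t in Ioo 0 R, (((deriv χ t : ℝ) : ℂ) * compCoef α u 2 j t + (χ t : ℂ) * v t)
        = (χ R : ℂ) * c j := by
    rintro χ hχ ⟨s, hs, hχs⟩
    have h := hc.2 _ (isQPSmooth_modeFn α j hχ) ⟨s, hT0.trans_lt hs, fun x hx => by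
      simp [modeFn, hχs _ hx]⟩
    rw [pairing_modeFn] at h
    have e : ∫ x in cell R, ε x * ∑ i : Fin 3, u x i *
        (starRingEnd ℂ) (partialD i (modeFn α j χ) x) =
        ∫ x in cell R, ∑ i : Fin 3, u x i * (starRingEnd ℂ) (partialD i (modeFn α j χ) x) := by
      refine integral_congr_ae ?_
      filter_upwards [ae_cell_of_strip hone] with x hx
      by_cases ht : T < x 2
      · rw [hx ht, one_mul]
      · have h0 : x 2 < s := (not_lt.1 ht).trans_lt hs
        have z1 : χ (x 2) = 0 := hχs _ h0
        have z2 : deriv χ (x 2) = 0 := by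
          have : χ =ᶠ[𝓝 (x 2)] fun _ => 0 := by
            filter_upwards [Iio_mem_nhds h0] with t ht using hχs t ht
          rw [this.deriv_eq, deriv_const]
        have hz : ∑ i : Fin 3, u x i * (starRingEnd ℂ) (partialD i (modeFn α j χ) x) = 0 := by
          rw [Fin.sum_univ_three, (partialD_modeFn α j hχ x).1, (partialD_modeFn α j hχ x).2.1,
            (partialD_modeFn α j hχ x).2.2]
          simp [modeFn, z1, z2]
        rw [hz, mul_zero]
    rw [e, (integral_sum_conj_partialD hu j hχ).2] at h
    exact mul_left_cancel₀ hp h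
  -- On `(T, R)` both weak forms are available; their difference shows that `q` vanishes there,
  -- which makes them compatible.
  have hq0 : ∀ᵐ t, t ∈ Ioo T R → q t = 0 := by
    refine isOpen_Ioo.ae_eq_zero_of_integral_contDiff_smul_eq_zero
      (iq.mono_set (Ioo_subset_Ioo_left hT0)).locallyIntegrableOn fun η hη hηc hηs => ?_
    have hηs' : tsupport η ⊆ Ioo 0 R := hηs.trans (Ioo_subset_Ioo_left hT0)
    have h1 := hinner η hη hηc hηs'
    have hTs : ∃ s, T < s ∧ ∀ t < s, η t = 0 := by
      by_cases hne : (tsupport η).Nonempty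
      · obtain ⟨m, hm, hmin⟩ := hηc.isCompact.exists_isMinOn hne continuousOn_id
        refine ⟨m, (hηs hm).1, fun t ht => ?_⟩
        by_contra h
        exact absurd (hmin (subset_tsupport _ h)) (not_le.2 ht)
      · exact ⟨T + 1, by linarith, fun t _ => image_eq_zero_of_notMem_tsupport fun h => hne ⟨t, h⟩⟩
    have h2 := houter η hη hTs
    have hηR : η R = 0 := image_eq_zero_of_notMem_tsupport fun h => lt_irrefl _ (hηs h).2
    rw [hηR, Complex.ofReal_zero, zero_mul] at h2
    have h3 : ∫ t in Ioo 0 R, (η t : ℂ) * q t = 0 := by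
      have h4 := integral_sub (hint hη iv) (hint hη iw)
      have h5 : ∀ t, (((deriv η t : ℝ) : ℂ) * compCoef α u 2 j t + (η t : ℂ) * v t) -
          (((deriv η t : ℝ) : ℂ) * compCoef α u 2 j t + (η t : ℂ) * (v t - q t)) =
          (η t : ℂ) * q t := fun t => by ring
      simp only [h5] at h4
      rw [h4, h2, zero_sub, neg_eq_zero]
      exact h1
    rw [← h3]
    symm
    have h6 : ∀ t, (η t : ℂ) * q t = η t • q t := fun t => (Complex.real_smul).symm
    simp only [h6]
    refine setIntegral_eq_integral_of_forall_compl_eq_zero fun t ht => ?_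
    rw [image_eq_zero_of_notMem_tsupport fun h => ht (hηs' h), zero_smul]
  -- A cutoff with transition inside `(T, R)` splits a general test function into an interior part
  -- and a part supported above `T`.
  obtain ⟨a, haT, haR⟩ := exists_between hTR
  obtain ⟨b, hab, hbR⟩ := exists_between haR
  refine exists_primitive_of_weak hR (iu 2) iw fun χ hχ hχ0 => ?_
  obtain ⟨s, hs, hs0⟩ := hχ0
  set κ := topCut a b with hκ
  have hκs := contDiff_topCut a b
  have h1s : ContDiff ℝ ∞ fun t => (1 - κ t) * χ t := (contDiff_const.sub hκs).mul hχ
  have h2s : ContDiff ℝ ∞ fun t => κ t * χ t := hκs.mul hχ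
  have hsupp := hasCompactSupport_of_bounds (χ := fun t => (1 - κ t) * χ t) (a := s) (b := b)
    (fun t ht => by simp [hs0 t ht]) (fun t ht => by simp [hκ, topCut_of_ge hab ht.le])
  have h1 := hinner _ h1s hsupp.1 (hsupp.2.trans fun t ht => ⟨hs.trans_le ht.1, ht.2.trans_lt hbR⟩)
  have h2 := houter _ h2s ⟨a, haT, fun t ht => by simp [hκ, topCut_of_le hab ht.le]⟩
  have hκR : κ R = 1 := topCut_of_ge hab hbR.le
  rw [hκR, one_mul] at h2
  have hadd : ∫ t in Ioo 0 R, (((deriv χ t : ℝ) : ℂ) * compCoef α u 2 j t +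
      (χ t : ℂ) * (v t - q t)) = (∫ t in Ioo 0 R, (((deriv (fun t => (1 - κ t) * χ t) t : ℝ) : ℂ) *
        compCoef α u 2 j t + (((1 - κ t) * χ t : ℝ) : ℂ) * (v t - q t))) +
      ∫ t in Ioo 0 R, (((deriv (fun t => κ t * χ t) t : ℝ) : ℂ) * compCoef α u 2 j t +
        ((κ t * χ t : ℝ) : ℂ) * v t) := by
    rw [← integral_add (hint h1s iw) (hint h2s iv)]
    refine integral_congr_ae ?_
    have hq0' : ∀ᵐ t ∂volume.restrict (Ioo 0 R), t ∈ Ioo T R → q t = 0 := ae_restrict_of_ae hq0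
    filter_upwards [hq0', ae_restrict_mem measurableSet_Ioo] with t ht htm
    have hd1 := (h1s.differentiable (by simp) t).hasDerivAt
    have hd2 := (h2s.differentiable (by simp) t).hasDerivAt
    have hd : deriv χ t = deriv (fun t => (1 - κ t) * χ t) t + deriv (fun t => κ t * χ t) t := by
      have h3 := (hd1.add hd2).deriv
      rw [← h3]
      congr 1
      ext x; simp only [Pi.add_apply]; ring
    -- The outer weak form omits `q`, which is harmless because the cutoff is nonzero only where `q`
    -- vanishes.
    have hκq : (κ t : ℂ) * q t = 0 := by
      by_cases hta : t ≤ a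
      · rw [hκ, topCut_of_le hab hta]; simp
      · rw [ht ⟨haT.trans (not_le.1 hta), htm.2⟩, mul_zero]
    rw [hd]
    push_cast
    linear_combination (-(χ t : ℂ)) * hκq
  have h3 := hadd
  rw [h1, h2, zero_add] at h3
  exact h3

/-! ### Fourier symbols of the boundary operators -/

lemma norm_wave_sq (α : E2) (j : Idx) : ‖wave α j‖ ^ 2 = wave α j 0 ^ 2 + wave α j 1 ^ 2 := by
  rw [EuclideanSpace.real_norm_sq_eq, Fin.sum_univ_two]

lemma waveDot_waveC (α : E2) (j : Idx) : waveDot α j (waveC α j) = ((‖wave α j‖ ^ 2 : ℝ) : ℂ) := by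
  rw [norm_wave_sq]
  simp only [waveDot, waveC]
  push_cast
  ring

lemma beta_sq (k : ℝ) (hk : 0 < k) (α : E2) (j : Idx) :
    beta k α j ^ 2 = (k : ℂ) ^ 2 - ((‖wave α j‖ ^ 2 : ℝ) : ℂ) := by
  rw [beta]
  split_ifs with h
  · rw [← Complex.ofReal_pow, Real.sq_sqrt (sub_nonneg.2 (pow_le_pow_left₀ (norm_nonneg _) h 2))]
    push_cast; ring
  · rw [mul_pow, ← Complex.ofReal_pow, Real.sq_sqrt
      (sub_nonneg.2 (pow_le_pow_left₀ hk.le (not_le.1 h).le 2)), Complex.I_sq]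
    push_cast; ring

lemma beta_ne_zero {k : ℝ} (hk : 0 < k) {α : E2} {j : Idx} (h : ‖wave α j‖ ≠ k) :
    beta k α j ≠ 0 := by
  intro h0
  have h1 := beta_sq k hk α j
  rw [h0] at h1
  have h2 : k ^ 2 - ‖wave α j‖ ^ 2 = 0 := by
    have : ((k ^ 2 - ‖wave α j‖ ^ 2 : ℝ) : ℂ) = 0 := by push_cast at h1 ⊢; rw [← h1]; ring
    exact_mod_cast this
  exact h ((pow_left_inj₀ (norm_nonneg _) hk.le two_ne_zero).1 (by linarith))

/-- The symbol acting on `α_j · φ` is `-i (|α_j|² / β_j + β_j)`, and `|α_j|² + β_j² = k²`. -/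
lemma waveDot_opNT {k : ℝ} (hk : 0 < k) {α : E2} {j : Idx} (h : ‖wave α j‖ ≠ k) (φ : Idx → C2) :
    waveDot α j (opNT k α φ j) = -Complex.I * k ^ 2 / beta k α j * waveDot α j (φ j) := by
  have hb := beta_ne_zero hk h
  have hs := beta_sq k hk α j
  have h1 : waveDot α j (opNT k α φ j) = (-Complex.I / beta k α j * waveDot α j (φ j)) *
      waveDot α j (waveC α j) - Complex.I * beta k α j * waveDot α j (φ j) := by
    simp [opNT, opN, opT, waveDot]; ring
  rw [h1, waveDot_waveC]
  have h2 : ((‖wave α j‖ ^ 2 : ℝ) : ℂ) = (k : ℂ) ^ 2 - beta k α j ^ 2 := by rw [hs]; ring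
  rw [h2]
  field_simp
  ring

/-- The divergence of `N_α - T_α` contributes the same factor `k²` as the left-hand side; dividing
it out turns the boundary condition into a relation of order zero for each mode. -/
lemma normalTrace_eq {k : ℝ} (hk : 0 < k) {α : E2} {j : Idx} (h : ‖wave α j‖ ≠ k)
    {φ : Idx → C2} {c : ℂ} (hc : (k : ℂ) ^ 2 * c = -surfDiv α (opNT k α φ) j) :
    c = waveDot α j (φ j) / beta k α j := by
  have hk' : (k : ℂ) ^ 2 ≠ 0 := pow_ne_zero 2 (by exact_mod_cast hk.ne')
  rw [surfDiv, waveDot_opNT hk h] at hc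
  refine mul_left_cancel₀ hk' (hc.trans ?_)
  linear_combination (-(k : ℂ) ^ 2 * waveDot α j (φ j) / beta k α j) * Complex.I_sq

/-- The expression is `|w|² i / conj β_j`. It is purely imaginary for real `β_j`, and equals `-|w|²
/ b` for `β_j = i b` with `b > 0`. -/
lemma re_boundary_nonpos (k : ℝ) (α : E2) (j : Idx) (w : ℂ) :
    (Complex.I * w * (starRingEnd ℂ) (w / beta k α j)).re ≤ 0 := by
  have h1 : Complex.I * w * (starRingEnd ℂ) (w / beta k α j) =
      ((‖w‖ ^ 2 : ℝ) : ℂ) * (Complex.I / (starRingEnd ℂ) (beta k α j)) := by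
    have := Complex.mul_conj' w
    rw [map_div₀]
    push_cast
    rw [← this]; ring
  rw [h1, Complex.re_ofReal_mul]
  refine mul_nonpos_of_nonneg_of_nonpos (by positivity) ?_
  rw [beta]
  split_ifs
  · simp
  · rw [map_mul, Complex.conj_I, Complex.conj_ofReal, div_mul_eq_div_div, div_neg,
      div_self Complex.I_ne_zero]
    have : (-1 / (Real.sqrt (‖wave α j‖ ^ 2 - k ^ 2) : ℂ)) =
      ((-1 / Real.sqrt (‖wave α j‖ ^ 2 - k ^ 2) : ℝ) : ℂ) := by push_cast; ring
    rw [this, Complex.ofReal_re]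
    exact div_nonpos_of_nonpos_of_nonneg (by norm_num) (Real.sqrt_nonneg _)

/-! ### Mode systems and the summed energy inequality -/

/-- Absolutely continuous representatives `F j l` of the Fourier modes of a field, with square
integrable derivatives `f j l`, whose tangential components vanish at height `0`. -/
structure ModeSystem (R : ℝ) (α : E2) (u : E3 → C3) (F f : Idx → Fin 3 → ℝ → ℂ) : Prop where
  prim : ∀ j l, IsPrimitive (F j l) (f j l)
  coef : ∀ j l, ∀ᵐ t ∂volume.restrict (Ioo 0 R), compCoef α u l j t = F j l t
  memLp : ∀ j l, MemLp (f j l) 2 (volume.restrict (Ioo 0 R))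
  zero₀ : ∀ j, F j 0 0 = 0
  zero₁ : ∀ j, F j 1 0 = 0
  top₀ : ∀ j, F j 0 R = topTrace R α u j 0
  top₁ : ∀ j, F j 1 R = topTrace R α u j 1

/-- The contribution of the mode `j` to the squared `L²` norm of the gradient. -/
def modeGrad (R : ℝ) (α : E2) (F f : Idx → Fin 3 → ℝ → ℂ) (j : Idx) : ℝ :=
  ∑ l, ((∫ t in Ioo 0 R, ‖f j l t‖ ^ 2) + ‖wave α j‖ ^ 2 * ∫ t in Ioo 0 R, ‖F j l t‖ ^ 2)

lemma modeGrad_nonneg (R : ℝ) (α : E2) (F f : Idx → Fin 3 → ℝ → ℂ) (j : Idx) :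
    0 ≤ modeGrad R α F f j :=
  Finset.sum_nonneg fun l _ => add_nonneg (integral_nonneg fun t => by positivity)
    (mul_nonneg (by positivity) (integral_nonneg fun t => by positivity))

lemma sqL2_nonneg (R : ℝ) (u : E3 → C3) : 0 ≤ sqL2 R u := integral_nonneg fun x => by positivity

lemma sqL2_eq_sum {R : ℝ} {α : E2} {u : E3 → C3} (hu : MemL2 R α u) :
    sqL2 R u = ∑ l, ∫ x in cell R, ‖u x l‖ ^ 2 := by
  rw [sqL2, ← integral_finsetSum _ fun l _ => integrable_norm_sq (hu.comp l)]
  simp only [EuclideanSpace.norm_sq_eq]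

lemma hasSum_sqL2 {R : ℝ} {α : E2} {u : E3 → C3} (hu : MemL2 R α u) :
    HasSum (fun j => ∑ l, ∫ t in Ioo 0 R, ‖compCoef α u l j t‖ ^ 2) (sqL2 R u) := by
  rw [sqL2_eq_sum hu]
  exact hasSum_sum fun l _ => hasSum_integral_fourierCoef (hu.comp l)

lemma ModeSystem.integral_sq {R : ℝ} {α : E2} {u : E3 → C3} {F f : Idx → Fin 3 → ℝ → ℂ}
    (h : ModeSystem R α u F f) (j : Idx) (l : Fin 3) :
    ∫ t in Ioo 0 R, ‖compCoef α u l j t‖ ^ 2 = ∫ t in Ioo 0 R, ‖F j l t‖ ^ 2 :=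
  integral_congr_ae ((h.coef j l).mono fun t ht => by simp only [ht])

lemma ModeSystem.hasSum {R : ℝ} {α : E2} {u : E3 → C3} {F f : Idx → Fin 3 → ℝ → ℂ}
    (h : ModeSystem R α u F f) (hu : MemL2 R α u) :
    HasSum (fun j => ∑ l, ∫ t in Ioo 0 R, ‖F j l t‖ ^ 2) (sqL2 R u) := by
  have := hasSum_sqL2 hu
  simp only [h.integral_sq] at this
  exact this

/-- Every field in `Y_α` has a mode system, with a gradient bounded by the curl and the field. -/
lemma exists_modeSystem {k R T ε₀ : ℝ} (hk : 0 < k) (hT0 : 0 ≤ T) (hTR : T < R) (hε₀ : 0 < ε₀)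
    {α : E2} (hαk : ∀ j : Idx, ‖wave α j‖ ≠ k) {ε : E3 → ℂ} (hε : MemW1Inf R ε)
    (hper : IsPeriodic R ε)
    (hpos : ∀ᵐ x ∂volume.restrict (strip R), ε₀ ≤ (ε x).re)
    (hone : ∀ᵐ x ∂volume.restrict (strip R), T < x 2 → ε x = 1) :
    ∃ K, 0 ≤ K ∧ ∀ u, MemY k R α ε u → ∃ F f, ModeSystem R α u F f ∧
      Summable (modeGrad R α F f) ∧
      ∑' j, modeGrad R α F f j ≤ sqL2 R (weakCurl R α u) + K * sqL2 R u := by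
  have hR : 0 < R := hT0.trans_lt hTR
  choose g hg hw using hε.2
  obtain ⟨K, hK0, hK⟩ := exists_divPart_bound hε₀ α hε.1 hpos hg
  refine ⟨K, hK0, fun u hu => ?_⟩
  obtain ⟨c, hc, hbd⟩ := hu.boundary
  have huL := hu.memX.hcurl.1
  have hcL := (isWeakCurl_weakCurl hu.memX.hcurl).1
  obtain ⟨hq, hqb⟩ := hK u huL
  choose F₀ f₀ F₁ f₁ p₀ p₁ r₀ r₁ e₀ e₁ e₂ z₀ z₁ t₀ t₁ using
    fun j => exists_tangential_primitives hR hu.memX j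
  choose F₂ f₂ p₂ r₂ e₃ t₂ using fun j => exists_normal_primitive hT0 hTR hε₀ hε.1 hper hpos hone
    hg hw huL hc j
  have mu (l j) := huL.memLp_compCoef l j
  have mc (l j) := hcL.memLp_compCoef l j
  have mq (j) := memLp_fourierCoef (α := α) hq j
  have m₀ (j) : MemLp (f₀ j) 2 (volume.restrict (Ioo 0 R)) :=
    ((mc 1 j).sub ((mu 2 j).const_mul (Complex.I * wave α j 0))).ae_eq
      ((e₀ j).mono fun t h => h.symm)
  have m₁ (j) : MemLp (f₁ j) 2 (volume.restrict (Ioo 0 R)) :=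
    ((mc 0 j).add ((mu 2 j).const_mul (Complex.I * wave α j 1))).neg.ae_eq
      ((e₁ j).mono fun t h => h.symm)
  have m₂ (j) : MemLp (f₂ j) 2 (volume.restrict (Ioo 0 R)) :=
    (((((mu 0 j).const_mul (wave α j 0 : ℂ)).add ((mu 1 j).const_mul (wave α j 1 : ℂ))).const_mul
      Complex.I).sub (mq j)).ae_eq ((e₃ j).mono fun t h => h.symm)
  have hsys : ModeSystem R α u (fun j => ![F₀ j, F₁ j, F₂ j]) (fun j => ![f₀ j, f₁ j, f₂ j]) := by
    refine ⟨fun j l => ?_, fun j l => ?_, fun j l => ?_, z₀, z₁, t₀, t₁⟩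
    · fin_cases l
      exacts [p₀ j, p₁ j, p₂ j]
    · fin_cases l
      exacts [r₀ j, r₁ j, r₂ j]
    · fin_cases l
      exacts [m₀ j, m₁ j, m₂ j]
  refine ⟨_, _, hsys, ?_⟩
  have hen (j) : modeGrad R α (fun j => ![F₀ j, F₁ j, F₂ j]) (fun j => ![f₀ j, f₁ j, f₂ j]) j ≤
      (∑ l, ∫ t in Ioo 0 R, ‖compCoef α (weakCurl R α u) l j t‖ ^ 2) +
        ∫ t in Ioo 0 R, ‖fourierCoef t α (divPart ε g u) j‖ ^ 2 := by
    -- The sign hypothesis of the energy estimate is supplied by the boundary condition of `Y_α`,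
    -- rewritten mode by mode.
    have h := mode_energy (a := wave α j 0) (b := wave α j 1) hR (p₀ j) (p₁ j) (p₂ j) (m₀ j) (m₁ j)
      (m₂ j) (mc 0 j) (mc 1 j) (mc 2 j) (mq j)
      (by filter_upwards [e₀ j, r₂ j] with t h1 h2; rw [h1, h2])
      (by filter_upwards [e₁ j, r₂ j] with t h1 h2; rw [h1, h2])
      (by filter_upwards [e₃ j, r₀ j, r₁ j] with t h1 h2 h3; rw [h1, h2, h3])
      (by filter_upwards [e₂ j, r₀ j, r₁ j] with t h1 h2 h3; rw [h1, h2, h3])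
      (z₀ j) (z₁ j) (by
        rw [t₂ j, normalTrace_eq hk (hαk j) (hbd j), t₀ j, t₁ j]
        exact re_boundary_nonpos k α j _)
    rw [modeGrad, Fin.sum_univ_three, Fin.sum_univ_three, norm_wave_sq]
    refine le_trans (le_of_eq ?_) h
    simp only [Matrix.cons_val_zero, Matrix.cons_val_one, Matrix.cons_val_two, Matrix.head_cons,
      Matrix.tail_cons]
    ring
  have hS := (hasSum_sqL2 hcL).add (hasSum_integral_fourierCoef (α := α) hq)
  have hsum := hS.summable.of_nonneg_of_le (modeGrad_nonneg R α _ _) hen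
  refine ⟨hsum, (hsum.tsum_le_tsum hen hS.summable).trans ?_⟩
  rw [hS.tsum_eq]
  exact add_le_add_right hqb _

/-! ### Tilings of the strip and quasi-periodic functions -/

/-- The translate of the half-open periodicity cell with index `j`. -/
def tile (R : ℝ) (j : Idx) : Set E3 :=
  {x | (∀ i : Fin 2, hor x i - 2 * Real.pi * j i ∈ Ioc (-Real.pi) Real.pi) ∧ x 2 ∈ Ioo 0 R}

lemma add_shift_apply (x : E3) (j : Idx) :
    (x + shift j) 0 = x 0 + 2 * Real.pi * j 0 ∧ (x + shift j) 1 = x 1 + 2 * Real.pi * j 1 ∧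
      (x + shift j) 2 = x 2 :=
  ⟨rfl, rfl, add_zero _⟩

lemma measurePreserving_tile (R : ℝ) (j : Idx) : MeasurePreserving (fun x : E3 => x + shift j)
    (volume.restrict (cell R)) (volume.restrict (tile R j)) := by
  have h1 := (measurePreserving_add_right (volume : Measure E3) (shift j)).restrict_preimage_emb
    (measurableEmbedding_addRight _) (tile R j)
  have h2 := measurePreserving_emb.restrict_preimage_emb measurableEmbedding_emb
    ((fun x : E3 => x + shift j) ⁻¹' tile R j)
  have h3 : emb ⁻¹' ((fun x : E3 => x + shift j) ⁻¹' tile R j) = halfSquare ×ˢ Ioo 0 R := by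
    ext p
    obtain ⟨e0, e1, e2⟩ := add_shift_apply (emb p) j
    have : ∀ i : Fin 2, hor (emb p + shift j) i - 2 * Real.pi * j i = p.1 i := by
      intro i
      fin_cases i
      · change (emb p + shift j) 0 - _ = _
        rw [e0]; simp
      · change (emb p + shift j) 1 - _ = _
        rw [e1]; simp
    simp only [mem_preimage, tile, mem_ofPred_eq, this, e2, emb_two, mem_prod, halfSquare]
  rw [h3, ← Measure.prod_restrict, ← Measure.restrict_congr_set square_ae_eq_halfSquare] at h2
  rw [← h2.map_eq, (measurePreserving_emb_cell R).map_eq] at h1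
  exact h1

lemma exists_mem_tile {R : ℝ} {x : E3} (hx : x ∈ strip R) : ∃ j, x ∈ tile R j := by
  have hp := Real.pi_pos
  -- For the cell `(-π, π]`, closed on the right, the index of a point is a ceiling rather than a
  -- floor.
  refine ⟨fun i => ⌈(hor x i - Real.pi) / (2 * Real.pi)⌉, fun i => ?_, hx⟩
  have h1 := Int.le_ceil ((hor x i - Real.pi) / (2 * Real.pi))
  have h2 := Int.ceil_lt_add_one ((hor x i - Real.pi) / (2 * Real.pi))
  rw [div_le_iff₀ (by positivity)] at h1
  rw [← sub_lt_iff_lt_add, lt_div_iff₀ (by positivity)] at h2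
  constructor <;> linarith

lemma strip_subset_iUnion_tile (R : ℝ) : strip R ⊆ ⋃ j, tile R j := fun _ hx =>
  mem_iUnion.2 (exists_mem_tile hx)

lemma norm_hor_apply_le (x : E3) (i : Fin 2) : |hor x i| ≤ ‖x‖ := by
  fin_cases i
  · exact PiLp.norm_apply_le x 0
  · exact PiLp.norm_apply_le x 1

/-- From `2π |j i| ≤ |x i| + π` the index is at most `ρ + 1` in absolute value; so only finitely
many tiles meet a ball. -/
lemma index_mem_of_mem_tile {R ρ : ℝ} {x : E3} {j : Idx} (hx : x ∈ tile R j) (hr : ‖x‖ ≤ ρ) :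
    j ∈ Fintype.piFinset fun _ : Fin 2 => Finset.Icc (-⌈ρ + 1⌉) ⌈ρ + 1⌉ := by
  have hp := Real.pi_gt_three
  rw [Fintype.mem_piFinset]
  intro i
  have h1 := hx.1 i
  have h2 := abs_le.1 ((norm_hor_apply_le x i).trans hr)
  have h3 := Int.le_ceil (ρ + 1)
  have hρ : 0 ≤ ρ := (norm_nonneg x).trans hr
  have h4 : (j i : ℝ) ≤ ρ + 1 := by
    by_contra h
    have := mul_lt_mul_of_pos_left (not_le.1 h) (show 0 < 2 * Real.pi by positivity)
    nlinarith [h1.1, h2.2]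
  have h5 : -(ρ + 1) ≤ (j i : ℝ) := by
    by_contra h
    have := mul_lt_mul_of_pos_left (not_le.1 h) (show 0 < 2 * Real.pi by positivity)
    nlinarith [h1.2, h2.1]
  rw [Finset.mem_Icc]
  constructor
  · have : ((-⌈ρ + 1⌉ : ℤ) : ℝ) ≤ j i := by push_cast; linarith
    exact_mod_cast this
  · have : (j i : ℝ) ≤ (⌈ρ + 1⌉ : ℤ) := by linarith
    exact_mod_cast this

/-- Countably many tiles cover the strip, and each is a measure-preserving translate of the cell up
to a null set. -/
lemma ae_strip_of_cell {R : ℝ} {p : E3 → Prop}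
    (h : ∀ j, ∀ᵐ x ∂volume.restrict (cell R), p (x + shift j)) :
    ∀ᵐ x ∂volume.restrict (strip R), p x := by
  refine ae_restrict_of_ae_restrict_of_subset (strip_subset_iUnion_tile R) ?_
  rw [ae_restrict_iUnion_iff]
  intro j
  rw [← (measurePreserving_tile R j).map_eq, (measurableEmbedding_addRight (shift j)).ae_map_iff]
  exact h j

section QP

variable {V : Type*} [NormedAddCommGroup V] [NormedSpace ℂ V]

/-- Quasi-periodicity, almost everywhere in the strip. -/
def QuasiPeriodic (R : ℝ) (α : E2) (w : E3 → V) : Prop :=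
  ∀ j : Idx, ∀ᵐ x ∂volume.restrict (strip R), w (x + shift j) = phase α j • w x

lemma norm_phase (α : E2) (j : Idx) : ‖phase α j‖ = 1 := by
  have : phase α j = Complex.exp (((-(2 * Real.pi * (α 0 * j 0 + α 1 * j 1)) : ℝ) : ℂ) *
      Complex.I) := by
    rw [phase]; push_cast; rfl
  rw [this, Complex.norm_exp_ofReal_mul_I]

lemma QuasiPeriodic.sub {R : ℝ} {α : E2} {v w : E3 → V} (hv : QuasiPeriodic R α v)
    (hw : QuasiPeriodic R α w) : QuasiPeriodic R α fun x => v x - w x := fun j => by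
  filter_upwards [hv j, hw j] with x h1 h2
  rw [h1, h2, smul_sub]

/-- Pulled back from a tile to the cell, the function is a constant multiple of itself, and there
are countably many tiles. -/
lemma QuasiPeriodic.aestronglyMeasurable {R : ℝ} {α : E2} {w : E3 → V}
    (hw : QuasiPeriodic R α w) (hm : AEStronglyMeasurable w (volume.restrict (cell R))) :
    AEStronglyMeasurable w (volume.restrict (strip R)) := by
  refine AEStronglyMeasurable.mono_set (strip_subset_iUnion_tile R) ?_
  rw [aestronglyMeasurable_iUnion_iff]
  intro j
  rw [← (measurePreserving_tile R j).map_eq,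
    (measurableEmbedding_addRight (shift j)).aestronglyMeasurable_map_iff]
  exact (hm.const_smul (phase α j)).congr ((ae_cell_of_strip (hw j)).mono fun x hx => hx.symm)

/-- The `L¹` norm over a bounded part of the strip is controlled by that over a cell. -/
lemma exists_tile_bound (R : ℝ) (α : E2) (ρ : ℝ) : ∃ N : ℕ, ∀ w : E3 → V, QuasiPeriodic R α w →
    ∫⁻ x in strip R ∩ Metric.closedBall 0 ρ, ‖w x‖ₑ ≤ N * ∫⁻ x in cell R, ‖w x‖ₑ := by
  set S : Finset Idx := Fintype.piFinset fun _ : Fin 2 => Finset.Icc (-⌈ρ + 1⌉) ⌈ρ + 1⌉ with hS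
  refine ⟨S.card, fun w hw => ?_⟩
  have hsub : strip R ∩ Metric.closedBall 0 ρ ⊆ ⋃ j : S, tile R j := by
    rintro x ⟨hx, hr⟩
    obtain ⟨j, hj⟩ := exists_mem_tile hx
    exact mem_iUnion.2 ⟨⟨j, index_mem_of_mem_tile hj (mem_closedBall_zero_iff.1 hr)⟩, hj⟩
  refine (lintegral_mono_set hsub).trans ((lintegral_iUnion_le _ _).trans ?_)
  rw [tsum_fintype]
  have h (j : Idx) : ∫⁻ x in tile R j, ‖w x‖ₑ = ∫⁻ x in cell R, ‖w x‖ₑ := by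
    rw [← (measurePreserving_tile R j).map_eq,
      (measurableEmbedding_addRight (shift j)).lintegral_map]
    refine lintegral_congr_ae ?_
    filter_upwards [ae_cell_of_strip (hw j)] with x hx
    rw [hx, enorm_smul, ← ofReal_norm, norm_phase, ENNReal.ofReal_one, one_mul]
  simp only [h, Finset.sum_const, nsmul_eq_mul, Finset.card_univ, Fintype.card_coe]
  exact le_rfl

lemma QuasiPeriodic.integrableOn {R : ℝ} {α : E2} {w : E3 → V} (hw : QuasiPeriodic R α w)
    (hi : Integrable w (volume.restrict (cell R))) (ρ : ℝ) :
    IntegrableOn w (strip R ∩ Metric.closedBall 0 ρ) := by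
  obtain ⟨N, hN⟩ := exists_tile_bound (V := V) R α ρ
  refine ⟨(hw.aestronglyMeasurable hi.1).mono_set inter_subset_left, (hN w hw).trans_lt ?_⟩
  exact ENNReal.mul_lt_top (ENNReal.natCast_lt_top N) hi.2

lemma QuasiPeriodic.locallyIntegrableOn {R : ℝ} {α : E2} {w : E3 → V} (hw : QuasiPeriodic R α w)
    (hi : Integrable w (volume.restrict (cell R))) : LocallyIntegrableOn w (strip R) := by
  intro x _
  refine ⟨strip R ∩ Metric.closedBall 0 (‖x‖ + 1), ?_, hw.integrableOn hi _⟩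
  refine inter_mem self_mem_nhdsWithin (mem_nhdsWithin_of_mem_nhds ?_)
  refine mem_of_superset (Metric.ball_mem_nhds x one_pos) fun y hy => ?_
  rw [mem_closedBall_zero_iff]
  have h1 := norm_le_norm_add_norm_sub' y x
  have h2 := (mem_ball_iff_norm.1 hy).le
  linarith

variable [NormedSpace ℝ V]

/-- The constant is independent of `w`; hence mean convergence on one cell implies convergence of
integrals over the strip against a fixed test function. -/
lemma exists_test_bound (R : ℝ) (α : E2) {ψ : E3 → ℝ} (hψ : Continuous ψ)
    (hc : HasCompactSupport ψ) : ∃ C : ENNReal, C ≠ ⊤ ∧ ∀ w : E3 → V, QuasiPeriodic R α w →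
      ∫⁻ x in strip R, ‖ψ x • w x‖ₑ ≤ C * ∫⁻ x in cell R, ‖w x‖ₑ := by
  obtain ⟨ρ, hρ⟩ := hc.isCompact.isBounded.subset_closedBall 0
  obtain ⟨B, hB⟩ := hψ.bounded_above_of_compact_support hc
  obtain ⟨N, hN⟩ := exists_tile_bound (V := V) R α ρ
  refine ⟨ENNReal.ofReal B * N, ENNReal.mul_ne_top ENNReal.ofReal_ne_top
    (ENNReal.natCast_ne_top N), fun w hw => ?_⟩
  have h1 : ∫⁻ x in strip R, ‖ψ x • w x‖ₑ = ∫⁻ x in strip R ∩ Metric.closedBall 0 ρ,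
      ‖ψ x • w x‖ₑ := by
    rw [inter_comm, ← setLIntegral_indicator Metric.isClosed_closedBall.measurableSet]
    refine lintegral_congr fun x => ?_
    by_cases hx : x ∈ Metric.closedBall (0 : E3) ρ
    · rw [indicator_of_mem hx]
    · rw [indicator_of_notMem hx, image_eq_zero_of_notMem_tsupport (mt (@hρ x) hx)]
      simp
  rw [h1, mul_assoc]
  refine le_trans ?_ (mul_le_mul_right (hN w hw) _)
  rw [← lintegral_const_mul' _ _ ENNReal.ofReal_ne_top]
  refine lintegral_mono fun x => ?_
  rw [enorm_smul]
  refine mul_le_mul_left ?_ _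
  rw [← ofReal_norm]
  exact ENNReal.ofReal_le_ofReal (hB x)

lemma QuasiPeriodic.integrable_smul {R : ℝ} {α : E2} {w : E3 → V} (hw : QuasiPeriodic R α w)
    (hi : Integrable w (volume.restrict (cell R))) {ψ : E3 → ℝ} (hψ : Continuous ψ)
    (hc : HasCompactSupport ψ) : IntegrableOn (fun x => ψ x • w x) (strip R) := by
  obtain ⟨C, hC, hb⟩ := exists_test_bound (V := V) R α hψ hc
  exact ⟨hψ.aestronglyMeasurable.smul (hw.aestronglyMeasurable hi.1),
    (hb w hw).trans_lt (ENNReal.mul_lt_top hC.lt_top hi.2)⟩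

lemma tendsto_integral_smul {R : ℝ} {α : E2} {ι : Type*} {l : Filter ι} {w : ι → E3 → V}
    {g : E3 → V} (hw : ∀ n, QuasiPeriodic R α (w n)) (hg : QuasiPeriodic R α g)
    (hwi : ∀ n, Integrable (w n) (volume.restrict (cell R)))
    (hgi : Integrable g (volume.restrict (cell R)))
    (h : Tendsto (fun n => ∫⁻ x in cell R, ‖w n x - g x‖ₑ) l (𝓝 0)) {ψ : E3 → ℝ}
    (hψ : Continuous ψ) (hc : HasCompactSupport ψ) :
    Tendsto (fun n => ∫ x in strip R, ψ x • w n x) l (𝓝 (∫ x in strip R, ψ x • g x)) := by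
  obtain ⟨C, hC, hb⟩ := exists_test_bound (V := V) R α hψ hc
  refine tendsto_integral_of_L1 _ (hg.integrable_smul hgi hψ hc).1
    (Eventually.of_forall fun n => (hw n).integrable_smul (hwi n) hψ hc) ?_
  have h1 : Tendsto (fun n => C * ∫⁻ x in cell R, ‖w n x - g x‖ₑ) l (𝓝 0) := by
    have := ENNReal.Tendsto.const_mul h (Or.inr hC)
    rwa [mul_zero] at this
  refine tendsto_of_tendsto_of_tendsto_of_le_of_le tendsto_const_nhds h1 (fun _ => zero_le)
    fun n => ?_
  refine le_trans (le_of_eq (lintegral_congr fun x => ?_)) (hb _ ((hw n).sub hg))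
  rw [smul_sub]

end QP

lemma MemL2.quasiPeriodic {R : ℝ} {α : E2} {u : E3 → C3} (hu : MemL2 R α u) :
    QuasiPeriodic R α u := hu.2

lemma isOpen_strip (R : ℝ) : IsOpen (strip R) := by
  have h : Continuous fun x : E3 => x 2 := by fun_prop
  exact (isOpen_lt continuous_const h).inter (isOpen_lt h continuous_const)

/-- Weak partial derivatives are unique. -/
lemma IsWeakPartial.ae_eq {R : ℝ} {α : E2} {i : Fin 3} {u g h : E3 → C3} (hg : MemL2 R α g)
    (hh : MemL2 R α h) (h1 : IsWeakPartial R i u g) (h2 : IsWeakPartial R i u h) :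
    g =ᵐ[volume.restrict (cell R)] h := by
  have ig := hg.1.integrable one_le_two
  have ih := hh.1.integrable one_le_two
  have hz := (isOpen_strip R).ae_eq_zero_of_integral_contDiff_smul_eq_zero
    (f := fun x => g x - h x) ((hg.quasiPeriodic.sub hh.quasiPeriodic).locallyIntegrableOn
      (ig.sub ih)) fun φ hφ hc hs => by
    have e := (h1 φ ⟨hφ, hc, hs⟩).symm.trans (h2 φ ⟨hφ, hc, hs⟩)
    rw [neg_inj] at e
    have hsub : ∫ x in strip R, φ x • (g x - h x) = 0 := by
      simp only [smul_sub]
      rw [integral_sub (hg.quasiPeriodic.integrable_smul ig hφ.continuous hc)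
        (hh.quasiPeriodic.integrable_smul ih hφ.continuous hc), e, sub_self]
    rw [← hsub]
    symm
    refine setIntegral_eq_integral_of_forall_compl_eq_zero fun x hx => ?_
    rw [image_eq_zero_of_notMem_tsupport (mt (@hs x) hx), zero_smul]
  refine ae_cell_of_strip (R := R) ?_
  rw [ae_restrict_iff' (measurableSet_strip R)]
  filter_upwards [hz] with x hx hxs
  exact sub_eq_zero.1 (hx hxs)

/-! ### Synthesis of functions from horizontal Fourier coefficients -/

/-- The quasi-periodic function whose only nonzero horizontal Fourier coefficient is `h`. -/
def modeTerm (α : E2) (j : Idx) (h : ℝ → ℂ) (x : E3) : ℂ :=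
  ((2 * Real.pi : ℝ) : ℂ)⁻¹ * h (x 2) * (starRingEnd ℂ) (planeWave α j (hor x))

lemma norm_modeTerm (α : E2) (j : Idx) (h : ℝ → ℂ) (x : E3) :
    ‖modeTerm α j h x‖ = ‖((2 * Real.pi : ℝ) : ℂ)⁻¹ * h (x 2)‖ := by
  rw [modeTerm, norm_mul, RCLike.norm_conj, norm_planeWave, mul_one]

lemma quasiPeriodic_modeTerm (R : ℝ) (α : E2) (j : Idx) (h : ℝ → ℂ) :
    QuasiPeriodic R α (modeTerm α j h) := fun l => Eventually.of_forall fun x => by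
  rw [modeTerm, planeWave_shift, (add_shift_apply x l).2.2, modeTerm, smul_eq_mul]
  ring

lemma memLp_modeTerm {R : ℝ} (α : E2) (j : Idx) {h : ℝ → ℂ}
    (hh : MemLp h 2 (volume.restrict (Ioo 0 R))) :
    MemLp (modeTerm α j h) 2 (volume.restrict (cell R)) := by
  have h1 : MemLp (fun p : E2 × ℝ => h p.2) 2
      ((volume.restrict square).prod (volume.restrict (Ioo 0 R))) := hh.comp_snd _
  have h2 : MemLp (fun x : E3 => h (x 2)) 2 (volume.restrict (cell R)) := by
    rw [← (measurePreserving_emb_cell R).map_eq, measurableEmbedding_emb.memLp_map_measure_iff]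
    exact h1
  have h3 := h2.const_mul ((2 * Real.pi : ℝ) : ℂ)⁻¹
  refine h3.of_le ?_ (Eventually.of_forall fun x => (norm_modeTerm α j h x).le)
  exact h3.1.mul (Complex.continuous_conj.comp ((continuous_planeWave α j).comp
    continuous_hor)).aestronglyMeasurable

lemma fourierCoef_modeTerm (α : E2) (j l : Idx) (h : ℝ → ℂ) (t : ℝ) :
    fourierCoef t α (modeTerm α j h) l = if l = j then h t else 0 := by
  have hp : ((2 * Real.pi : ℝ) : ℂ) ≠ 0 := by
    have : (2 * Real.pi) ≠ 0 := by positivity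
    exact_mod_cast this
  rw [fourierCoef_eq_sliceCoef]
  have e : (fun y => modeTerm α j h (emb (y, t))) =
      fun y => (starRingEnd ℂ) (planeWave α j y) • (((2 * Real.pi : ℝ) : ℂ)⁻¹ * h t) := by
    ext y; simp only [modeTerm, emb_two, hor_emb, smul_eq_mul, mul_comm]
  rw [e, sliceCoef_planeWave]
  split_ifs
  · rw [smul_eq_mul, mul_inv_cancel_left₀ hp]
  · rfl

/-- Partial sums of horizontal Fourier series. -/
def modeSum (α : E2) (h : Idx → ℝ → ℂ) (s : Finset Idx) (x : E3) : ℂ :=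
  ∑ j ∈ s, modeTerm α j (h j) x

lemma modeSum_shift (α : E2) (h : Idx → ℝ → ℂ) (s : Finset Idx) (x : E3) (l : Idx) :
    modeSum α h s (x + shift l) = phase α l * modeSum α h s x := by
  rw [modeSum, modeSum, Finset.mul_sum]
  refine Finset.sum_congr rfl fun j _ => ?_
  rw [modeTerm, planeWave_shift, (add_shift_apply x l).2.2, modeTerm]
  ring

lemma quasiPeriodic_modeSum (R : ℝ) (α : E2) (h : Idx → ℝ → ℂ) (s : Finset Idx) :
    QuasiPeriodic R α (modeSum α h s) := fun l =>
  Eventually.of_forall fun x => modeSum_shift α h s x l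

section Sums

variable {R : ℝ} {α : E2} {h : Idx → ℝ → ℂ}

lemma memLp_modeSum
    (hh : ∀ j, MemLp (h j) 2 (volume.restrict (Ioo 0 R))) (s : Finset Idx) : MemLp (modeSum α h s) 2 (volume.restrict (cell R)) :=
  memLp_finsetSum s fun j _ => memLp_modeTerm α j (hh j)

lemma fourierCoef_modeSum
    (hh : ∀ j, MemLp (h j) 2 (volume.restrict (Ioo 0 R))) (s : Finset Idx) (l : Idx) : ∀ᵐ t ∂volume.restrict (Ioo 0 R),
    fourierCoef t α (modeSum α h s) l = if l ∈ s then h l t else 0 := by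
  classical
  induction s using Finset.induction_on with
  | empty =>
    refine Eventually.of_forall fun t => ?_
    have : modeSum α h ∅ = fun x => (0 : ℂ) • (0 : ℂ) := by ext x; simp [modeSum]
    rw [this, fourierCoef_const_smul]
    simp
  | insert j s hj ih =>
    have e : modeSum α h (insert j s) = fun x => modeTerm α j (h j) x + modeSum α h s x := by
      ext x; exact Finset.sum_insert hj
    filter_upwards [ih, fourierCoef_add_ae (α := α)
      ((memLp_modeTerm α j (hh j)).integrable one_le_two)
      ((memLp_modeSum hh s).integrable one_le_two) l] with t h1 h2
    rw [e, h2, h1, fourierCoef_modeTerm]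
    by_cases hl : l = j
    · subst hl; simp [hj]
    · simp [hl]

lemma hasSum_integral_sub_modeSum
    (hh : ∀ j, MemLp (h j) 2 (volume.restrict (Ioo 0 R)))
    {f : E3 → ℂ} (hf : MemLp f 2 (volume.restrict (cell R)))
    (s : Finset Idx) :
    HasSum (fun j => ∫ t in Ioo 0 R, ‖fourierCoef t α f j - if j ∈ s then h j t else 0‖ ^ 2)
      (∫ x in cell R, ‖f x - modeSum α h s x‖ ^ 2) := by
  have hs := memLp_modeSum (α := α) hh s
  refine (hasSum_integral_fourierCoef (α := α) (hf.sub hs)).congr_fun fun j => ?_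
  refine integral_congr_ae ?_
  filter_upwards [fourierCoef_modeSum (α := α) hh s j, fourierCoef_sub_ae (α := α)
    (hf.integrable one_le_two) (hs.integrable one_le_two) j] with t h1 h2
  rw [← h1, ← h2]; rfl

lemma integral_modeSum_sq
    (hh : ∀ j, MemLp (h j) 2 (volume.restrict (Ioo 0 R))) (s : Finset Idx) :
    ∫ x in cell R, ‖modeSum α h s x‖ ^ 2 = ∑ j ∈ s, ∫ t in Ioo 0 R, ‖h j t‖ ^ 2 := by
  refine (hasSum_integral_fourierCoef (α := α) (memLp_modeSum hh s)).unique ?_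
  have e (j : Idx) : ∫ t in Ioo 0 R, ‖fourierCoef t α (modeSum α h s) j‖ ^ 2 =
      if j ∈ s then ∫ t in Ioo 0 R, ‖h j t‖ ^ 2 else 0 := by
    rw [integral_congr_ae (g := fun t => ‖if j ∈ s then h j t else 0‖ ^ 2)
      ((fourierCoef_modeSum (α := α) hh s j).mono fun t ht => by simp only [ht])]
    split_ifs <;> simp
  simp only [e]
  have := hasSum_sum_of_ne_finset_zero (s := s) (L := .unconditional _)
    (f := fun j => if j ∈ s then ∫ t in Ioo 0 R, ‖h j t‖ ^ 2 else 0) fun j hj => if_neg hj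
  rwa [Finset.sum_congr rfl fun j hj => if_pos hj] at this

end Sums

lemma toReal_eLpNorm_two_sq {X E : Type*} [MeasurableSpace X] {m : Measure X}
    [NormedAddCommGroup E] {f : X → E} (hf : MemLp f 2 m) :
    (eLpNorm f 2 m).toReal ^ 2 = ∫ x, ‖f x‖ ^ 2 ∂m := by
  have h0 : 0 ≤ ∫ x, ‖f x‖ ^ 2 ∂m := integral_nonneg fun x => by positivity
  rw [hf.eLpNorm_eq_integral_rpow_norm two_ne_zero (by simp)]
  have e : ∫ x, ‖f x‖ ^ (2 : ENNReal).toReal ∂m = ∫ x, ‖f x‖ ^ 2 ∂m := by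
    simp
  rw [e, ENNReal.toReal_ofReal (by positivity), ENNReal.toReal_ofNat, ← Real.rpow_natCast,
    ← Real.rpow_mul h0]
  norm_num

/-- This is the Cauchy–Schwarz inequality against the constant one; it passes from `L²` to mean
convergence on the cell. -/
lemma lintegral_enorm_sq_le {X E : Type*} [MeasurableSpace X] {m : Measure X}
    [NormedAddCommGroup E] {f : X → E} (hf : MemLp f 2 m) :
    ∫⁻ x, ‖f x‖ₑ ∂m ≤ ENNReal.ofReal (Real.sqrt (∫ x, ‖f x‖ ^ 2 ∂m)) * m univ ^ (1 / 2 : ℝ) := by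
  rw [← eLpNorm_one_eq_lintegral_enorm, ← toReal_eLpNorm_two_sq hf,
    Real.sqrt_sq ENNReal.toReal_nonneg, ENNReal.ofReal_toReal hf.2.ne]
  refine (eLpNorm_le_eLpNorm_mul_rpow_measure_univ (p := 1) (q := 2) one_le_two hf.1).trans ?_
  norm_num

/-- Convergence of horizontal Fourier series in the mean. -/
def SumsTo (R : ℝ) (α : E2) (h : Idx → ℝ → ℂ) (g : E3 → ℂ) : Prop :=
  Tendsto (fun s => ∫⁻ x in cell R, ‖modeSum α h s x - g x‖ₑ) atTop (𝓝 0)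

lemma sumsTo_of_integral_sq {R : ℝ} {α : E2} {h : Idx → ℝ → ℂ} {g : E3 → ℂ}
    (hh : ∀ j, MemLp (h j) 2 (volume.restrict (Ioo 0 R)))
    (hg : MemLp g 2 (volume.restrict (cell R)))
    (hl : Tendsto (fun s => ∫ x in cell R, ‖modeSum α h s x - g x‖ ^ 2) atTop (𝓝 0)) :
    SumsTo R α h g := by
  have h1 : Tendsto (fun s => ENNReal.ofReal
      (Real.sqrt (∫ x in cell R, ‖modeSum α h s x - g x‖ ^ 2)) *
        (volume.restrict (cell R)) univ ^ (1 / 2 : ℝ)) atTop (𝓝 0) := by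
    have h2 := (Real.continuous_sqrt.tendsto 0).comp hl
    rw [Real.sqrt_zero] at h2
    have h3 := ENNReal.tendsto_ofReal h2
    rw [ENNReal.ofReal_zero] at h3
    have h4 := ENNReal.Tendsto.mul_const (b := (volume.restrict (cell R)) univ ^ (1 / 2 : ℝ)) h3
      (Or.inr (ENNReal.rpow_ne_top_of_nonneg (by norm_num) (measure_ne_top _ _)))
    rwa [zero_mul] at h4
  exact tendsto_of_tendsto_of_tendsto_of_le_of_le tendsto_const_nhds h1 (fun _ => zero_le)
    fun s => lintegral_enorm_sq_le ((memLp_modeSum hh s).sub hg)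

/-- The Fourier series of a square integrable function converges to it. -/
lemma sumsTo_of_fourierCoef {R : ℝ} {α : E2} {h : Idx → ℝ → ℂ} {g : E3 → ℂ}
    (hh : ∀ j, MemLp (h j) 2 (volume.restrict (Ioo 0 R)))
    (hg : MemLp g 2 (volume.restrict (cell R)))
    (hc : ∀ j, ∀ᵐ t ∂volume.restrict (Ioo 0 R), fourierCoef t α g j = h j t) :
    SumsTo R α h g := by
  refine sumsTo_of_integral_sq hh hg ?_
  have hS := hasSum_integral_fourierCoef (α := α) hg
  -- Subtracting a partial sum cancels the coefficients in `s` and keeps the others, so the squared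
  -- error is the tail of the Parseval series.
  have e (s : Finset Idx) : ∫ x in cell R, ‖modeSum α h s x - g x‖ ^ 2 =
      (∫ x in cell R, ‖g x‖ ^ 2) - ∑ j ∈ s, ∫ t in Ioo 0 R, ‖fourierCoef t α g j‖ ^ 2 := by
    simp only [norm_sub_rev _ (g _)]
    refine (hasSum_integral_sub_modeSum (α := α) hh hg s).unique ?_
    have h1 := hS.sub (hasSum_sum_of_ne_finset_zero (s := s) (L := .unconditional _)
      (f := fun j => if j ∈ s then ∫ t in Ioo 0 R, ‖fourierCoef t α g j‖ ^ 2 else 0)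
      fun j hj => if_neg hj)
    rw [Finset.sum_congr rfl fun j hj => if_pos hj] at h1
    refine h1.congr_fun fun j => ?_
    by_cases hj : j ∈ s
    · simp only [hj, if_true, sub_self]
      rw [integral_congr_ae (g := fun _ => (0 : ℝ)) ((hc j).mono fun t ht => by simp [ht]),
        integral_zero]
    · simp only [hj, if_false, sub_zero]
  simp only [e]
  have := (tendsto_const_nhds (x := ∫ x in cell R, ‖g x‖ ^ 2)).sub hS
  rwa [sub_self] at this

/-- Square summable horizontal Fourier coefficients are those of a quasi-periodic function. -/
lemma exists_sumsTo {R : ℝ} {α : E2} {h : Idx → ℝ → ℂ}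
    (hh : ∀ j, MemLp (h j) 2 (volume.restrict (Ioo 0 R)))
    (hs : Summable fun j => ∫ t in Ioo 0 R, ‖h j t‖ ^ 2) :
    ∃ g : E3 → ℂ, QuasiPeriodic R α g ∧ MemLp g 2 (volume.restrict (cell R)) ∧
      ∫ x in cell R, ‖g x‖ ^ 2 = ∑' j, ∫ t in Ioo 0 R, ‖h j t‖ ^ 2 ∧ SumsTo R α h g := by
  set e : Idx → Lp ℂ 2 (volume.restrict (cell R)) := fun j => (memLp_modeTerm α j (hh j)).toLp
  have hsum (s : Finset Idx) : ∑ j ∈ s, e j = (memLp_modeSum (α := α) hh s).toLp := by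
    refine Lp.ext ?_
    refine (Lp.coeFn_finsetSum s e).trans ?_
    have h1 : ∀ᵐ x ∂volume.restrict (cell R), ∀ j, e j x = modeTerm α j (h j) x :=
      ae_all_iff.2 fun j => (memLp_modeTerm α j (hh j)).coeFn_toLp
    filter_upwards [h1, (memLp_modeSum (α := α) hh s).coeFn_toLp] with x h2 h3
    rw [h3, Finset.sum_apply, modeSum]
    exact Finset.sum_congr rfl fun j _ => h2 j
  have hnorm (s : Finset Idx) : ‖∑ j ∈ s, e j‖ ^ 2 = ∑ j ∈ s, ∫ t in Ioo 0 R, ‖h j t‖ ^ 2 := by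
    rw [hsum, Lp.norm_toLp, toReal_eLpNorm_two_sq (memLp_modeSum hh s), integral_modeSum_sq hh]
  -- Orthogonality gives the squared norm of a finite sum as the sum of the squared norms, so the
  -- Cauchy criterion for the series in `Lp` is that for the given real series.
  have hse : Summable e := by
    rw [summable_iff_vanishing_norm]
    intro η hη
    obtain ⟨s, hs'⟩ := summable_iff_vanishing_norm.1 hs (η ^ 2) (by positivity)
    refine ⟨s, fun t ht => ?_⟩
    have h1 := hs' t ht
    rw [← hnorm, Real.norm_of_nonneg (by positivity)] at h1
    exact lt_of_pow_lt_pow_left₀ 2 hη.le h1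
  obtain ⟨G, hG⟩ := hse
  have hGm := Lp.memLp G
  have hGt : Tendsto (fun s => ∑ j ∈ s, e j) atTop (𝓝 G) := hG
  have hsq : Tendsto (fun s => ∫ x in cell R, ‖modeSum α h s x - G x‖ ^ 2) atTop (𝓝 0) := by
    have h1 := (tendsto_iff_norm_sub_tendsto_zero.1 hGt).pow 2
    rw [zero_pow two_ne_zero] at h1
    refine h1.congr fun s => ?_
    rw [hsum]
    have e1 : (memLp_modeSum (α := α) hh s).toLp - G =
        ((memLp_modeSum (α := α) hh s).sub hGm).toLp := by
      rw [MemLp.toLp_sub _ hGm, Lp.toLp_coeFn]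
    rw [e1, Lp.norm_toLp, toReal_eLpNorm_two_sq ((memLp_modeSum hh s).sub hGm)]
    rfl
  have hmeas : TendstoInMeasure (volume.restrict (cell R)) (fun s => modeSum α h s) atTop G := by
    refine tendstoInMeasure_of_tendsto_eLpNorm one_ne_zero (fun s => (memLp_modeSum hh s).1) hGm.1 ?_
    simp only [eLpNorm_one_eq_lintegral_enorm]
    exact sumsTo_of_integral_sq hh hGm hsq
  obtain ⟨ns, -, hns⟩ := hmeas.exists_seq_tendsto_ae'
  -- The limit `G` in `Lp` is determined only on the cell. A pointwise limit along a subsequence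
  -- also makes sense on every translate and inherits quasi-periodicity from the partial sums, which
  -- satisfy it at every point.
  set g : E3 → ℂ := fun x => limUnder atTop fun n => modeSum α h (ns n) x with hg
  have hgG : g =ᵐ[volume.restrict (cell R)] G := hns.mono fun x hx => hx.limUnder_eq
  have hconv : ∀ᵐ x ∂volume.restrict (strip R), ∃ z, Tendsto (fun n => modeSum α h (ns n) x)
      atTop (𝓝 z) := by
    refine ae_strip_of_cell fun l => hns.mono fun x hx => ⟨phase α l * G x, ?_⟩
    simp only [modeSum_shift]
    exact hx.const_mul _
  have hgm : MemLp g 2 (volume.restrict (cell R)) := hGm.ae_eq hgG.symm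
  have hsq' : Tendsto (fun s => ∫ x in cell R, ‖modeSum α h s x - g x‖ ^ 2) atTop (𝓝 0) := by
    refine hsq.congr fun s => integral_congr_ae ?_
    filter_upwards [hgG] with x hx
    rw [hx]
  refine ⟨g, fun l => ?_, hgm, ?_, sumsTo_of_integral_sq hh hgm hsq'⟩
  · filter_upwards [hconv] with x hx
    obtain ⟨z, hz⟩ := hx
    have h1 : g x = z := hz.limUnder_eq
    have h2 : g (x + shift l) = phase α l * z := by
      refine Tendsto.limUnder_eq ?_
      simp only [modeSum_shift]
      exact hz.const_mul _
    rw [h1, h2, smul_eq_mul]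
  · rw [integral_congr_ae (g := fun x => ‖G x‖ ^ 2) (hgG.mono fun x hx => by simp only [hx]),
      ← toReal_eLpNorm_two_sq hGm, ← Lp.norm_def]
    have h1 := (hGt.norm).pow 2
    simp only [hnorm] at h1
    exact tendsto_nhds_unique h1 hs.hasSum

/-! ### Weak derivatives of horizontal Fourier series -/

lemma IsTest.continuous_partialD {R : ℝ} {φ : E3 → ℝ} (hφ : IsTest R φ) (i : Fin 3) :
    Continuous (partialD i φ) :=
  (hφ.smooth.continuous_fderiv (by simp)).clm_apply continuous_const

lemma IsTest.hasCompactSupport_partialD {R : ℝ} {φ : E3 → ℝ} (hφ : IsTest R φ) (i : Fin 3) :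
    HasCompactSupport (partialD i φ) := hφ.compact.fderiv_apply (𝕜 := ℝ) _

lemma IsTest.eq_zero {R : ℝ} {φ : E3 → ℝ} (hφ : IsTest R φ) {x : E3} (hx : x ∉ strip R) :
    φ x = 0 := image_eq_zero_of_notMem_tsupport (mt (@hφ.supp x) hx)

lemma IsTest.partialD_eq_zero {R : ℝ} {φ : E3 → ℝ} (hφ : IsTest R φ) (i : Fin 3) {x : E3}
    (hx : x ∉ strip R) : partialD i φ x = 0 := by
  rw [partialD, fderiv_of_notMem_tsupport (𝕜 := ℝ) (mt (@hφ.supp x) hx)]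
  rfl

lemma setIntegral_smul_eq {V : Type*} [NormedAddCommGroup V] [NormedSpace ℝ V] {R : ℝ}
    {ψ : E3 → ℝ} (h : ∀ x ∉ strip R, ψ x = 0) (w : E3 → V) :
    ∫ x in strip R, ψ x • w x = ∫ x, ψ x • w x :=
  setIntegral_eq_integral_of_forall_compl_eq_zero fun x hx => by rw [h x hx, zero_smul]

/-- A continuous function with a continuous line derivative has it as weak derivative. -/
lemma isWeakPartial_of_hasLineDerivAt {R : ℝ} {i : Fin 3} {w w' : E3 → ℂ} (hw : Continuous w)
    (hw' : Continuous w')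
    (h : ∀ x, HasLineDerivAt ℝ w (w' x) x (EuclideanSpace.single i (1 : ℝ))) :
    IsWeakPartial R i w w' := by
  intro φ hφ
  rw [setIntegral_smul_eq (fun x hx => hφ.partialD_eq_zero i hx),
    setIntegral_smul_eq (fun x hx => hφ.eq_zero hx)]
  have hc := hφ.smooth.continuous
  exact integral_bilinear_hasLineDerivAt_right_eq_neg_left_of_integrable
    (B := (ContinuousLinearMap.lsmul ℝ ℝ : ℝ →L[ℝ] ℂ →L[ℝ] ℂ).flip) (f := w) (f' := w') (g := φ)
    (g' := partialD i φ) (v := EuclideanSpace.single i (1 : ℝ))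
    ((hc.smul hw').integrable_of_hasCompactSupport hφ.compact.smul_right)
    (((hφ.continuous_partialD i).smul hw).integrable_of_hasCompactSupport
      (hφ.hasCompactSupport_partialD i).smul_right)
    ((hc.smul hw).integrable_of_hasCompactSupport hφ.compact.smul_right) (fun x _ => h x)
    fun x _ => (hφ.smooth.differentiable (by simp) x).hasFDerivAt.hasLineDerivAt _

lemma continuous_modeTerm (α : E2) (j : Idx) {h : ℝ → ℂ} (hh : Continuous h) :
    Continuous (modeTerm α j h) :=
  (continuous_const.mul (hh.comp (by fun_prop))).mul
    (Complex.continuous_conj.comp ((continuous_planeWave α j).comp continuous_hor))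

lemma modeTerm_line (α : E2) (j : Idx) (h : ℝ → ℂ) (x : E3) (s : ℝ) :
    modeTerm α j h (x + s • EuclideanSpace.single 0 (1 : ℝ)) =
      modeTerm α j h x * Complex.exp (-(Complex.I * (wave α j 0 : ℂ)) * s) ∧
    modeTerm α j h (x + s • EuclideanSpace.single 1 (1 : ℝ)) =
      modeTerm α j h x * Complex.exp (-(Complex.I * (wave α j 1 : ℂ)) * s) := by
  simp only [modeTerm, conj_planeWave_hor]
  refine ⟨?_, ?_⟩
  · rw [mul_assoc (_ * _) (Complex.exp _), ← Complex.exp_add]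
    congr 2
    · simp
    · simp; ring
  · rw [mul_assoc (_ * _) (Complex.exp _), ← Complex.exp_add]
    congr 2
    · simp
    · simp; ring

lemma hasDerivAt_mul_exp (z c : ℂ) :
    HasDerivAt (fun s : ℝ => z * Complex.exp (c * s)) (c * z) 0 := by
  have h1 : HasDerivAt (fun s : ℝ => c * (s : ℂ)) c 0 := by
    simpa using (Complex.ofRealCLM.hasDerivAt (x := 0)).const_mul c
  have h2 := (h1.cexp).const_mul z
  simpa [mul_comm] using h2

lemma modeTerm_const_mul (α : E2) (j : Idx) (h : ℝ → ℂ) (c : ℂ) :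
    modeTerm α j (fun t => c * h t) = fun x => c * modeTerm α j h x := by
  ext x; simp only [modeTerm]; ring

lemma isWeakPartial_modeTerm_zero (R : ℝ) (α : E2) (j : Idx) {h : ℝ → ℂ} (hh : Continuous h) :
    IsWeakPartial R 0 (modeTerm α j h)
      (modeTerm α j fun t => -(Complex.I * (wave α j 0 : ℂ)) * h t) := by
  rw [modeTerm_const_mul]
  refine isWeakPartial_of_hasLineDerivAt (continuous_modeTerm α j hh)
    (continuous_const.mul (continuous_modeTerm α j hh)) fun x => ?_
  simp only [HasLineDerivAt, (modeTerm_line α j h x _).1]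
  exact hasDerivAt_mul_exp _ _

lemma isWeakPartial_modeTerm_one (R : ℝ) (α : E2) (j : Idx) {h : ℝ → ℂ} (hh : Continuous h) :
    IsWeakPartial R 1 (modeTerm α j h)
      (modeTerm α j fun t => -(Complex.I * (wave α j 1 : ℂ)) * h t) := by
  rw [modeTerm_const_mul]
  refine isWeakPartial_of_hasLineDerivAt (continuous_modeTerm α j hh)
    (continuous_const.mul (continuous_modeTerm α j hh)) fun x => ?_
  simp only [HasLineDerivAt, (modeTerm_line α j h x _).2]
  exact hasDerivAt_mul_exp _ _

lemma contDiff_emb_right (y : E2) : ContDiff ℝ ∞ fun t : ℝ => emb (y, t) := by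
  rw [contDiff_euclidean]
  intro i
  fin_cases i
  · exact (contDiff_const : ContDiff ℝ ∞ fun _ : ℝ => y 0)
  · exact (contDiff_const : ContDiff ℝ ∞ fun _ : ℝ => y 1)
  · exact (contDiff_id : ContDiff ℝ ∞ fun t : ℝ => t)

lemma deriv_comp_emb {φ : E3 → ℝ} (hφ : ContDiff ℝ ∞ φ) (y : E2) (t : ℝ) :
    deriv (fun s => φ (emb (y, s))) t = partialD 2 φ (emb (y, t)) := by
  have h : HasLineDerivAt ℝ φ (partialD 2 φ (emb (y, t))) (emb (y, t))
      (EuclideanSpace.single 2 (1 : ℝ)) :=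
    (hφ.differentiable (by simp) _).hasFDerivAt.hasLineDerivAt _
  have e (s : ℝ) : emb (y, t) + s • EuclideanSpace.single 2 (1 : ℝ) = emb (y, t + s) := by
    ext i
    fin_cases i <;> simp [emb]
  simp only [HasLineDerivAt, e] at h
  rw [← sub_self t] at h
  have h2 := h.comp_sub_const t t
  simp only [add_sub_cancel] at h2
  exact h2.deriv

/-- The amplitude `F` is only absolutely continuous, so integration by parts is done on each
vertical segment, where the test function vanishes at both ends. -/
lemma isWeakPartial_modeTerm_two {R : ℝ} (hR : 0 < R) (α : E2) (j : Idx) {F f : ℝ → ℂ}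
    (hF : IsPrimitive F f) (hf : MemLp f 2 (volume.restrict (Ioo 0 R))) :
    IsWeakPartial R 2 (modeTerm α j F) (modeTerm α j f) := by
  intro φ hφ
  have i1 := (quasiPeriodic_modeTerm R α j F).integrable_smul
    ((memLp_modeTerm α j (memLp_two_Ioo_of_continuous hF.continuous R)).integrable one_le_two)
    (hφ.continuous_partialD 2) (hφ.hasCompactSupport_partialD 2)
  have i2 := (quasiPeriodic_modeTerm R α j f).integrable_smul
    ((memLp_modeTerm α j hf).integrable one_le_two) hφ.smooth.continuous hφ.compact
  have i3 : IntegrableOn (fun x => partialD 2 φ x • modeTerm α j F x +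
    φ x • modeTerm α j f x) (strip R) := i1.add i2
  rw [← sub_eq_zero, sub_neg_eq_add, ← integral_add i1 i2, integral_strip i3]
  refine integral_eq_zero_of_ae (Eventually.of_forall fun y => ?_)
  have hχ : ContDiff ℝ ∞ fun t => φ (emb (y, t)) := hφ.smooth.comp (contDiff_emb_right y)
  have h1 := ((IsPrimitive.of_contDiff hχ).mul hF).integral_Ioo hR
  have z0 : φ (emb (y, 0)) = 0 := hφ.eq_zero fun h => lt_irrefl _ h.1
  have zR : φ (emb (y, R)) = 0 := hφ.eq_zero fun h => lt_irrefl _ h.2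
  simp only [z0, zR, Complex.ofReal_zero, zero_mul, sub_self, deriv_comp_emb hφ.smooth] at h1
  have h2 := congrArg (fun z => ((2 * Real.pi : ℝ) : ℂ)⁻¹ *
    (starRingEnd ℂ) (planeWave α j y) * z) h1
  simp only [mul_zero] at h2
  rw [← integral_const_mul] at h2
  simp only [Pi.zero_apply]
  rw [← h2]
  refine integral_congr_ae (Eventually.of_forall fun t => ?_)
  simp only [modeTerm, emb_two, hor_emb, Complex.real_smul]
  ring

lemma isWeakPartial_modeSum {R : ℝ} {α : E2} {i : Fin 3} {h h' : Idx → ℝ → ℂ}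
    (hh : ∀ j, MemLp (h j) 2 (volume.restrict (Ioo 0 R)))
    (hh' : ∀ j, MemLp (h' j) 2 (volume.restrict (Ioo 0 R)))
    (hd : ∀ j, IsWeakPartial R i (modeTerm α j (h j)) (modeTerm α j (h' j))) (s : Finset Idx) :
    IsWeakPartial R i (modeSum α h s) (modeSum α h' s) := by
  intro φ hφ
  simp only [modeSum, Finset.smul_sum]
  rw [integral_finsetSum, integral_finsetSum, ← Finset.sum_neg_distrib]
  · exact Finset.sum_congr rfl fun j _ => hd j φ hφ
  · exact fun j _ => (quasiPeriodic_modeTerm R α j _).integrable_smul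
      ((memLp_modeTerm α j (hh' j)).integrable one_le_two) hφ.smooth.continuous hφ.compact
  · exact fun j _ => (quasiPeriodic_modeTerm R α j _).integrable_smul
      ((memLp_modeTerm α j (hh j)).integrable one_le_two) (hφ.continuous_partialD i)
      (hφ.hasCompactSupport_partialD i)

/-- The identity holds for the finite partial sums, and both sides are continuous for mean
convergence on the cell. -/
lemma isWeakPartial_of_sumsTo {R : ℝ} {α : E2} {i : Fin 3} {h h' : Idx → ℝ → ℂ} {w g : E3 → ℂ}
    (hh : ∀ j, MemLp (h j) 2 (volume.restrict (Ioo 0 R)))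
    (hh' : ∀ j, MemLp (h' j) 2 (volume.restrict (Ioo 0 R)))
    (hd : ∀ j, IsWeakPartial R i (modeTerm α j (h j)) (modeTerm α j (h' j)))
    (hw : QuasiPeriodic R α w) (hwi : Integrable w (volume.restrict (cell R)))
    (hg : QuasiPeriodic R α g) (hgi : Integrable g (volume.restrict (cell R)))
    (sw : SumsTo R α h w) (sg : SumsTo R α h' g) : IsWeakPartial R i w g := by
  intro φ hφ
  have h1 := tendsto_integral_smul (fun s => quasiPeriodic_modeSum R α h s) hw
    (fun s => (memLp_modeSum hh s).integrable one_le_two) hwi sw (hφ.continuous_partialD i)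
    (hφ.hasCompactSupport_partialD i)
  have h2 := (tendsto_integral_smul (fun s => quasiPeriodic_modeSum R α h' s) hg
    (fun s => (memLp_modeSum hh' s).integrable one_le_two) hgi sg hφ.smooth.continuous
    hφ.compact).neg
  refine tendsto_nhds_unique h1 (h2.congr fun s => ?_)
  exact (isWeakPartial_modeSum hh hh' hd s φ hφ).symm

/-! ### Regularity of fields with a mode system -/

/-- The modes of the partial derivatives of a function with modes `F`, where `f = F'`. -/
def gradCoef (α : E2) (F f : Idx → Fin 3 → ℝ → ℂ) (l : Fin 3) (i : Fin 3) (j : Idx) : ℝ → ℂ :=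
  ![fun t => -(Complex.I * (wave α j 0 : ℂ)) * F j l t,
    fun t => -(Complex.I * (wave α j 1 : ℂ)) * F j l t, f j l] i

section Regularity

variable {R : ℝ} {α : E2} {u : E3 → C3} {F f : Idx → Fin 3 → ℝ → ℂ}

lemma sum_gradCoef (F f : Idx → Fin 3 → ℝ → ℂ) (j : Idx) :
    ∑ i, ∑ l, ∫ t in Ioo 0 R, ‖gradCoef α F f l i j t‖ ^ 2 = modeGrad R α F f j := by
  rw [Finset.sum_comm, modeGrad]
  refine Finset.sum_congr rfl fun l _ => ?_
  have e (c : ℝ) : ∫ t in Ioo 0 R, ‖-(Complex.I * (c : ℂ)) * F j l t‖ ^ 2 =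
      c ^ 2 * ∫ t in Ioo 0 R, ‖F j l t‖ ^ 2 := by
    rw [← integral_const_mul]
    refine integral_congr_ae (Eventually.of_forall fun t => ?_)
    simp [mul_pow]
  rw [Fin.sum_univ_three, norm_wave_sq]
  simp only [gradCoef, Matrix.cons_val_zero, Matrix.cons_val_one, Matrix.cons_val_two,
    Matrix.head_cons, Matrix.tail_cons, e]
  ring

lemma ModeSystem.memLp_mode (h : ModeSystem R α u F f) (j : Idx) (l : Fin 3) :
    MemLp (F j l) 2 (volume.restrict (Ioo 0 R)) :=
  memLp_two_Ioo_of_continuous (h.prim j l).continuous R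

lemma ModeSystem.memLp_gradCoef (h : ModeSystem R α u F f) (l i : Fin 3) (j : Idx) :
    MemLp (gradCoef α F f l i j) 2 (volume.restrict (Ioo 0 R)) := by
  fin_cases i
  · exact (h.memLp_mode j l).const_mul _
  · exact (h.memLp_mode j l).const_mul _
  · exact h.memLp j l

lemma ModeSystem.isWeakPartial (h : ModeSystem R α u F f) (hR : 0 < R) (l i : Fin 3) (j : Idx) :
    IsWeakPartial R i (modeTerm α j (F j l)) (modeTerm α j (gradCoef α F f l i j)) := by
  fin_cases i
  · exact isWeakPartial_modeTerm_zero R α j (h.prim j l).continuous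
  · exact isWeakPartial_modeTerm_one R α j (h.prim j l).continuous
  · exact isWeakPartial_modeTerm_two hR α j (h.prim j l) (h.memLp j l)

lemma summable_gradCoef (hs : Summable (modeGrad R α F f)) (l i : Fin 3) :
    Summable fun j => ∫ t in Ioo 0 R, ‖gradCoef α F f l i j t‖ ^ 2 := by
  have h0 (l i : Fin 3) (j : Idx) : 0 ≤ ∫ t in Ioo 0 R, ‖gradCoef α F f l i j t‖ ^ 2 :=
    integral_nonneg fun t => by positivity
  refine hs.of_nonneg_of_le (h0 l i) fun j => ?_
  rw [← sum_gradCoef]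
  refine le_trans ?_ (Finset.single_le_sum
    (fun i _ => Finset.sum_nonneg fun l _ => h0 l i j) (Finset.mem_univ i))
  exact Finset.single_le_sum (f := fun l => ∫ t in Ioo 0 R, ‖gradCoef α F f l i j t‖ ^ 2)
    (fun l _ => h0 l i j) (Finset.mem_univ l)

/-- Each component of the derivative is synthesized from the modes `gradCoef`, which are square
summable by finite energy. The Fourier series of the component of `u` itself converges, and its
termwise derivatives converge to the synthesized function. -/
lemma ModeSystem.exists_weakPartial (h : ModeSystem R α u F f) (hR : 0 < R) (hu : MemL2 R α u)
    (hs : Summable (modeGrad R α F f)) (i : Fin 3) :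
    ∃ g, MemL2 R α g ∧ IsWeakPartial R i u g ∧
      sqL2 R g = ∑' j, ∑ l, ∫ t in Ioo 0 R, ‖gradCoef α F f l i j t‖ ^ 2 := by
  choose g hq hm hn hS using fun l => exists_sumsTo (α := α) (fun j => h.memLp_gradCoef l i j)
    (summable_gradCoef hs l i)
  have hgm : MemL2 R α fun x => WithLp.toLp 2 fun l => g l x := by
    refine ⟨MemLp.of_eval_piLp fun l => hm l, fun j => ?_⟩
    filter_upwards [ae_all_iff.2 fun l => hq l j] with x hx
    ext l
    exact hx l
  refine ⟨_, hgm, fun φ hφ => ?_, ?_⟩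
  · have iu := hu.quasiPeriodic.integrable_smul (hu.1.integrable one_le_two)
      (hφ.continuous_partialD i) (hφ.hasCompactSupport_partialD i)
    have ig := hgm.quasiPeriodic.integrable_smul (hgm.1.integrable one_le_two)
      hφ.smooth.continuous hφ.compact
    ext l
    rw [PiLp.neg_apply, eval_integral_piLp fun l => iu.eval_piLp l,
      eval_integral_piLp fun l => ig.eval_piLp l]
    have hul : QuasiPeriodic R α fun x => u x l := fun j => by
      filter_upwards [hu.2 j] with x hx
      rw [hx]; rfl
    exact isWeakPartial_of_sumsTo (h := fun j => F j l) (fun j => h.memLp_mode j l)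
      (fun j => h.memLp_gradCoef l i j) (fun j => h.isWeakPartial hR l i j) hul
      (hu.comp_integrable l) (hq l) ((hm l).integrable one_le_two)
      (sumsTo_of_fourierCoef (fun j => h.memLp_mode j l) (hu.comp l) fun j => h.coef j l) (hS l)
      φ hφ
  · rw [sqL2_eq_sum hgm, Summable.tsum_finsetSum fun l _ => summable_gradCoef hs l i]
    exact Finset.sum_congr rfl fun l _ => hn l

/-- A field with a mode system of finite energy belongs to `H¹`, with the expected norm. -/
lemma ModeSystem.memH1 (h : ModeSystem R α u F f) (hR : 0 < R) (hu : MemL2 R α u)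
    (hs : Summable (modeGrad R α F f)) :
    MemH1 R α u ∧ sqH1 R α u = sqL2 R u + ∑' j, modeGrad R α F f j := by
  have hex (i) := h.exists_weakPartial hR hu hs i
  refine ⟨⟨hu, fun i => ?_⟩, ?_⟩
  · obtain ⟨g, h1, h2, -⟩ := hex i
    exact ⟨g, h1, h2⟩
  · have e (i : Fin 3) : sqL2 R (weakPartial R α i u) =
        ∑' j, ∑ l, ∫ t in Ioo 0 R, ‖gradCoef α F f l i j t‖ ^ 2 := by
      obtain ⟨g, h1, h2, h3⟩ := hex i
      have hg : ∃ g, MemL2 R α g ∧ IsWeakPartial R i u g := ⟨g, h1, h2⟩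
      -- The derivative picked by `weakPartial` need not be the synthesized one; uniqueness almost
      -- everywhere gives equal norms.
      rw [← h3, weakPartial, dif_pos hg]
      refine integral_congr_ae ?_
      filter_upwards [hg.choose_spec.2.ae_eq hg.choose_spec.1 h1 h2] with x hx
      rw [hx]
    rw [sqH1]
    simp only [e]
    rw [← Summable.tsum_finsetSum fun i _ => summable_sum fun l _ => summable_gradCoef hs l i]
    simp only [sum_gradCoef]

end Regularity

/-! ### Trace estimates -/

section Trace

variable {R : ℝ} {α : E2} {u : E3 → C3} {F f : Idx → Fin 3 → ℝ → ℂ}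

/-- The contribution of the mode `j` to the squared `L²` norm. -/
def modeMass (R : ℝ) (F : Idx → Fin 3 → ℝ → ℂ) (j : Idx) : ℝ :=
  ∑ l, ∫ t in Ioo 0 R, ‖F j l t‖ ^ 2

/-- The endpoint bound applies to both tangential components, which vanish at height `0`. The
difference on the right is the energy of the vertical derivatives alone; keeping it in this form
allows `η` to depend on the mode. -/
lemma ModeSystem.norm_trace_sq_le (h : ModeSystem R α u F f) (hR : 0 < R) (j : Idx) {η : ℝ}
    (hη : 0 < η) :
    ‖topTrace R α u j‖ ^ 2 ≤ η * (modeGrad R α F f j - ‖wave α j‖ ^ 2 * modeMass R F j) +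
      η⁻¹ * modeMass R F j := by
  have h0 := (h.prim j 0).norm_sq_end_le hR (h.zero₀ j) (h.memLp j 0) hη
  have h1 := (h.prim j 1).norm_sq_end_le hR (h.zero₁ j) (h.memLp j 1) hη
  rw [h.top₀] at h0
  rw [h.top₁] at h1
  have e : modeGrad R α F f j - ‖wave α j‖ ^ 2 * modeMass R F j =
      ∑ l, ∫ t in Ioo 0 R, ‖f j l t‖ ^ 2 := by
    rw [modeGrad, modeMass, Finset.sum_add_distrib, ← Finset.mul_sum]; ring
  rw [e, modeMass, EuclideanSpace.norm_sq_eq, Fin.sum_univ_two, Fin.sum_univ_three,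
    Fin.sum_univ_three]
  have p1 : 0 ≤ ∫ t in Ioo 0 R, ‖f j 2 t‖ ^ 2 := integral_nonneg fun t => by positivity
  have p2 : 0 ≤ ∫ t in Ioo 0 R, ‖F j 2 t‖ ^ 2 := integral_nonneg fun t => by positivity
  have p3 := mul_nonneg hη.le p1
  have p4 := mul_nonneg (inv_pos.2 hη).le p2
  linarith

lemma modeMass_nonneg (R : ℝ) (F : Idx → Fin 3 → ℝ → ℂ) (j : Idx) : 0 ≤ modeMass R F j :=
  Finset.sum_nonneg fun l _ => integral_nonneg fun t => by positivity

/-- A single `η` serves all modes here, giving an `L²` trace bound with an arbitrarily small weight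
on the gradient. -/
lemma ModeSystem.tsum_trace_sq_le (h : ModeSystem R α u F f) (hR : 0 < R) (hu : MemL2 R α u)
    (hs : Summable (modeGrad R α F f)) {η : ℝ} (hη : 0 < η) :
    (Summable fun j => ‖topTrace R α u j‖ ^ 2) ∧
      ∑' j, ‖topTrace R α u j‖ ^ 2 ≤ η * ∑' j, modeGrad R α F f j + η⁻¹ * sqL2 R u := by
  have hS := (hs.hasSum.mul_left η).add ((h.hasSum hu).mul_left η⁻¹)
  have hle (j) : ‖topTrace R α u j‖ ^ 2 ≤ η * modeGrad R α F f j + η⁻¹ * modeMass R F j := by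
    refine (h.norm_trace_sq_le hR j hη).trans ?_
    have := mul_nonneg hη.le (mul_nonneg (sq_nonneg ‖wave α j‖) (modeMass_nonneg R F j))
    linarith
  have hsum := hS.summable.of_nonneg_of_le (fun j => sq_nonneg _) hle
  exact ⟨hsum, (hsum.tsum_le_tsum hle hS.summable).trans hS.tsum_eq.le⟩

/-- With `b = (1 + |α_j|²)^{1/2}` the choice `η = b⁻¹` bounds `b |φ_j|²` by the vertical energy plus
`b²` times the mass. The part `|α_j|²` of `b²` completes the gradient and the remaining `1` gives
the mass. -/
lemma ModeSystem.sqHs_trace_le (h : ModeSystem R α u F f) (hR : 0 < R) (hu : MemL2 R α u)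
    (hs : Summable (modeGrad R α F f)) :
    sqHs α (1 / 2) (topTrace R α u) ≤ (∑' j, modeGrad R α F f j) + sqL2 R u := by
  have hS := hs.hasSum.add (h.hasSum hu)
  have hle (j) : (1 + ‖wave α j‖ ^ 2) ^ (1 / 2 : ℝ) * ‖topTrace R α u j‖ ^ 2 ≤
      modeGrad R α F f j + modeMass R F j := by
    have hp : 0 < 1 + ‖wave α j‖ ^ 2 := by positivity
    set b := (1 + ‖wave α j‖ ^ 2) ^ (1 / 2 : ℝ) with hb
    have hb0 : 0 < b := Real.rpow_pos_of_pos hp _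
    have hbb : b * b = 1 + ‖wave α j‖ ^ 2 := by
      rw [hb, ← Real.rpow_add hp]; norm_num
    have h1 := mul_le_mul_of_nonneg_left (h.norm_trace_sq_le hR j (inv_pos.2 hb0)) hb0.le
    rw [inv_inv, mul_add, mul_inv_cancel_left₀ hb0.ne', ← mul_assoc, hbb] at h1
    linarith
  have hsum := hS.summable.of_nonneg_of_le (fun j => by positivity) hle
  exact (hsum.tsum_le_tsum hle hS.summable).trans hS.tsum_eq.le

end Trace

/-! ### The boundary form -/

lemma abs_wave_apply_le (α : E2) (j : Idx) (i : Fin 2) : |α i + j i| ≤ ‖wave α j‖ := by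
  fin_cases i
  · exact PiLp.norm_apply_le (wave α j) 0
  · exact PiLp.norm_apply_le (wave α j) 1

lemma finite_wave_le (α : E2) (M : ℝ) : {j : Idx | ‖wave α j‖ ≤ M}.Finite := by
  refine (Set.Finite.pi (t := fun i : Fin 2 => Icc (⌊-M - α i⌋) ⌈M - α i⌉)
    fun i => finite_Icc _ _).subset fun j hj i _ => ?_
  have h := abs_le.1 ((abs_wave_apply_le α j i).trans hj)
  constructor
  · have : ((⌊-M - α i⌋ : ℤ) : ℝ) ≤ j i := (Int.floor_le _).trans (by linarith)
    exact_mod_cast this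
  · have : (j i : ℝ) ≤ ((⌈M - α i⌉ : ℤ) : ℝ) := le_trans (by linarith) (Int.le_ceil _)
    exact_mod_cast this

/-- Only finitely many wave vectors satisfy `k < |α_j| ≤ k + 1`, each with a positive root; beyond
`k + 1` one has `|α_j|² - k² ≥ 1`. -/
lemma exists_gap {k : ℝ} (hk : 0 < k) (α : E2) :
    ∃ s, 0 < s ∧ ∀ j : Idx, k < ‖wave α j‖ → s ≤ Real.sqrt (‖wave α j‖ ^ 2 - k ^ 2) := by
  have hpos (j : Idx) (h : k < ‖wave α j‖) : 0 < Real.sqrt (‖wave α j‖ ^ 2 - k ^ 2) :=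
    Real.sqrt_pos.2 (sub_pos.2 (pow_lt_pow_left₀ h hk.le two_ne_zero))
  have h1 : ∀ᶠ s in 𝓝[>] (0 : ℝ), ∀ j ∈ {j : Idx | ‖wave α j‖ ≤ k + 1}, k < ‖wave α j‖ →
      s ≤ Real.sqrt (‖wave α j‖ ^ 2 - k ^ 2) := by
    rw [eventually_all_finite (finite_wave_le α (k + 1))]
    intro j _
    by_cases h : k < ‖wave α j‖
    · filter_upwards [Ioo_mem_nhdsGT (hpos j h)] with s hs _ using hs.2.le
    · exact Eventually.of_forall fun s h' => absurd h' h
  obtain ⟨s, ⟨hs, hs1⟩, hs0⟩ := ((h1.and (Ioo_mem_nhdsGT one_pos)).and self_mem_nhdsWithin).exists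
  refine ⟨s, hs0, fun j hj => ?_⟩
  by_cases h : ‖wave α j‖ ≤ k + 1
  · exact hs j h hj
  · refine hs1.2.le.trans (Real.le_sqrt_of_sq_le ?_)
    have := pow_le_pow_left₀ (by positivity) (not_le.1 h).le 2
    nlinarith

lemma norm_waveDot_sq_le (α : E2) (j : Idx) (φ : C2) :
    ‖waveDot α j φ‖ ^ 2 ≤ ‖wave α j‖ ^ 2 * ‖φ‖ ^ 2 := by
  have h1 : ‖waveDot α j φ‖ ≤ |wave α j 0| * ‖φ 0‖ + |wave α j 1| * ‖φ 1‖ := by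
    refine (norm_add_le _ _).trans (le_of_eq ?_)
    rw [norm_mul, norm_mul, Complex.norm_real, Complex.norm_real, Real.norm_eq_abs,
      Real.norm_eq_abs]
  refine (pow_le_pow_left₀ (norm_nonneg _) h1 2).trans ?_
  rw [norm_wave_sq, EuclideanSpace.norm_sq_eq, Fin.sum_univ_two, ← sq_abs (wave α j 0),
    ← sq_abs (wave α j 1)]
  nlinarith [sq_nonneg (|wave α j 0| * ‖φ 1‖ - |wave α j 1| * ‖φ 0‖)]

lemma inner_waveC (α : E2) (j : Idx) (φ : C2) :
    inner ℂ φ (waveC α j) = (starRingEnd ℂ) (waveDot α j φ) := by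
  rw [PiLp.inner_apply, Fin.sum_univ_two]
  simp [waveC, waveDot]

lemma inner_opNT (k : ℝ) (α : E2) (φ : Idx → C2) (j : Idx) :
    inner ℂ (φ j) (opNT k α φ j) =
      -Complex.I / beta k α j * ((‖waveDot α j (φ j)‖ ^ 2 : ℝ) : ℂ) -
        Complex.I * beta k α j * ((‖φ j‖ ^ 2 : ℝ) : ℂ) := by
  rw [opNT, opN, opT, inner_sub_right, inner_smul_right, inner_smul_right, inner_waveC,
    inner_self_eq_norm_sq_to_K, mul_assoc, Complex.mul_conj']
  push_cast
  rfl

/-- Propagating modes contribute only an imaginary part. For `β_j = i b` the real part is `b |φ|² -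
|α_j · φ|² / b`; since `|α_j · φ|² ≤ (b² + k²) |φ|²`, the terms growing with `b` cancel and `-k² / b
|φ|²` remains. -/
lemma re_inner_opNT_ge {k s : ℝ} (hs : 0 < s) {α : E2}
    (hgap : ∀ j : Idx, k < ‖wave α j‖ → s ≤ Real.sqrt (‖wave α j‖ ^ 2 - k ^ 2))
    (φ : Idx → C2) (j : Idx) :
    -(k ^ 2 / s * ‖φ j‖ ^ 2) ≤ (inner ℂ (φ j) (opNT k α φ j)).re := by
  rw [inner_opNT, beta]
  split_ifs with h
  · have e : -Complex.I / (Real.sqrt (k ^ 2 - ‖wave α j‖ ^ 2) : ℂ) *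
        ((‖waveDot α j (φ j)‖ ^ 2 : ℝ) : ℂ) -
        Complex.I * (Real.sqrt (k ^ 2 - ‖wave α j‖ ^ 2) : ℂ) * ((‖φ j‖ ^ 2 : ℝ) : ℂ) =
        Complex.I * ((-(‖waveDot α j (φ j)‖ ^ 2 / Real.sqrt (k ^ 2 - ‖wave α j‖ ^ 2)) -
          Real.sqrt (k ^ 2 - ‖wave α j‖ ^ 2) * ‖φ j‖ ^ 2 : ℝ) : ℂ) := by
      push_cast; ring
    rw [e, Complex.re_mul_ofReal, Complex.I_re, zero_mul]
    have : 0 ≤ k ^ 2 / s * ‖φ j‖ ^ 2 := by positivity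
    linarith
  · have hb := hgap j (not_le.1 h)
    set b := Real.sqrt (‖wave α j‖ ^ 2 - k ^ 2) with hbdef
    have hb0 : 0 < b := hs.trans_le hb
    have hbC : (b : ℂ) ≠ 0 := by exact_mod_cast hb0.ne'
    have hb2 : b ^ 2 = ‖wave α j‖ ^ 2 - k ^ 2 :=
      Real.sq_sqrt (Real.sqrt_pos.1 hb0).le
    have e : -Complex.I / (Complex.I * (b : ℂ)) * ((‖waveDot α j (φ j)‖ ^ 2 : ℝ) : ℂ) -
        Complex.I * (Complex.I * (b : ℂ)) * ((‖φ j‖ ^ 2 : ℝ) : ℂ) =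
        ((b * ‖φ j‖ ^ 2 - ‖waveDot α j (φ j)‖ ^ 2 / b : ℝ) : ℂ) := by
      have h1 : -Complex.I / (Complex.I * (b : ℂ)) = -(b : ℂ)⁻¹ := by
        field_simp
      rw [h1, ← mul_assoc Complex.I Complex.I, Complex.I_mul_I]
      push_cast; ring
    rw [e, Complex.ofReal_re]
    have h1 : ‖waveDot α j (φ j)‖ ^ 2 / b ≤ (b ^ 2 + k ^ 2) * ‖φ j‖ ^ 2 / b := by
      refine div_le_div_of_nonneg_right ?_ hb0.le
      rw [hb2, sub_add_cancel]
      exact norm_waveDot_sq_le α j _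
    have h2 : (b ^ 2 + k ^ 2) * ‖φ j‖ ^ 2 / b = b * ‖φ j‖ ^ 2 + k ^ 2 / b * ‖φ j‖ ^ 2 := by
      field_simp
    have h3 : k ^ 2 / b * ‖φ j‖ ^ 2 ≤ k ^ 2 / s * ‖φ j‖ ^ 2 :=
      mul_le_mul_of_nonneg_right (div_le_div_of_nonneg_left (sq_nonneg k) hs hb) (sq_nonneg _)
    linarith

lemma re_pairing_ge {k s : ℝ} (hs : 0 < s) {α : E2}
    (hgap : ∀ j : Idx, k < ‖wave α j‖ → s ≤ Real.sqrt (‖wave α j‖ ^ 2 - k ^ 2))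
    {φ : Idx → C2} (hφ : Summable fun j => ‖φ j‖ ^ 2) :
    -(k ^ 2 / s * ∑' j, ‖φ j‖ ^ 2) ≤ (pairing (opNT k α φ) φ).re := by
  rw [pairing]
  -- Without summability the pairing has the default value `0`, and the lower bound is then trivial.
  by_cases h : Summable fun j => inner ℂ (φ j) (opNT k α φ j)
  · rw [Complex.re_tsum h, ← tsum_mul_left, ← tsum_neg]
    exact (hφ.mul_left _).neg.tsum_le_tsum (fun j => re_inner_opNT_ge hs hgap φ j)
      (Complex.hasSum_re h.hasSum).summable
  · rw [tsum_eq_zero_of_not_summable h, Complex.zero_re, neg_nonpos]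
    exact mul_nonneg (by positivity) (tsum_nonneg fun j => sq_nonneg _)

/-- A real supremum of nonnegative terms is nonnegative even without an upper bound, its default
value then being `0`. -/
lemma constC_nonneg (k : ℝ) (α : E2) : 0 ≤ constC k α :=
  mul_nonneg (by positivity) (Real.iSup_nonneg fun j => by positivity)

/-- On the diagonal every summand is a nonnegative real number, so this term may be dropped from
lower bounds. -/
lemma re_correction_nonneg (k : ℝ) (α : E2) (φ : Idx → C2) :
    0 ≤ ((constC k α : ℂ) * ∑' j, (((1 + ‖wave α j‖ ^ 2) ^ (-1 / 2 : ℝ) : ℝ) : ℂ) *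
      inner ℂ (φ j) (φ j)).re := by
  have e (j : Idx) : (((1 + ‖wave α j‖ ^ 2) ^ (-1 / 2 : ℝ) : ℝ) : ℂ) * inner ℂ (φ j) (φ j) =
      (((1 + ‖wave α j‖ ^ 2) ^ (-1 / 2 : ℝ) * ‖φ j‖ ^ 2 : ℝ) : ℂ) := by
    rw [inner_self_eq_norm_sq_to_K]; push_cast; rfl
  simp only [e]
  rw [← Complex.ofReal_tsum, ← Complex.ofReal_mul, Complex.ofReal_re]
  exact mul_nonneg (constC_nonneg k α) (tsum_nonneg fun j => by positivity)

/-! ### The volume form -/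

lemma exists_volume_bound {R μ₀ : ℝ} (hμ₀ : 0 < μ₀) {μ : E3 → ℂ}
    (hμ : MemLp μ ⊤ (volume.restrict (strip R)))
    (hpos : ∀ᵐ x ∂volume.restrict (strip R), μ₀ ≤ (μ x).re) :
    ∃ m, 0 < m ∧ ∀ (ρ : ℝ) (c u : E3 → C3), MemLp c 2 (volume.restrict (cell R)) →
      MemLp u 2 (volume.restrict (cell R)) →
      m * sqL2 R c + ρ * sqL2 R u ≤
        (∫ x in cell R, ((μ x)⁻¹ * inner ℂ (c x) (c x) + (ρ : ℂ) * inner ℂ (u x) (u x))).re := by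
  obtain ⟨M, hM0, hM⟩ := memLp_top_bound hμ
  -- This constant comes from `Re μ⁻¹ = Re μ / |μ|²`; adding one to `M` keeps the denominator
  -- positive without a lower bound on `M`.
  refine ⟨μ₀ / (M + 1) ^ 2, by positivity, fun ρ c u hc hu => ?_⟩
  have e (v : C3) : inner ℂ v v = ((‖v‖ ^ 2 : ℝ) : ℂ) := by
    rw [inner_self_eq_norm_sq_to_K]; push_cast; rfl
  simp only [e]
  have ic := integrable_norm_sq hc
  have iu := integrable_norm_sq hu
  have i1 : Integrable (fun x => (μ x)⁻¹ * ((‖c x‖ ^ 2 : ℝ) : ℂ)) (volume.restrict (cell R)) := by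
    refine ic.ofReal.bdd_mul (c := μ₀⁻¹)
      (aestronglyMeasurable_cell_of_strip hμ.1).aemeasurable.inv.aestronglyMeasurable ?_
    filter_upwards [ae_cell_of_strip hpos] with x hx
    rw [norm_inv]
    exact inv_anti₀ hμ₀ (hx.trans (Complex.re_le_norm _))
  have i2 : Integrable (fun x => (ρ : ℂ) * ((‖u x‖ ^ 2 : ℝ) : ℂ)) (volume.restrict (cell R)) :=
    iu.ofReal.const_mul _
  have i3 : Integrable (fun x => (μ x)⁻¹ * ((‖c x‖ ^ 2 : ℝ) : ℂ) +
    (ρ : ℂ) * ((‖u x‖ ^ 2 : ℝ) : ℂ)) (volume.restrict (cell R)) := i1.add i2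
  rw [← integral_re_eq i3, sqL2, sqL2, ← integral_const_mul, ← integral_const_mul,
    ← integral_add (ic.const_mul _) (iu.const_mul _)]
  refine integral_mono_ae ((ic.const_mul _).add (iu.const_mul _)) i3.re ?_
  filter_upwards [ae_cell_of_strip hpos, ae_cell_of_strip hM] with x h1 h2
  have h3 : μ₀ / (M + 1) ^ 2 ≤ ((μ x)⁻¹).re := by
    rw [Complex.inv_re]
    refine div_le_div₀ (hμ₀.le.trans h1) h1 ?_ ?_
    · rw [Complex.normSq_eq_norm_sq]
      exact pow_pos (hμ₀.trans_le (h1.trans (Complex.re_le_norm _))) 2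
    · rw [Complex.normSq_eq_norm_sq]
      exact pow_le_pow_left₀ (norm_nonneg _) (by linarith) 2
  have h4 := mul_le_mul_of_nonneg_right h3 (sq_nonneg ‖c x‖)
  simp only [Complex.add_re, Complex.re_mul_ofReal, Complex.ofReal_re]
  exact add_le_add_left h4 _

end QPMaxwell

end

/-! ### Regularity and coercivity -/

theorem mainTheorem7
    (k R₀ R δ ε₀ μ₀ : ℝ) (hk : 0 < k) (hR₀ : 0 < R₀) (hR : R₀ ≤ R) (hδ : 0 < δ)
    (hε₀ : 0 < ε₀) (hμ₀ : 0 < μ₀)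
    (α : E2) (hα : ∀ i, |α i| ≤ 1 / 2) (hαk : ∀ j : Idx, ‖wave α j‖ ≠ k)
    (ε μ : E3 → ℂ)
    (hε : MemW1Inf R ε) (hεper : IsPeriodic R ε)
    (hεpos : ∀ᵐ x ∂volume.restrict (strip R), ε₀ ≤ (ε x).re)
    (hεone : ∀ᵐ x ∂volume.restrict (strip R), R₀ - δ < x 2 → ε x = 1)
    (hμ : MemLp μ ⊤ (volume.restrict (strip R))) (hμper : IsPeriodic R μ)
    (hμpos : ∀ᵐ x ∂volume.restrict (strip R), μ₀ ≤ (μ x).re)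
    (hμone : ∀ᵐ x ∂volume.restrict (strip R), R₀ - δ < x 2 → μ x = 1) :
    (∀ u, MemY k R α ε u → MemH1 R α u) ∧
    ∃ ρ₀ : ℝ, 0 < ρ₀ ∧ ∀ ρ : ℝ, ρ₀ ≤ ρ → ∃ c : ℝ, 0 < c ∧
      ∀ u, MemY k R α ε u →
        c * sqH1 R α u ≤ (formA k R α μ ρ u u).re ∧
        c * sqX R α u ≤ (formA k R α μ ρ u u).re := by
  have hRpos : 0 < R := hR₀.trans_le hR
  -- The height `R₀ - δ` may be negative, while the splitting of test functions needs a nonnegative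
  -- threshold.
  have hTR : max (R₀ - δ) 0 < R := max_lt (by linarith) hRpos
  obtain ⟨K, hK0, hK⟩ := exists_modeSystem hk (le_max_right _ _) hTR hε₀ hαk hε hεper hεpos
    (hεone.mono fun x hx h => hx ((le_max_left _ _).trans_lt h))
  obtain ⟨s, hs, hgap⟩ := exists_gap hk α
  obtain ⟨m, hm, hvol⟩ := exists_volume_bound hμ₀ hμ hμpos
  refine ⟨fun u hu => ?_, ?_⟩
  · obtain ⟨F, f, hsys, hsum, -⟩ := hK u hu
    exact (hsys.memH1 hRpos hu.memX.hcurl.1 hsum).1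
  set B := k ^ 2 / s with hB
  have hB0 : 0 ≤ B := by positivity
  -- With this `η` the gradient part of the boundary loss is at most `m / 4`; the `+ 1` covers small
  -- `B`.
  set η := m / (4 * (B + 1)) with hη
  have hη0 : 0 < η := by positivity
  have hBη : B * η ≤ m / 4 := by
    rw [hη, mul_div_assoc', div_le_div_iff₀ (by positivity) (by norm_num)]
    nlinarith
  -- The three summands of the threshold are a surplus of one `‖u‖²`, the divergence error in
  -- trading half of the curl term for the gradient, and the `L²` part of the trace bound. The `1 /
  -- 2` in `c` is there because `‖u‖²` occurs twice in the bound for the `X̃_α` norm.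
  refine ⟨1 + m / 2 * K + B * η⁻¹, by positivity, fun ρ hρ => ⟨min (1 / 2) (m / 4),
    by positivity, fun u hu => ?_⟩⟩
  obtain ⟨F, f, hsys, hsum, hG⟩ := hK u hu
  have huL := hu.memX.hcurl.1
  have hcL := (isWeakCurl_weakCurl hu.memX.hcurl).1
  have hH1 := (hsys.memH1 hRpos huL hsum).2
  have htr := hsys.tsum_trace_sq_le hRpos huL hsum hη0
  have hX := hsys.sqHs_trace_le hRpos huL hsum
  have hv := hvol ρ _ _ hcL.1 huL.1
  have hp := re_pairing_ge hs hgap htr.1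
  have hC := re_correction_nonneg k α (topTrace R α u)
  have hU := sqL2_nonneg R u
  have hC2 := sqL2_nonneg R (weakCurl R α u)
  have hG0 : 0 ≤ ∑' j, modeGrad R α F f j := tsum_nonneg fun j => modeGrad_nonneg R α F f j
  have hpB := mul_le_mul_of_nonneg_left htr.2 hB0
  have h1 := mul_le_mul_of_nonneg_right hBη hG0
  have h2 := mul_le_mul_of_nonneg_left hG (by positivity : 0 ≤ m / 2)
  have h3 := mul_le_mul_of_nonneg_right hρ hU
  rw [← hB] at hp
  -- Half of `m ‖curl u‖²` is kept. The other half yields `m / 2` times the gradient energy, and the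
  -- boundary loss consumes `m / 4` of it.
  have hmain : m / 2 * sqL2 R (weakCurl R α u) + m / 4 * ∑' j, modeGrad R α F f j + sqL2 R u ≤
      (formA k R α μ ρ u u).re := by
    rw [formA, Complex.add_re, Complex.add_re]
    linarith
  set c := min (1 / 2 : ℝ) (m / 4) with hc
  have hc1 : c ≤ 1 / 2 := min_le_left _ _
  have hc2 : c ≤ m / 4 := min_le_right _ _
  have hc0 : 0 ≤ c := by positivity
  have q1 := mul_le_mul_of_nonneg_right hc1 hU
  have q2 := mul_le_mul_of_nonneg_right hc2 hG0
  have q3 := mul_le_mul_of_nonneg_right hc2 hC2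
  have q4 := mul_nonneg hm.le hC2
  refine ⟨?_, ?_⟩
  · rw [hH1]; linarith
  · have h4 := mul_le_mul_of_nonneg_left hX hc0
    rw [sqX]; linarith
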